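/- Let $\mathbb H^2$ be the hyperbolic plane with its orientation, let $PSL_2\mathbb R$ act on it by orientation-preserving isometries, and let $\widetilde{PSL_2\mathbb R}\to PSL_2\mathbb R$ be the universal covering group, whose elements are the homotopy classes (relative to endpoints) of paths in $PSL_2\mathbb R$ starting at $1$. For $\tilde x\in\widetilde{PSL_2\mathbb R}$ covering $x$ and $y\in\mathbb H^2$, let $c:[0,1]\to\mathbb H^2$ be the constant-speed geodesic from $y$ to $xy$ and let $V$ be a continuous field of unit tangent vectors along $c$ of the form $V(t)=\gamma(t)\cdot V(0)$ with $\gamma$ a path in the class $\tilde x$. Let $\theta:[0,1]\to\mathbb R$ be a continuous choice of the angle, measured anticlockwise, from the direction of $c$ to $V$ (if $c$ is constant, its direction is replaced by a fixed unit vector at $y$). The twist of $\tilde x$ at $y$ is $\mathrm{Twist}(\tilde x,y)=\theta(1)-\theta(0)$. For $\alpha,\beta\in PSL_2\mathbb R$ and $p\in\mathbb H^2$, let $\mathrm{Pent}(\alpha,\beta;p)$ be the closed geodesic pentagon with successive, oriented sides $$p\to\alpha^{-1}\beta^{-1}\alpha\beta p\to\beta p\to\alpha\beta p\to\beta^{-1}\alpha\beta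 p\to p .$$ It is nondegenerate if all five sides have nonzero length. It bounds an immersed disc if there is a map $f:\overline D\to\mathbb H^2$ of the closed unit disc $\overline D\subset\mathbb C$ that is continuous and locally injective on $\overline D$, a smooth immersion on the open disc $D$, and maps the unit circle, traversed anticlockwise, onto $\mathrm{Pent}(\alpha,\beta;p)$ traversed once in the direction above (up to an orientation-preserving reparametrization of the circle). The signed area of the pentagon is then $\Delta[\mathrm{Pent}(\alpha,\beta;p)]=\int_D f^*\omega$, where $\omega$ is the hyperbolic area form; it is positive if $f$ preserves orientation and negative if $f$ reverses it. **Proposition (Commutator pentagon).** Let $\alpha,\beta\in PSL_2\mathbb R$ and $p\in\mathbb H^2$, and let $\tilde\alpha,\tilde\beta\in\widetilde{PSL_2\mathbb R}$ be any lifts of $\alpha,\beta$. Suppose that $\mathrm{Pent}(\alpha,\beta;p)$ is nondegenerate and bounds an immersed disc, and let $f$ be any such disc. Then the area integral converges absolutely, the twist of $[\tilde\alpha^{-1},\tilde\beta^{-1}]=\tilde\alpha^{-1}\tilde\beta^{-1}\tilde\alpha\tilde\beta$ at $p$ is well defined, and $$\mathrm{Twist}\big([\tilde\alpha^{-1},\tilde\beta^{-1}],p\big)=\Delta[\mathrm{Pent}(\alpha,\beta;p)].$$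 -/

import Mathlib

open scoped MatrixGroups unitInterval Topology ContDiff commutatorElement

/-! ### The universal covering group of a topological group -/

section UniversalCover

variable (G : Type*) [Group G] [TopologicalSpace G] [IsTopologicalGroup G]

/-- Continuous paths `[0,1] → G` starting at `1`, a group under pointwise multiplication. -/
def BasedPath : Subgroup C(I, G) where
  carrier := {γ | γ 0 = 1}
  mul_mem' := fun {a b} ha hb => by
    have ha' : a 0 = 1 := ha
    have hb' : b 0 = 1 := hb
    show (a * b) 0 = 1
    simp [ha', hb']
  one_mem' := rfl
  inv_mem' := fun {a} ha => by
    have ha' : a 0 = 1 := ha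
    show a⁻¹ 0 = 1
    simp [ha']

/-- Homotopy of based paths relative to both endpoints. It is compatible with
pointwise multiplication. -/
def pathCon : Con (BasedPath G) where
  r γ δ := ContinuousMap.HomotopicRel (γ : C(I, G)) (δ : C(I, G)) {0, 1}
  iseqv :=
    ⟨fun γ => ContinuousMap.HomotopicRel.refl _,
     fun h => ContinuousMap.HomotopicRel.symm h,
     fun h k => ContinuousMap.HomotopicRel.trans h k⟩
  mul' := by
    rintro w x y z ⟨F⟩ ⟨K⟩
    refine ⟨⟨⟨⟨fun p => F p * K p, by fun_prop⟩, ?_, ?_⟩, ?_⟩⟩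
    · intro t; simp
    · intro t; simp
    · intro s t ht
      have h1 := F.eq_fst s ht
      have h2 := K.eq_fst s ht
      simp [h1, h2]

/-- The universal covering group of `G` (for `G` a connected Lie group): homotopy classes,
relative to the endpoints, of paths starting at `1`, multiplied pointwise. -/
abbrev UnivCover : Type _ := (pathCon G).Quotient

variable {G}

/-- The covering projection: a class of paths is sent to its common endpoint. -/
def UnivCover.proj : UnivCover G →* G :=
  (pathCon G).lift
    { toFun := fun γ => (γ : C(I, G)) 1
      map_one' := rfl
      map_mul' := fun _ _ => rfl }
    (by
      rintro x y h
      have h' : ContinuousMap.HomotopicRel (x : C(I, G)) (y : C(I, G)) {0, 1} := h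
      exact h'.fst_eq_snd (by simp : (1 : I) ∈ ({0, 1} : Set I)))

end UniversalCover

/-! ### Unit tangent vectors of the hyperbolic plane, and the action of `PSL(2, ℝ)` -/

/-- A unit tangent vector of the upper half-plane: a tangent vector `vec ∈ ℂ` at `base ∈ ℍ`
whose length `‖vec‖ / base.im` in the hyperbolic metric is `1`. -/
@[ext]
structure UnitTangent where
  base : UpperHalfPlane
  vec : ℂ
  norm_vec : ‖vec‖ = base.im

namespace UnitTangent

/-- `g ∈ SL(2, ℝ)` acts on tangent vectors by the derivative `(c z + d)⁻²` of
`z ↦ (a z + b) / (c z + d)`. -/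
noncomputable instance : MulAction SL(2, ℝ) UnitTangent where
  smul g v := ⟨g • v.base, v.vec / (UpperHalfPlane.denom (g : GL (Fin 2) ℝ) v.base) ^ 2, by
    show _ = ((g : GL (Fin 2) ℝ) • v.base).im
    rw [UpperHalfPlane.im_smul_eq_div_normSq]
    simp [v.norm_vec, Complex.normSq_eq_norm_sq]⟩
  one_smul v := by
    apply UnitTangent.ext
    · exact one_smul _ v.base
    · show v.vec / (UpperHalfPlane.denom ((1 : SL(2, ℝ)) : GL (Fin 2) ℝ) v.base) ^ 2 = v.vec
      simp
  mul_smul g h v := by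
    apply UnitTangent.ext
    · exact mul_smul g h v.base
    · show v.vec / (UpperHalfPlane.denom ((g * h : SL(2, ℝ)) : GL (Fin 2) ℝ) v.base) ^ 2 =
        v.vec / (UpperHalfPlane.denom (h : GL (Fin 2) ℝ) v.base) ^ 2 /
          (UpperHalfPlane.denom (g : GL (Fin 2) ℝ) ((h • v.base : UpperHalfPlane) : ℂ)) ^ 2
      have hc := UpperHalfPlane.denom_cocycle (g : GL (Fin 2) ℝ) (h : GL (Fin 2) ℝ)
        v.base.im_ne_zero
      have hb : ((h • v.base : UpperHalfPlane) : ℂ) =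
          UpperHalfPlane.num (h : GL (Fin 2) ℝ) v.base /
            UpperHalfPlane.denom (h : GL (Fin 2) ℝ) v.base := by
        rw [UpperHalfPlane.coe_specialLinearGroup_apply]
        simp [UpperHalfPlane.num, UpperHalfPlane.denom]
      rw [hb, map_mul, hc, mul_pow, div_div, mul_comm]

/-- Rotate a tangent vector anticlockwise by the angle `θ`, keeping its base point. -/
noncomputable def rotate (θ : ℝ) (v : UnitTangent) : UnitTangent :=
  ⟨v.base, Complex.exp (θ * Complex.I) * v.vec, by
    rw [norm_mul, Complex.norm_exp_ofReal_mul_I, one_mul, v.norm_vec]⟩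

theorem center_smul {g : SL(2, ℝ)} (hg : g ∈ Subgroup.center SL(2, ℝ)) (v : UnitTangent) :
    g • v = v := by
  obtain ⟨r, hr, hrg⟩ := Matrix.SpecialLinearGroup.mem_center_iff.mp hg
  have hr2 : r ^ 2 = 1 := by simpa using hr
  have hr0 : r ≠ 0 := by rintro rfl; norm_num at hr2
  have h00 : g 0 0 = r := by rw [← hrg]; simp
  have h01 : g 0 1 = 0 := by rw [← hrg]; simp
  have h10 : g 1 0 = 0 := by rw [← hrg]; simp
  have h11 : g 1 1 = r := by rw [← hrg]; simp
  have hrc : (r : ℂ) ≠ 0 := by exact_mod_cast hr0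
  have hrc2 : (r : ℂ) ^ 2 = 1 := by exact_mod_cast hr2
  apply UnitTangent.ext
  · show g • v.base = v.base
    apply UpperHalfPlane.ext
    rw [UpperHalfPlane.coe_specialLinearGroup_apply]
    simp [h00, h01, h10, h11, hrc]
  · show v.vec / (UpperHalfPlane.denom (g : GL (Fin 2) ℝ) v.base) ^ 2 = v.vec
    simp [UpperHalfPlane.denom, h10, h11, hrc2]

/-- The action of `PSL(2, ℝ)` on unit tangent vectors, induced from `SL(2, ℝ)`. -/
noncomputable instance : MulAction PSL(2, ℝ) UnitTangent :=
  MulAction.compHom UnitTangent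
    (QuotientGroup.lift (Subgroup.center SL(2, ℝ)) (MulAction.toPermHom SL(2, ℝ) UnitTangent)
      (fun _ hg => Equiv.ext fun v => center_smul hg v))

end UnitTangent

theorem center_smul_upperHalfPlane {g : SL(2, ℝ)} (hg : g ∈ Subgroup.center SL(2, ℝ))
    (z : UpperHalfPlane) : g • z = z :=
  congrArg UnitTangent.base (UnitTangent.center_smul hg ⟨z, z.im, by simp [abs_of_pos z.im_pos]⟩)

/-- The action of `PSL(2, ℝ)` on the upper half-plane, induced from `SL(2, ℝ)`. -/
noncomputable instance : MulAction PSL(2, ℝ) UpperHalfPlane :=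
  MulAction.compHom UpperHalfPlane
    (QuotientGroup.lift (Subgroup.center SL(2, ℝ)) (MulAction.toPermHom SL(2, ℝ) UpperHalfPlane)
      (fun _ hg => Equiv.ext fun z => center_smul_upperHalfPlane hg z))

/-! ### Geodesics -/

/-- The unit velocity vector, at time `s`, of the unit-speed geodesic `s ↦ e ^ s * i`. -/
noncomputable def verticalVec (s : ℝ) : UnitTangent :=
  ⟨⟨Real.exp s * Complex.I, by
    rw [Complex.im_ofReal_mul, Complex.I_im, mul_one]; exact Real.exp_pos s⟩, Real.exp s * Complex.I, by
    rw [norm_mul, Complex.norm_I, mul_one, Complex.norm_real, Real.norm_of_nonneg (Real.exp_pos s).le]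
    show Real.exp s = (Real.exp s * Complex.I : ℂ).im
    rw [Complex.im_ofReal_mul, Complex.I_im, mul_one]⟩

/-- The unit velocity vector, at time `s`, of the unit-speed geodesic `s ↦ h • (e ^ s * i)`.
Every unit-speed geodesic of the upper half-plane is of this form for some `h ∈ SL(2, ℝ)`. -/
noncomputable def geodesicVec (h : SL(2, ℝ)) (s : ℝ) : UnitTangent := h • verticalVec s

/-- `geodesicVec h` parametrizes, on `[0, ℓ]`, the geodesic segment from `y` to `y'`
(with its velocity vectors), of length `ℓ ≥ 0`. -/
def IsGeodesicFromTo (h : SL(2, ℝ)) (ℓ : ℝ) (y y' : UpperHalfPlane) : Prop :=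
  0 ≤ ℓ ∧ (geodesicVec h 0).base = y ∧ (geodesicVec h ℓ).base = y'

/-- `c`, restricted to `[0, 1]`, is the constant-speed (possibly zero) geodesic
from `y` to `y'`. -/
def IsGeodesicSegment (c : ℝ → UpperHalfPlane) (y y' : UpperHalfPlane) : Prop :=
  ∃ (h : SL(2, ℝ)) (ℓ : ℝ), IsGeodesicFromTo h ℓ y y' ∧
    ∀ t ∈ Set.Icc (0 : ℝ) 1, c t = (geodesicVec h (t * ℓ)).base

theorem dist_geodesicVec (h : SL(2, ℝ)) (s t : ℝ) :
    dist (geodesicVec h s).base (geodesicVec h t).base = |s - t| := by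
  show dist (h • (verticalVec s).base) (h • (verticalVec t).base) = |s - t|
  rw [dist_smul, UpperHalfPlane.dist_of_re_eq (by simp [verticalVec, UpperHalfPlane.re])]
  have him : ∀ u : ℝ, (verticalVec u).base.im = Real.exp u := fun u => by
    show (Real.exp u * Complex.I : ℂ).im = Real.exp u
    rw [Complex.im_ofReal_mul, Complex.I_im, mul_one]
  rw [him, him, Real.log_exp, Real.log_exp, Real.dist_eq]

/-! ### The twist -/

/-- `τ` is the twist of `x`, an element of the universal covering group of `PSL(2, ℝ)`, at the
point `y`. Write `α` for the isometry covered by `x` and `c t`, `0 ≤ t ≤ 1`, for the constant-speed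
geodesic from `y` to `α y`. A path `V` of unit tangent vectors lies in the homotopy class `x` if
`V t = γ t • V 0` for a path `γ` in the class `x`. The twist is the total change `θ 1 - θ 0` of a
continuous choice `θ` of the angle, measured anticlockwise, from the direction of `c` to `V`, where
`V` lies along `c` and in the homotopy class `x`. (If `y = α y`, then `c` is constant and its
direction is replaced by a constant unit vector at `y`.) -/
def IsTwist (x : UnivCover PSL(2, ℝ)) (y : UpperHalfPlane) (τ : ℝ) : Prop :=
  ∃ (h : SL(2, ℝ)) (ℓ : ℝ), IsGeodesicFromTo h ℓ y (UnivCover.proj x • y) ∧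
    ∃ γ : BasedPath PSL(2, ℝ), (γ : UnivCover PSL(2, ℝ)) = x ∧
      ∃ V : I → UnitTangent, (∀ t, V t = (γ : C(I, PSL(2, ℝ))) t • V 0) ∧
        ∃ θ : C(I, ℝ), (∀ t, V t = (geodesicVec h (t * ℓ)).rotate (θ t)) ∧ τ = θ 1 - θ 0

/-! ### Polygons and immersed discs -/

/-- `P` runs through the closed geodesic polygon `v 0 → v 1 → ⋯ → v (n - 1) → v 0`, with period
`n` and constant speed on each side. -/
def IsPolygonLoop {n : ℕ} [NeZero n] (v : Fin n → UpperHalfPlane) (P : ℝ → UpperHalfPlane) :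
    Prop :=
  Function.Periodic P n ∧
    ∀ k : Fin n, IsGeodesicSegment (fun s => P (((k : ℕ) : ℝ) + s)) (v k) (v (k + 1))

/-- The closed unit disc in `ℂ` is mapped by `f` to an immersed disc in the hyperbolic plane bounded
by the closed polygon with successive vertices `v`: `f` is continuous and locally injective on the
closed disc, a smooth immersion on the open disc, and the unit circle, traversed anticlockwise, is
mapped to the polygon in its given direction, up to a reparametrization of the circle. The immersion
itself may preserve or reverse the orientation. -/
structure IsImmersedDisc {n : ℕ} [NeZero n] (v : Fin n → UpperHalfPlane)
    (f : ℂ → UpperHalfPlane) : Prop where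
  continuousOn : ContinuousOn f (Metric.closedBall 0 1)
  locally_injective : ∀ z ∈ Metric.closedBall (0 : ℂ) 1, ∃ U ∈ 𝓝 z,
    Set.InjOn f (U ∩ Metric.closedBall 0 1)
  smooth : ContDiffOn ℝ ∞ (fun z => (f z : ℂ)) (Metric.ball 0 1)
  immersion : ∀ z ∈ Metric.ball (0 : ℂ) 1,
    Function.Injective (fderiv ℝ (fun z => (f z : ℂ)) z)
  boundary : ∃ (P : ℝ → UpperHalfPlane) (φ : ℝ → ℝ), IsPolygonLoop v P ∧
    Continuous φ ∧ StrictMono φ ∧ (∀ t, φ (t + 1) = φ t + n) ∧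
    ∀ t : ℝ, f (Complex.exp (2 * Real.pi * t * Complex.I)) = P (φ t)

/-- The density, at `z`, of the pullback under `f` of the hyperbolic area form
`dx ∧ dy / y ^ 2`. -/
noncomputable def areaDensity (f : ℂ → UpperHalfPlane) (z : ℂ) : ℝ :=
  (fderiv ℝ (fun w => (f w : ℂ)) z).det / (f z).im ^ 2

/-- The signed area of the disc immersed by `f`: the integral over the open unit disc of the
pullback of the hyperbolic area form. -/
noncomputable def signedArea (f : ℂ → UpperHalfPlane) : ℝ :=
  ∫ z in Metric.ball (0 : ℂ) 1, areaDensity f z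

/-! ### The pentagon generated by two isometries at a point -/

/-- The successive vertices
`p → α⁻¹ β⁻¹ α β p → β p → α β p → β⁻¹ α β p (→ p)` of the pentagon. -/
noncomputable def pent (α β : PSL(2, ℝ)) (p : UpperHalfPlane) : Fin 5 → UpperHalfPlane :=
  ![p, (α⁻¹ * β⁻¹ * α * β) • p, β • p, (α * β) • p, (β⁻¹ * α * β) • p]

/-- All sides of the closed polygon have nonzero length. -/
def Nondegenerate {n : ℕ} [NeZero n] (v : Fin n → UpperHalfPlane) : Prop :=
  ∀ k : Fin n, v k ≠ v (k + 1)

open MeasureTheory Set Filter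

/-! The one-form `dx / y` is a primitive of the hyperbolic area form, so the signed area of a disc
should be the integral of `dx / y` around its boundary. Along the geodesic from `z` to `w` that
integral is `sideAngle z w`, whence the area is the sum of the `sideAngle`s of the sides
(`IsImmersedDisc.signedArea_eq_sum`). The same number is minus the change of the Euclidean direction
of the tangent along the geodesic (`dir_geodesicVec`).

An element `x` of the universal covering group has a real-valued Euclidean rotation `turning x p` of
the tangent vectors at `p`. The twist is the rotation relative to the geodesic instead of relative
to the horizontal, hence it equals `turning x p + sideAngle p (x p)`
(`IsTwist.eq_turning_add_sideAngle`, `isTwist_turning_add_sideAngle`). Two facts link the sides: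
`turning` is a cocycle (`turning_mul`), and it measures how far `sideAngle` is from being invariant
(`sideAngle_proj_smul`).

In the pentagon `β` carries the reversed fifth side to the third, and `α` carries the reversed
second side to the fourth. Each pair therefore contributes a difference of two values of `turning`,
and these four values are the ones into which the cocycle rule expands the turning of the
commutator. The unpaired first side is the term `sideAngle p (x p)` of the twist
(`turning_commutator`).

The analytic difficulty is that `f` is merely continuous at the boundary, so Stokes does not apply
there directly. Local injectivity makes the density integrable (`integrableOn_hypDensity`).
Composition with a map that collapses small neighbourhoods of the vertices and preserves the side
geodesics makes the disc constant near the ends of the radii to the vertices. The circle of radius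
`R < 1` then splits into arcs, and the integral of `dx / y` over each arc differs from the
corresponding `sideAngle` by at most a constant times the area outside that circle
(`abs_integral_sub_sideAngle_le`). That area tends to `0` as `R → 1`, and the collapse is removed by
dominated convergence. -/

/-! ### Green's formula and the pullback of the hyperbolic area form -/

/-- Green's formula on a rectangle for the one-form `p dq`. -/
theorem integral_rectangle_mul_fderiv {p q : ℝ × ℝ → ℝ} {U : Set (ℝ × ℝ)} (hU : IsOpen U)
    (hp : ContDiffOn ℝ 2 p U) (hq : ContDiffOn ℝ 2 q U) {a b c d : ℝ}
    (hsub : uIcc a b ×ˢ uIcc c d ⊆ U) :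
    (∫ r in a..b, ∫ t in c..d, (fderiv ℝ p (r, t) (1, 0) * fderiv ℝ q (r, t) (0, 1) -
        fderiv ℝ p (r, t) (0, 1) * fderiv ℝ q (r, t) (1, 0))) =
      (∫ t in c..d, p (b, t) * fderiv ℝ q (b, t) (0, 1)) -
        (∫ t in c..d, p (a, t) * fderiv ℝ q (a, t) (0, 1)) -
        ((∫ r in a..b, p (r, d) * fderiv ℝ q (r, d) (1, 0)) -
          ∫ r in a..b, p (r, c) * fderiv ℝ q (r, c) (1, 0)) := by
  have hpd : ∀ x ∈ U, HasFDerivAt p (fderiv ℝ p x) x := fun x hx =>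
    ((hp.contDiffAt (hU.mem_nhds hx)).differentiableAt (by norm_num)).hasFDerivAt
  have hq1 : ContDiffOn ℝ 1 (fderiv ℝ q) U := hq.fderiv_of_isOpen hU (by norm_num)
  have hp1 : ContDiffOn ℝ 1 (fderiv ℝ p) U := hp.fderiv_of_isOpen hU (by norm_num)
  have hqd : ∀ x ∈ U, ∀ v, HasFDerivAt (fun y => fderiv ℝ q y v)
      ((fderiv ℝ (fderiv ℝ q) x).flip v) x := fun x hx v => by
    have := ((hq1.contDiffAt (hU.mem_nhds hx)).differentiableAt (by norm_num)).hasFDerivAt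
    exact ((ContinuousLinearMap.apply ℝ ℝ v).hasFDerivAt.comp x this).congr_fderiv (by ext <;> simp)
  have hsymm : ∀ x ∈ U, ∀ v w, fderiv ℝ (fderiv ℝ q) x v w = fderiv ℝ (fderiv ℝ q) x w v :=
    fun x hx v w => (hq.contDiffAt (hU.mem_nhds hx)).isSymmSndFDerivAt (by simp) v w
  have hcp : ContinuousOn p U := hp.continuousOn
  have hcp1 : ∀ v, ContinuousOn (fun y => fderiv ℝ p y v) U := fun v =>
    hp1.continuousOn.clm_apply continuousOn_const
  have hcq1 : ∀ v, ContinuousOn (fun y => fderiv ℝ q y v) U := fun v =>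
    hq1.continuousOn.clm_apply continuousOn_const
  have hcq2 : ∀ v w, ContinuousOn (fun y => fderiv ℝ (fderiv ℝ q) y v w) U := fun v w =>
    ((hq1.continuousOn_fderiv_of_isOpen hU le_rfl).clm_apply continuousOn_const).clm_apply
      continuousOn_const
  have hmin : Ioo (min a b) (max a b) ×ˢ Ioo (min c d) (max c d) ⊆ U :=
    (Set.prod_mono Ioo_subset_Icc_self Ioo_subset_Icc_self).trans hsub
  -- The divergence theorem for the vector field `(p q_t, -p q_r)`; in its divergence the mixed
  -- second derivatives of `q` cancel.
  have key := integral2_divergence_prod_of_hasFDerivAt_off_countable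
    (fun x => p x * fderiv ℝ q x (0, 1)) (fun x => -(p x * fderiv ℝ q x (1, 0)))
    (fun x => p x • ((fderiv ℝ (fderiv ℝ q) x).flip (0, 1)) + fderiv ℝ q x (0, 1) • fderiv ℝ p x)
    (fun x => -(p x • ((fderiv ℝ (fderiv ℝ q) x).flip (1, 0)) +
      fderiv ℝ q x (1, 0) • fderiv ℝ p x)) a c b d ∅ countable_empty
    ((hcp.mul (hcq1 _)).mono hsub) ((hcp.mul (hcq1 _)).neg.mono hsub)
    (fun x hx => (hpd x (hmin hx.1)).mul (hqd x (hmin hx.1) _))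
    (fun x hx => ((hpd x (hmin hx.1)).mul (hqd x (hmin hx.1) _)).neg)
    (by
      refine ContinuousOn.integrableOn_compact (isCompact_uIcc.prod isCompact_uIcc) ?_
      refine ContinuousOn.mono ?_ hsub
      simp only [add_apply, neg_apply, smul_apply, ContinuousLinearMap.flip_apply, smul_eq_mul]
      have := hcp1
      have := hcq1
      have := hcq2
      fun_prop (disch := assumption))
  refine Eq.trans ?_ (key.trans ?_)
  · refine intervalIntegral.integral_congr fun r hr => ?_
    refine intervalIntegral.integral_congr fun t ht => ?_
    simp only [add_apply, neg_apply, smul_apply, ContinuousLinearMap.flip_apply, smul_eq_mul]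
    rw [hsymm (r, t) (hsub ⟨hr, ht⟩) (1, 0) (0, 1)]
    ring
  · simp only [intervalIntegral.integral_neg]
    ring

/-- The form `H'(x) dx / y` vanishes near the imaginary axis, which allows Stokes without any
control of derivatives at the boundary. The three bounds survive the rescaling `δ * H (x / δ)`: the
distance to the identity becomes `2 * δ`, while the bound on the derivative does not change. -/
theorem exists_smooth_eq_zero_near_zero : ∃ (C : ℝ) (H : ℝ → ℝ), ContDiff ℝ ∞ H ∧
    (∀ x, |x| < 1 → H x = 0) ∧ (∀ x, |x - H x| ≤ 2) ∧ ∀ x, |deriv H x| ≤ C := by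
  set H : ℝ → ℝ := fun x => x * Real.smoothTransition (x ^ 2 - 1) with hH
  have hsm : ContDiff ℝ ∞ H := by
    refine contDiff_id.mul (Real.smoothTransition.contDiff.comp ?_)
    fun_prop
  have hbig : ∀ x : ℝ, 2 < |x| → H x = x := fun x hx => by
    have : 1 ≤ x ^ 2 - 1 := by nlinarith [sq_abs x]
    simp [hH, Real.smoothTransition.one_of_one_le this]
  have hcont : Continuous (deriv H) := hsm.continuous_deriv (by norm_num)
  obtain ⟨C, hC⟩ := (isCompact_Icc (a := (-2 : ℝ)) (b := 2)).exists_bound_of_continuousOn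
    hcont.continuousOn
  refine ⟨max C 1, H, hsm, fun x hx => ?_, fun x => ?_, fun x => ?_⟩
  · have : x ^ 2 - 1 ≤ 0 := by nlinarith [sq_abs x, abs_nonneg x]
    simp [hH, Real.smoothTransition.zero_of_nonpos this]
  · rcases lt_or_ge 2 |x| with h | h
    · simp [hbig x h]
    · have h0 := Real.smoothTransition.nonneg (x ^ 2 - 1)
      have h1 := Real.smoothTransition.le_one (x ^ 2 - 1)
      have : x - H x = x * (1 - Real.smoothTransition (x ^ 2 - 1)) := by simp only [hH]; ring
      rw [this, abs_mul, abs_of_nonneg (sub_nonneg.2 h1)]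
      nlinarith [abs_nonneg x]
  · rcases lt_or_ge 2 |x| with h | h
    · have : H =ᶠ[𝓝 x] id := by
        filter_upwards [(continuous_abs.tendsto x).eventually (lt_mem_nhds h)] with y hy
        exact hbig y hy
      rw [this.deriv_eq]
      simp
    · exact (hC x (abs_le.1 h)).trans (le_max_left _ _)

/-- The Jacobian determinant of a map to the upper half-plane, with respect to the hyperbolic
area. -/
noncomputable def hypJacobian (G : ℝ × ℝ → ℂ) (x : ℝ × ℝ) : ℝ :=
  ((fderiv ℝ G x (1, 0)).re * (fderiv ℝ G x (0, 1)).im -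
    (fderiv ℝ G x (0, 1)).re * (fderiv ℝ G x (1, 0)).im) / (G x).im ^ 2

theorem fderiv_re_apply {E : Type*} [NormedAddCommGroup E] [NormedSpace ℝ E] {G : E → ℂ} {x : E}
    (h : DifferentiableAt ℝ G x) (v : E) :
    fderiv ℝ (fun y => (G y).re) x v = (fderiv ℝ G x v).re := by
  have := Complex.reCLM.hasFDerivAt.comp x h.hasFDerivAt
  rw [show (fun y => (G y).re) = Complex.reCLM ∘ G from rfl, this.fderiv]
  rfl

theorem fderiv_im_apply {E : Type*} [NormedAddCommGroup E] [NormedSpace ℝ E] {G : E → ℂ} {x : E}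
    (h : DifferentiableAt ℝ G x) (v : E) :
    fderiv ℝ (fun y => (G y).im) x v = (fderiv ℝ G x v).im := by
  have := Complex.imCLM.hasFDerivAt.comp x h.hasFDerivAt
  rw [show (fun y => (G y).im) = Complex.imCLM ∘ G from rfl, this.fderiv]
  rfl

theorem fderiv_inv_im_apply {E : Type*} [NormedAddCommGroup E] [NormedSpace ℝ E] {G : E → ℂ}
    {x : E} (h : DifferentiableAt ℝ G x) (h0 : (G x).im ≠ 0) (v : E) :
    fderiv ℝ (fun y => ((G y).im)⁻¹) x v = -(fderiv ℝ G x v).im / (G x).im ^ 2 := by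
  have h1 : DifferentiableAt ℝ (fun y => (G y).im) x :=
    (Complex.imCLM.hasFDerivAt.comp x h.hasFDerivAt).differentiableAt
  have := (hasDerivAt_inv h0).comp_hasFDerivAt x h1.hasFDerivAt
  rw [show (fun y => ((G y).im)⁻¹) = Inv.inv ∘ fun y => (G y).im from rfl, this.fderiv]
  simp [fderiv_im_apply h]
  ring

/-- Green's formula on a rectangle for the pullback of the one-form `H'(x) dx / y`. -/
theorem integral_rectangle_hypJacobian {G : ℝ × ℝ → ℂ} {U : Set (ℝ × ℝ)} (hU : IsOpen U)
    (hG : ContDiffOn ℝ 2 G U) (him : ∀ x ∈ U, 0 < (G x).im) {H : ℝ → ℝ} (hH : ContDiff ℝ ∞ H)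
    {a b c d : ℝ} (hsub : uIcc a b ×ˢ uIcc c d ⊆ U) :
    (∫ r in a..b, ∫ t in c..d, deriv H (G (r, t)).re * hypJacobian G (r, t)) =
      (∫ t in c..d, deriv H (G (b, t)).re * ((fderiv ℝ G (b, t) (0, 1)).re / (G (b, t)).im)) -
      (∫ t in c..d, deriv H (G (a, t)).re * ((fderiv ℝ G (a, t) (0, 1)).re / (G (a, t)).im)) -
      ((∫ r in a..b, deriv H (G (r, d)).re * ((fderiv ℝ G (r, d) (1, 0)).re / (G (r, d)).im)) -
        ∫ r in a..b, deriv H (G (r, c)).re * ((fderiv ℝ G (r, c) (1, 0)).re / (G (r, c)).im)) := by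
  have hre : ContDiffOn ℝ 2 (fun x => (G x).re) U := Complex.reCLM.contDiff.comp_contDiffOn hG
  have him' : ContDiffOn ℝ 2 (fun x => (G x).im) U := Complex.imCLM.contDiff.comp_contDiffOn hG
  have hp : ContDiffOn ℝ 2 (fun x => ((G x).im)⁻¹) U := him'.inv fun x hx => (him x hx).ne'
  have hq : ContDiffOn ℝ 2 (fun x => H (G x).re) U :=
    (hH.of_le (by norm_cast)).comp_contDiffOn hre
  have hd : ∀ x ∈ U, DifferentiableAt ℝ G x := fun x hx =>
    (hG.contDiffAt (hU.mem_nhds hx)).differentiableAt (by norm_num)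
  have hfq : ∀ x ∈ U, ∀ v, fderiv ℝ (fun x => H (G x).re) x v =
      deriv H (G x).re * (fderiv ℝ G x v).re := fun x hx v => by
    have h1 : HasDerivAt H (deriv H (G x).re) (G x).re :=
      (hH.differentiable (by norm_num) _).hasDerivAt
    have h2 : DifferentiableAt ℝ (fun y => (G y).re) x :=
      (Complex.reCLM.hasFDerivAt.comp x (hd x hx).hasFDerivAt).differentiableAt
    have := h1.comp_hasFDerivAt x h2.hasFDerivAt
    rw [show (fun x => H (G x).re) = H ∘ fun y => (G y).re from rfl, this.fderiv]
    simp [fderiv_re_apply (hd x hx)]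
  have key := integral_rectangle_mul_fderiv hU hp hq hsub
  have hmem : ∀ r ∈ uIcc a b, ∀ t ∈ uIcc c d, (r, t) ∈ U := fun r hr t ht => hsub ⟨hr, ht⟩
  have e1 : ∀ r ∈ uIcc a b, (∫ t in c..d, ((G (r, t)).im)⁻¹ *
      fderiv ℝ (fun x => H (G x).re) (r, t) (0, 1)) =
      ∫ t in c..d, deriv H (G (r, t)).re * ((fderiv ℝ G (r, t) (0, 1)).re / (G (r, t)).im) :=
    fun r hr => intervalIntegral.integral_congr fun t ht => by
      simp only [hfq _ (hmem r hr t ht)]; ring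
  have e2 : ∀ t ∈ uIcc c d, (∫ r in a..b, ((G (r, t)).im)⁻¹ *
      fderiv ℝ (fun x => H (G x).re) (r, t) (1, 0)) =
      ∫ r in a..b, deriv H (G (r, t)).re * ((fderiv ℝ G (r, t) (1, 0)).re / (G (r, t)).im) :=
    fun t ht => intervalIntegral.integral_congr fun r hr => by
      simp only [hfq _ (hmem r hr t ht)]; ring
  rw [e1 a left_mem_uIcc, e1 b right_mem_uIcc, e2 c left_mem_uIcc, e2 d right_mem_uIcc] at key
  rw [← key]
  refine intervalIntegral.integral_congr fun r hr => ?_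
  refine intervalIntegral.integral_congr fun t ht => ?_
  have hx := hmem r hr t ht
  simp only [hfq _ hx, fderiv_inv_im_apply (hd _ hx) (him _ hx).ne', hypJacobian]
  have := (him _ hx).ne'
  field_simp
  ring

/-! ### Curves converging to the imaginary axis -/

theorem DifferentiableAt.hasDerivAt_snd {E : Type*} [NormedAddCommGroup E] [NormedSpace ℝ E]
    {G : ℝ × ℝ → E} {r t : ℝ} (h : DifferentiableAt ℝ G (r, t)) :
    HasDerivAt (fun t => G (r, t)) (fderiv ℝ G (r, t) (0, 1)) t :=
  h.hasFDerivAt.comp_hasDerivAt t ((hasDerivAt_const t r).prodMk (hasDerivAt_id t))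

theorem ContinuousOn.intervalIntegrable_integral {F : ℝ × ℝ → ℝ} {a b c d : ℝ} (hab : a ≤ b)
    (hcd : c ≤ d) (hF : ContinuousOn F (Icc a b ×ˢ Icc c d)) :
    IntervalIntegrable (fun r => ∫ t in c..d, F (r, t)) volume a b := by
  have h1 : IntegrableOn F (Icc a b ×ˢ Icc c d) :=
    hF.integrableOn_compact (isCompact_Icc.prod isCompact_Icc)
  have h2 : Integrable F ((volume.restrict (Ioc a b)).prod (volume.restrict (Ioc c d))) := by
    rw [Measure.prod_restrict]
    exact h1.mono_set (Set.prod_mono Ioc_subset_Icc_self Ioc_subset_Icc_self)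
  rw [intervalIntegrable_iff_integrableOn_Ioc_of_le hab]
  simp only [intervalIntegral.integral_of_le hcd]
  exact h2.integral_prod_left

theorem continuousOn_hypJacobian {G : ℝ × ℝ → ℂ} {U : Set (ℝ × ℝ)} (hU : IsOpen U)
    (hG : ContDiffOn ℝ 2 G U) (him : ∀ x ∈ U, 0 < (G x).im) :
    ContinuousOn (hypJacobian G) U := by
  have h1 : ∀ v, ContinuousOn (fun x => fderiv ℝ G x v) U := fun v =>
    (hG.continuousOn_fderiv_of_isOpen hU (by norm_num)).clm_apply continuousOn_const
  have hre := fun v => Complex.continuous_re.comp_continuousOn (h1 v)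
  have him' := fun v => Complex.continuous_im.comp_continuousOn (h1 v)
  exact (((hre _).mul (him' _)).sub ((hre _).mul (him' _))).div
    ((Complex.continuous_im.comp_continuousOn hG.continuousOn).pow 2)
    fun x hx => (pow_pos (him x hx) 2).ne'

/-- Stokes for `H'(x) dx / y` on `[R, R'] × [c, d]`. For `R'` close to `1` the curve lies where `H'
= 0`, and `G` does not move along the edges `t = c` and `t = d`. Only the edge `r = R` survives, so
its integral is minus that of `H'(x)` times the area form, at most `C` times the area. -/
theorem abs_integral_deriv_mul_le {G : ℝ × ℝ → ℂ} {U : Set (ℝ × ℝ)} (hU : IsOpen U)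
    (hG : ContDiffOn ℝ 2 G U) (him : ∀ x ∈ U, 0 < (G x).im) {H : ℝ → ℝ} (hH : ContDiff ℝ ∞ H)
    {C δ : ℝ} (hδ : 0 < δ) (hH0 : ∀ x, |x| < δ → H x = 0) (hHC : ∀ x, |deriv H x| ≤ C)
    {R c d B : ℝ} (hcd : c ≤ d) (hR : R < 1) (hsub : Ico R 1 ×ˢ Icc c d ⊆ U)
    (hre : ∀ δ > 0, ∀ᶠ r in 𝓝[<] (1 : ℝ), ∀ t ∈ Icc c d, |(G (r, t)).re| < δ)
    (hc : ∀ r ∈ Ico R 1, fderiv ℝ G (r, c) (1, 0) = 0)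
    (hd : ∀ r ∈ Ico R 1, fderiv ℝ G (r, d) (1, 0) = 0)
    (hB : ∀ R' ∈ Ico R 1, (∫ r in R..R', ∫ t in c..d, |hypJacobian G (r, t)|) ≤ B) :
    |∫ t in c..d, deriv H (G (R, t)).re * ((fderiv ℝ G (R, t) (0, 1)).re / (G (R, t)).im)| ≤
      C * B := by
  obtain ⟨R', hR'δ, hR'⟩ := ((hre δ hδ).and (Ioo_mem_nhdsLT hR)).exists
  have hsub' : uIcc R R' ×ˢ uIcc c d ⊆ U := by
    rw [uIcc_of_le hR'.1.le, uIcc_of_le hcd]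
    exact (Set.prod_mono (Icc_subset_Ico_right hR'.2) le_rfl).trans hsub
  have key := integral_rectangle_hypJacobian hU hG him hH hsub'
  have hdH : ∀ x, |x| < δ → deriv H x = 0 := fun x hx => by
    have : H =ᶠ[𝓝 x] fun _ => 0 := by
      filter_upwards [(continuous_abs.tendsto x).eventually (gt_mem_nhds hx)] with y hy
      exact hH0 y hy
    rw [this.deriv_eq]
    simp
  have z1 : (∫ t in c..d, deriv H (G (R', t)).re *
      ((fderiv ℝ G (R', t) (0, 1)).re / (G (R', t)).im)) = 0 := by
    rw [intervalIntegral.integral_congr (g := fun _ => (0 : ℝ)), intervalIntegral.integral_zero]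
    intro t ht
    rw [uIcc_of_le hcd] at ht
    simp [hdH _ (hR'δ t ht)]
  have z2 : ∀ e, (∀ r ∈ Ico R 1, fderiv ℝ G (r, e) (1, 0) = 0) →
      (∫ r in R..R', deriv H (G (r, e)).re *
        ((fderiv ℝ G (r, e) (1, 0)).re / (G (r, e)).im)) = 0 := fun e he => by
    rw [intervalIntegral.integral_congr (g := fun _ => (0 : ℝ)), intervalIntegral.integral_zero]
    intro r hr
    rw [uIcc_of_le hR'.1.le] at hr
    simp [he r ⟨hr.1, hr.2.trans_lt hR'.2⟩]
  rw [z1, z2 c hc, z2 d hd] at key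
  have hcW := continuousOn_hypJacobian hU hG him
  have hC0 : 0 ≤ C := (abs_nonneg _).trans (hHC 0)
  have hline : ∀ r ∈ Icc R R', ContinuousOn (fun t => hypJacobian G (r, t)) (uIcc c d) :=
    fun r hr => hcW.comp (by fun_prop) fun t ht => hsub' ⟨by rwa [uIcc_of_le hR'.1.le], ht⟩
  have hlineH : ∀ r ∈ Icc R R', ContinuousOn (fun t => deriv H (G (r, t)).re) (uIcc c d) :=
    fun r hr => (hH.continuous_deriv (by norm_num)).comp_continuousOn
      (Complex.continuous_re.comp_continuousOn (hG.continuousOn.comp (by fun_prop)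
        fun t ht => hsub' ⟨by rwa [uIcc_of_le hR'.1.le], ht⟩))
  have hint : IntervalIntegrable (fun r => ∫ t in c..d, |hypJacobian G (r, t)|) volume R R' := by
    rw [uIcc_of_le hR'.1.le, uIcc_of_le hcd] at hsub'
    exact ContinuousOn.intervalIntegrable_integral (F := fun x => |hypJacobian G x|) hR'.1.le hcd
      (hcW.mono hsub').abs
  have hle : ∀ r ∈ Icc R R', ‖∫ t in c..d, deriv H (G (r, t)).re * hypJacobian G (r, t)‖ ≤
      C * ∫ t in c..d, |hypJacobian G (r, t)| := fun r hr => by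
    rw [← intervalIntegral.integral_const_mul]
    refine intervalIntegral.norm_integral_le_of_norm_le hcd (ae_of_all _ fun t _ => ?_)
      (((hline r hr).abs.intervalIntegrable).const_mul C)
    rw [norm_mul]
    exact mul_le_mul_of_nonneg_right (hHC _) (norm_nonneg _)
  have := intervalIntegral.norm_integral_le_of_norm_le hR'.1.le
    (ae_of_all _ fun r hr => hle r ⟨hr.1.le, hr.2⟩) (hint.const_mul C)
  rw [intervalIntegral.integral_const_mul, key, Real.norm_eq_abs] at this
  simp only [sub_self, sub_zero, zero_sub, abs_neg] at this
  exact this.trans (mul_le_mul_of_nonneg_left (hB R' ⟨hR'.1.le, hR'.2⟩) hC0)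

/-- Integration by parts moves the derivative from `u - H u`, which is uniformly small, to `1 / y`.
Hence `K` depends on the curve alone and not on `H`, as needed to let the width of the cut-off tend
to `0` with the curve fixed. -/
theorem exists_bound_integral_sub {u y u' y' : ℝ → ℝ} {c d : ℝ} (hcd : c ≤ d)
    (hu : ∀ t ∈ Icc c d, HasDerivAt u (u' t) t) (hy : ∀ t ∈ Icc c d, HasDerivAt y (y' t) t)
    (hu' : ContinuousOn u' (Icc c d)) (hy' : ContinuousOn y' (Icc c d))
    (h0 : ∀ t ∈ Icc c d, 0 < y t) :
    ∃ K, ∀ (H : ℝ → ℝ) (δ : ℝ), ContDiff ℝ ∞ H → 0 ≤ δ → (∀ x, |x - H x| ≤ δ) →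
      |∫ t in c..d, (u' t / y t - deriv H (u t) * (u' t / y t))| ≤ δ * K := by
  have hyc : ContinuousOn y (Icc c d) := fun t ht => (hy t ht).continuousAt.continuousWithinAt
  have huc : ContinuousOn u (Icc c d) := fun t ht => (hu t ht).continuousAt.continuousWithinAt
  have hi : ContinuousOn (fun t => -y' t / y t ^ 2) (Icc c d) :=
    hy'.neg.div (hyc.pow 2) fun t ht => (pow_pos (h0 t ht) 2).ne'
  refine ⟨|(y d)⁻¹| + |(y c)⁻¹| + ∫ t in c..d, |(-y' t / y t ^ 2)|, fun H δ hH hδ hb => ?_⟩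
  have hHc := hH.continuous_deriv (by norm_num)
  have hi1 : IntervalIntegrable (fun t => -y' t / y t ^ 2) volume c d :=
    ContinuousOn.intervalIntegrable (by rwa [uIcc_of_le hcd])
  have hi2 : IntervalIntegrable (fun t => u' t - deriv H (u t) * u' t) volume c d :=
    ContinuousOn.intervalIntegrable (by
      rw [uIcc_of_le hcd]
      exact hu'.sub ((hHc.comp_continuousOn huc).mul hu'))
  have parts := intervalIntegral.integral_mul_deriv_eq_deriv_mul (a := c) (b := d)
    (u := fun t => (y t)⁻¹) (v := fun t => u t - H (u t)) (u' := fun t => -y' t / y t ^ 2)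
    (v' := fun t => u' t - deriv H (u t) * u' t)
    (fun t ht => by
      rw [uIcc_of_le hcd] at ht
      exact (hy t ht).inv (h0 t ht).ne')
    (fun t ht => by
      rw [uIcc_of_le hcd] at ht
      exact (hu t ht).sub
        ((hH.differentiable (by norm_num) (u t)).hasDerivAt.comp t (hu t ht)))
    hi1 hi2
  have e : (∫ t in c..d, (u' t / y t - deriv H (u t) * (u' t / y t))) =
      ∫ t in c..d, (y t)⁻¹ * (u' t - deriv H (u t) * u' t) := by
    refine intervalIntegral.integral_congr fun t _ => ?_
    simp only [div_eq_mul_inv]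
    ring
  rw [e, parts]
  have h3 : |∫ t in c..d, -y' t / y t ^ 2 * (u t - H (u t))| ≤
      δ * ∫ t in c..d, |(-y' t / y t ^ 2)| := by
    rw [← intervalIntegral.integral_const_mul]
    refine intervalIntegral.norm_integral_le_of_norm_le (E := ℝ) (μ := volume)
      (g := fun t => δ * |(-y' t / y t ^ 2)|) hcd (ae_of_all _ fun t _ => ?_)
      (hi1.abs.const_mul δ)
    rw [norm_mul, mul_comm]
    exact mul_le_mul_of_nonneg_right (hb _) (norm_nonneg _)
  have h1 : |(y d)⁻¹ * (u d - H (u d))| ≤ δ * |(y d)⁻¹| := by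
    rw [abs_mul, mul_comm]
    exact mul_le_mul_of_nonneg_right (hb _) (abs_nonneg _)
  have h2 : |(y c)⁻¹ * (u c - H (u c))| ≤ δ * |(y c)⁻¹| := by
    rw [abs_mul, mul_comm]
    exact mul_le_mul_of_nonneg_right (hb _) (abs_nonneg _)
  rw [abs_le] at *
  constructor <;> linarith [h1.1, h1.2, h2.1, h2.2, h3.1, h3.2]

/-- The integral of `dx / y` along a curve close to the vertical geodesic is bounded by the area
between the curve and the geodesic. -/
theorem abs_integral_side_le {C : ℝ} {H : ℝ → ℝ} (hH : ContDiff ℝ ∞ H)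
    (hH0 : ∀ x, |x| < 1 → H x = 0) (hH2 : ∀ x, |x - H x| ≤ 2) (hHC : ∀ x, |deriv H x| ≤ C)
    {G : ℝ × ℝ → ℂ} {U : Set (ℝ × ℝ)} (hU : IsOpen U)
    (hG : ContDiffOn ℝ 2 G U) (him : ∀ x ∈ U, 0 < (G x).im)
    {R c d B : ℝ} (hcd : c ≤ d) (hR : R < 1) (hsub : Ico R 1 ×ˢ Icc c d ⊆ U)
    (hre : ∀ δ > 0, ∀ᶠ r in 𝓝[<] (1 : ℝ), ∀ t ∈ Icc c d, |(G (r, t)).re| < δ)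
    (hc : ∀ r ∈ Ico R 1, fderiv ℝ G (r, c) (1, 0) = 0)
    (hd : ∀ r ∈ Ico R 1, fderiv ℝ G (r, d) (1, 0) = 0)
    (hB : ∀ R' ∈ Ico R 1, (∫ r in R..R', ∫ t in c..d, |hypJacobian G (r, t)|) ≤ B) :
    |∫ t in c..d, (fderiv ℝ G (R, t) (0, 1)).re / (G (R, t)).im| ≤ C * B := by
  have hmem : ∀ t ∈ Icc c d, (R, t) ∈ U := fun t ht => hsub ⟨⟨le_rfl, hR⟩, ht⟩
  have hder : ∀ t ∈ Icc c d, HasDerivAt (fun t => G (R, t)) (fderiv ℝ G (R, t) (0, 1)) t :=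
    fun t ht => ((hG.contDiffAt (hU.mem_nhds (hmem t ht))).differentiableAt
      (by norm_num)).hasDerivAt_snd
  have hcf : ContinuousOn (fun t => fderiv ℝ G (R, t) (0, 1)) (Icc c d) := by
    refine ContinuousOn.comp (g := fun x => fderiv ℝ G x (0, 1)) (t := U) ?_ (by fun_prop) hmem
    exact (hG.continuousOn_fderiv_of_isOpen hU (by norm_num)).clm_apply continuousOn_const
  have hcG : ContinuousOn (fun t => G (R, t)) (Icc c d) :=
    fun t ht => (hder t ht).continuousAt.continuousWithinAt
  obtain ⟨K, hK⟩ := exists_bound_integral_sub hcd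
    (u := fun t => (G (R, t)).re) (y := fun t => (G (R, t)).im)
    (u' := fun t => (fderiv ℝ G (R, t) (0, 1)).re) (y' := fun t => (fderiv ℝ G (R, t) (0, 1)).im)
    (fun t ht => Complex.reCLM.hasFDerivAt.comp_hasDerivAt t (hder t ht))
    (fun t ht => Complex.imCLM.hasFDerivAt.comp_hasDerivAt t (hder t ht))
    (Complex.continuous_re.comp_continuousOn hcf) (Complex.continuous_im.comp_continuousOn hcf)
    (fun t ht => him _ (hmem t ht))
  have hbound : ∀ δ > 0, |∫ t in c..d, (fderiv ℝ G (R, t) (0, 1)).re / (G (R, t)).im| ≤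
      C * B + δ * (2 * K) := fun δ hδ => by
    -- Narrowing the cut-off to width `δ` keeps the constant `C` of the area bound and makes the
    -- error of replacing `dx` by `H'(x) dx` of order `δ`.
    set Hδ : ℝ → ℝ := fun x => δ * H (x / δ) with hHδ
    have hs : ContDiff ℝ ∞ Hδ := contDiff_const.mul (hH.comp (contDiff_id.div_const δ))
    have hderiv : ∀ x, deriv Hδ x = deriv H (x / δ) := fun x => by
      have h1 : HasDerivAt H (deriv H (x / δ)) (x / δ) :=
        (hH.differentiable (by norm_num) _).hasDerivAt
      have h2 := (h1.comp x ((hasDerivAt_id x).div_const δ)).const_mul δ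
      have h3 : deriv Hδ x = _ := h2.deriv
      rw [h3]
      field_simp
    have h1 := abs_integral_deriv_mul_le hU hG him hs hδ
      (fun x hx => by
        rw [hHδ]
        simp only [mul_eq_zero]
        refine Or.inr (hH0 _ ?_)
        rwa [abs_div, abs_of_pos hδ, div_lt_one hδ])
      (fun x => by rw [hderiv]; exact hHC _) hcd hR hsub hre hc hd hB
    have h2 := hK Hδ (2 * δ) hs (by positivity) fun x => by
      have : x - Hδ x = δ * (x / δ - H (x / δ)) := by
        simp only [hHδ]
        field_simp
      rw [this, abs_mul, abs_of_pos hδ, mul_comm]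
      exact mul_le_mul_of_nonneg_right (hH2 _) hδ.le
    have hi1 : IntervalIntegrable (fun t => (fderiv ℝ G (R, t) (0, 1)).re / (G (R, t)).im)
        volume c d := by
      refine ContinuousOn.intervalIntegrable ?_
      rw [uIcc_of_le hcd]
      exact (Complex.continuous_re.comp_continuousOn hcf).div
        (Complex.continuous_im.comp_continuousOn hcG) fun t ht => (him _ (hmem t ht)).ne'
    have hi2 : IntervalIntegrable (fun t => deriv Hδ (G (R, t)).re *
        ((fderiv ℝ G (R, t) (0, 1)).re / (G (R, t)).im)) volume c d := by
      refine hi1.continuousOn_mul ?_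
      rw [uIcc_of_le hcd]
      exact (hs.continuous_deriv (by norm_num)).comp_continuousOn
        (Complex.continuous_re.comp_continuousOn hcG)
    rw [intervalIntegral.integral_sub hi1 hi2] at h2
    have h3 := abs_sub_abs_le_abs_sub
      (∫ t in c..d, (fderiv ℝ G (R, t) (0, 1)).re / (G (R, t)).im)
      (∫ t in c..d, deriv Hδ (G (R, t)).re *
        ((fderiv ℝ G (R, t) (0, 1)).re / (G (R, t)).im))
    linarith
  have hlim : Tendsto (fun δ : ℝ => C * B + δ * (2 * K)) (𝓝[>] 0) (𝓝 (C * B + 0 * (2 * K))) :=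
    Tendsto.mono_left (Continuous.tendsto (by fun_prop) 0) nhdsWithin_le_nhds
  rw [zero_mul, add_zero] at hlim
  exact ge_of_tendsto hlim (by filter_upwards [self_mem_nhdsWithin] with δ hδ using hbound δ hδ)

/-! ### Moebius transformations and the invariant one-form -/

/-- The denominator of the Moebius transformation of `M`. -/
noncomputable def mobiusDen (M : SL(2, ℝ)) (z : ℂ) : ℂ := (M 1 0 : ℂ) * z + (M 1 1 : ℂ)

/-- The Moebius transformation of `M`, as a map of `ℂ`. -/
noncomputable def mobius (M : SL(2, ℝ)) (z : ℂ) : ℂ :=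
  ((M 0 0 : ℂ) * z + (M 0 1 : ℂ)) / mobiusDen M z

theorem Matrix.SpecialLinearGroup.det_fin_two_eq_one (M : SL(2, ℝ)) :
    M 0 0 * M 1 1 - M 0 1 * M 1 0 = 1 := by
  rw [← Matrix.det_fin_two]
  exact M.2

theorem mobiusDen_ne_zero (M : SL(2, ℝ)) {z : ℂ} (hz : 0 < z.im) : mobiusDen M z ≠ 0 := by
  intro h
  have him := congrArg Complex.im h
  have hre := congrArg Complex.re h
  simp [mobiusDen, hz.ne'] at him hre
  have := M.det_fin_two_eq_one
  rw [him] at this hre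
  simp at hre
  simp [hre] at this

theorem coe_smul_eq_mobius (M : SL(2, ℝ)) (z : UpperHalfPlane) :
    ((M • z : UpperHalfPlane) : ℂ) = mobius M z := by
  rw [UpperHalfPlane.coe_specialLinearGroup_apply]
  simp [mobius, mobiusDen]

theorem im_mobius (M : SL(2, ℝ)) {z : ℂ} (hz : 0 < z.im) :
    (mobius M z).im = z.im / Complex.normSq (mobiusDen M z) := by
  have h1 : Complex.normSq (mobiusDen M z) ≠ 0 := by simpa using mobiusDen_ne_zero M hz
  rw [mobius, Complex.div_im, div_sub_div_same, div_left_inj' h1]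
  simp [mobiusDen]
  linear_combination z.im * M.det_fin_two_eq_one

theorem im_mobius_pos (M : SL(2, ℝ)) {z : ℂ} (hz : 0 < z.im) : 0 < (mobius M z).im := by
  rw [im_mobius M hz]
  exact div_pos hz (Complex.normSq_pos.2 (mobiusDen_ne_zero M hz))

theorem hasDerivAt_mobius (M : SL(2, ℝ)) {z : ℂ} (hz : 0 < z.im) :
    HasDerivAt (mobius M) (1 / mobiusDen M z ^ 2) z := by
  have h1 : HasDerivAt (mobiusDen M) (M 1 0 : ℂ) z := by
    exact (((hasDerivAt_id z).const_mul (M 1 0 : ℂ)).add_const (M 1 1 : ℂ)).congr_deriv (mul_one _)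
  have h2 : HasDerivAt (fun z : ℂ => (M 0 0 : ℂ) * z + (M 0 1 : ℂ)) (M 0 0 : ℂ) z := by
    simpa using ((hasDerivAt_id z).const_mul (M 0 0 : ℂ)).add_const (M 0 1 : ℂ)
  refine (h2.div h1 (mobiusDen_ne_zero M hz)).congr_deriv ?_
  congr 1
  have : ((M 0 0 * M 1 1 - M 0 1 * M 1 0 : ℝ) : ℂ) = 1 := by rw [M.det_fin_two_eq_one]; simp
  push_cast at this
  rw [mobiusDen]
  linear_combination this

theorem contDiffAt_mobius (M : SL(2, ℝ)) {z : ℂ} (hz : 0 < z.im) {n : WithTop ℕ∞} :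
    ContDiffAt ℝ n (mobius M) z := by
  have h0 := mobiusDen_ne_zero M hz
  have : ContDiffAt ℂ n (mobius M) z := by
    unfold mobius mobiusDen at *
    exact ContDiffAt.div (by fun_prop) (by fun_prop) h0
  exact this.restrict_scalars ℝ

theorem fderiv_mobius_comp (M : SL(2, ℝ)) {E : Type*} [NormedAddCommGroup E] [NormedSpace ℝ E]
    {G : E → ℂ} {x : E} (h : DifferentiableAt ℝ G x) (hx : 0 < (G x).im) (v : E) :
    fderiv ℝ (fun y => mobius M (G y)) x v = fderiv ℝ G x v / mobiusDen M (G x) ^ 2 := by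
  have h1 := ((hasDerivAt_mobius M hx).hasFDerivAt.restrictScalars ℝ).comp x h.hasFDerivAt
  rw [show (fun y => mobius M (G y)) = mobius M ∘ G from rfl, h1.fderiv]
  simp [div_eq_mul_inv]

theorem hypJacobian_mobius_comp (M : SL(2, ℝ)) {G : ℝ × ℝ → ℂ} {x : ℝ × ℝ}
    (h : DifferentiableAt ℝ G x) (hx : 0 < (G x).im) :
    hypJacobian (fun y => mobius M (G y)) x = hypJacobian G x := by
  rw [hypJacobian, hypJacobian, fderiv_mobius_comp M h hx, fderiv_mobius_comp M h hx,
    im_mobius M hx]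
  have hw : ∀ a b w : ℂ, (a / w).re * (b / w).im - (b / w).re * (a / w).im =
      (a.re * b.im - b.re * a.im) / Complex.normSq w := fun a b w => by
    by_cases h0 : w = 0
    · simp [h0]
    have h1 : Complex.normSq w ≠ 0 := by simpa using h0
    simp only [Complex.div_re, Complex.div_im]
    field_simp
    rw [Complex.normSq_apply]
    ring
  have hn : Complex.normSq (mobiusDen M (G x)) ≠ 0 := by simpa using mobiusDen_ne_zero M hx
  rw [hw, map_pow]
  have := hx.ne'
  field_simp

/-- The pullback of `dx / y` under `M` is `dx / y + 2 d arg (c z + d)`: an isometry changes the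
primitive by an exact form, since `c dz / (c z + d)` is the differential of `log (c z + d)`. -/
theorem fderiv_mobius_comp_re_div_im (M : SL(2, ℝ)) {E : Type*} [NormedAddCommGroup E]
    [NormedSpace ℝ E] {G : E → ℂ} {x : E} (h : DifferentiableAt ℝ G x) (hx : 0 < (G x).im)
    (v : E) :
    (fderiv ℝ (fun y => mobius M (G y)) x v).re / (mobius M (G x)).im =
      (fderiv ℝ G x v).re / (G x).im +
        2 * ((M 1 0 : ℂ) * fderiv ℝ G x v / mobiusDen M (G x)).im := by
  rw [fderiv_mobius_comp M h hx, im_mobius M hx]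
  have hn : Complex.normSq (mobiusDen M (G x)) ≠ 0 := by simpa using mobiusDen_ne_zero M hx
  have hi : (mobiusDen M (G x)).im = M 1 0 * (G x).im := by simp [mobiusDen]
  have := hx.ne'
  rw [Complex.div_re, Complex.div_im, map_pow]
  generalize mobiusDen M (G x) = w at *
  simp only [pow_two, Complex.mul_re, Complex.mul_im, Complex.ofReal_re, Complex.ofReal_im]
  field_simp
  rw [Complex.normSq_apply, hi]
  ring

/-! ### The angle of a side and its behaviour under isometries -/

/-- The integral of `dx / y` along the geodesic from `z` to `w`. -/
noncomputable def sideAngle (z w : ℂ) : ℝ :=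
  2 * Complex.arg (-Complex.I * (z - (starRingEnd ℂ) w))

theorem sideAngle_factor_re_pos {z w : ℂ} (hz : 0 < z.im) (hw : 0 < w.im) :
    0 < (-Complex.I * (z - (starRingEnd ℂ) w)).re := by
  simp
  positivity

theorem sideAngle_factor_mem {z w : ℂ} (hz : 0 < z.im) (hw : 0 < w.im) :
    -Complex.I * (z - (starRingEnd ℂ) w) ∈ Complex.slitPlane :=
  Or.inl (sideAngle_factor_re_pos hz hw)

theorem sideAngle_of_re_eq {z w : ℂ} (hz : 0 < z.im) (hw : 0 < w.im) (h : z.re = w.re) :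
    sideAngle z w = 0 := by
  have h1 : -Complex.I * (z - (starRingEnd ℂ) w) = ((z.im + w.im : ℝ) : ℂ) := by
    apply Complex.ext <;> simp [h]
  rw [sideAngle, h1, Complex.arg_ofReal_of_nonneg (by positivity), mul_zero]

theorem sideAngle_self {z : ℂ} (hz : 0 < z.im) : sideAngle z z = 0 :=
  sideAngle_of_re_eq hz hz rfl

theorem sideAngle_swap {z w : ℂ} (hz : 0 < z.im) (hw : 0 < w.im) :
    sideAngle w z = -sideAngle z w := by
  have h1 : -Complex.I * (w - (starRingEnd ℂ) z) =
      (starRingEnd ℂ) (-Complex.I * (z - (starRingEnd ℂ) w)) := by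
    apply Complex.ext <;> simp
  rw [sideAngle, sideAngle, h1, Complex.arg_conj, if_neg]
  · ring
  · intro h
    have := (Complex.arg_eq_pi_iff.1 h).1
    linarith [sideAngle_factor_re_pos hz hw]

/-- Follows from `M z - conj (M w) = (z - conj w) / ((c z + d) * conj (c w + d))` on taking
arguments, hence only modulo `2π`; continuity removes the ambiguity later. -/
theorem coe_sideAngle_mobius (M : SL(2, ℝ)) {z w : ℂ} (hz : 0 < z.im) (hw : 0 < w.im) :
    (sideAngle (mobius M z) (mobius M w) : Real.Angle) = sideAngle z w +
      ((2 * Complex.arg (mobiusDen M w) : ℝ) : Real.Angle) -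
      ((2 * Complex.arg (mobiusDen M z) : ℝ) : Real.Angle) := by
  have h1 := mobiusDen_ne_zero M hz
  have h2 := mobiusDen_ne_zero M hw
  have h2' : (starRingEnd ℂ) (mobiusDen M w) ≠ 0 := by simpa using h2
  have h0 := Complex.slitPlane_ne_zero (sideAngle_factor_mem hz hw)
  have key : -Complex.I * (mobius M z - (starRingEnd ℂ) (mobius M w)) =
      -Complex.I * (z - (starRingEnd ℂ) w) /
        (mobiusDen M z * (starRingEnd ℂ) (mobiusDen M w)) := by
    rw [mul_div_assoc]
    congr 1
    have hd : ((M 0 0 * M 1 1 - M 0 1 * M 1 0 : ℝ) : ℂ) = 1 := by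
      rw [M.det_fin_two_eq_one]; simp
    push_cast at hd
    rw [mobius, mobius, map_div₀, div_sub_div _ _ h1 h2']
    congr 1
    simp only [mobiusDen, map_add, map_mul, Complex.conj_ofReal]
    linear_combination (z - (starRingEnd ℂ) w) * hd
  have : ∀ a : ℝ, ((2 * a : ℝ) : Real.Angle) = (2 : ℕ) • (a : Real.Angle) := fun a => by
    rw [two_mul, two_nsmul, Real.Angle.coe_add]
  rw [sideAngle, sideAngle, this, this, this, this, key, Complex.arg_div_coe_angle h0
    (mul_ne_zero h1 h2'), Complex.arg_mul_coe_angle h1 h2', Complex.arg_conj_coe_angle]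
  abel

theorem continuousAt_sideAngle {z w : ℂ} (hz : 0 < z.im) (hw : 0 < w.im) :
    ContinuousAt (fun x : ℂ × ℂ => sideAngle x.1 x.2) (z, w) := by
  refine continuousAt_const.mul (ContinuousAt.comp (f := fun x : ℂ × ℂ =>
    -Complex.I * (x.1 - (starRingEnd ℂ) x.2)) (g := Complex.arg) ?_ ?_)
  · exact Complex.continuousAt_arg (sideAngle_factor_mem hz hw)
  · have := Complex.continuous_conj
    fun_prop

/-- A real function on a preconnected set with values in `2πℤ` that vanishes at a point is `0`. -/
theorem IsPreconnected.eq_zero_of_coe_angle_eq_zero {X : Type*} [TopologicalSpace X] {s : Set X}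
    (hs : IsPreconnected s) {f : X → ℝ} (hf : ContinuousOn f s)
    (h : ∀ x ∈ s, (f x : Real.Angle) = 0) {x₀ : X} (hx₀ : x₀ ∈ s) (h0 : f x₀ = 0) {x : X}
    (hx : x ∈ s) : f x = 0 := by
  rw [← h0]
  have hT : IsDiscrete (AddSubgroup.zmultiples (2 * Real.pi) : Set ℝ) :=
    ⟨inferInstanceAs (DiscreteTopology (AddSubgroup.zmultiples (2 * Real.pi)))⟩
  refine hs.constant_of_mapsTo hT hf (fun y hy => ?_) hx hx₀
  obtain ⟨n, hn⟩ := Real.Angle.coe_eq_zero_iff.1 (h y hy)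
  exact ⟨n, hn⟩

theorem isPreconnected_im_pos : IsPreconnected {z : ℂ | 0 < z.im} :=
  (convex_halfSpace_im_gt 0).isPreconnected

/-- If `c ≠ 0`, both `c z + d` and `c i + d` lie in the same open half-plane bounded by the real
axis, so their ratio is not in `(-∞, 0]`; if `c = 0`, the ratio is `1`. Dividing by the value at `i`
thus gives one branch of the argument on the whole upper half-plane. -/
theorem mobiusDen_div_mem_slitPlane (M : SL(2, ℝ)) {z : ℂ} (hz : 0 < z.im) :
    mobiusDen M z / mobiusDen M Complex.I ∈ Complex.slitPlane := by
  have hI : mobiusDen M Complex.I ≠ 0 := mobiusDen_ne_zero M (by simp)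
  have hn : 0 < Complex.normSq (mobiusDen M Complex.I) := Complex.normSq_pos.2 hI
  have hd := M.det_fin_two_eq_one
  have hre : (mobiusDen M z / mobiusDen M Complex.I).re =
      ((M 1 0 * z.re + M 1 1) * M 1 1 + M 1 0 ^ 2 * z.im) /
        Complex.normSq (mobiusDen M Complex.I) := by
    rw [Complex.div_re, ← add_div]
    simp [mobiusDen]
    ring
  have him : (mobiusDen M z / mobiusDen M Complex.I).im =
      M 1 0 * (z.im * M 1 1 - (M 1 0 * z.re + M 1 1)) /
        Complex.normSq (mobiusDen M Complex.I) := by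
    rw [Complex.div_im, div_sub_div_same]
    simp [mobiusDen]
    ring
  rw [Complex.mem_slitPlane_iff, hre, him]
  by_contra! hcon
  have h1 : M 1 0 * (z.im * M 1 1 - (M 1 0 * z.re + M 1 1)) = 0 := by
    simpa [hn.ne'] using hcon.2
  have h2 : (M 1 0 * z.re + M 1 1) * M 1 1 + M 1 0 ^ 2 * z.im ≤ 0 := by
    by_contra! h
    exact absurd hcon.1 (not_le.2 (div_pos h hn))
  rcases mul_eq_zero.1 h1 with h | h
  · rw [h] at hd h2
    have : M 1 1 ≠ 0 := by
      intro h'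
      simp [h'] at hd
    have := pow_pos (abs_pos.2 this) 2
    rw [sq_abs] at this
    nlinarith
  · have h3 : M 1 0 * z.re + M 1 1 = z.im * M 1 1 := by linarith
    rw [h3] at h2
    have h4 : (M 1 1 ^ 2 + M 1 0 ^ 2) * z.im ≤ 0 := by linarith
    have h5 : M 1 1 ^ 2 + M 1 0 ^ 2 ≤ 0 := by
      by_contra! h'
      exact absurd h4 (not_le.2 (mul_pos h' hz))
    have h6 : M 1 1 = 0 := by nlinarith [sq_nonneg (M 1 1), sq_nonneg (M 1 0)]
    have h7 : M 1 0 = 0 := by nlinarith [sq_nonneg (M 1 1), sq_nonneg (M 1 0)]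
    simp [h6, h7] at hd

/-- A continuous choice of the argument of the denominator of `M`. -/
noncomputable def mobiusArg (M : SL(2, ℝ)) (z : ℂ) : ℝ :=
  Complex.arg (mobiusDen M z / mobiusDen M Complex.I)

theorem two_mul_mobiusArg_sub (M : SL(2, ℝ)) {z w : ℂ} (hz : 0 < z.im) (hw : 0 < w.im) :
    2 * (mobiusArg M w - mobiusArg M z) =
      sideAngle (mobius M z) (mobius M w) - sideAngle z w := by
  have hI : mobiusDen M Complex.I ≠ 0 := mobiusDen_ne_zero M (by simp)
  -- The identity holds modulo `2π` and is trivial at `z = w`; the upper half-plane is connected.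
  have key := isPreconnected_im_pos.eq_zero_of_coe_angle_eq_zero
    (f := fun z => sideAngle (mobius M z) (mobius M w) - sideAngle z w -
      2 * (mobiusArg M w - mobiusArg M z)) ?_ ?_ (x₀ := w) hw ?_ hz
  · linarith
  · intro z (hz : 0 < z.im)
    refine ContinuousAt.continuousWithinAt (ContinuousAt.sub (ContinuousAt.sub ?_ ?_)
      (continuousAt_const.mul (continuousAt_const.sub ?_)))
    · exact ContinuousAt.comp (f := fun z => (mobius M z, mobius M w))
        (continuousAt_sideAngle (im_mobius_pos M hz) (im_mobius_pos M hw))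
        ((hasDerivAt_mobius M hz).continuousAt.prodMk continuousAt_const)
    · exact ContinuousAt.comp (f := fun z => (z, w))
        (continuousAt_sideAngle hz hw) (continuousAt_id.prodMk continuousAt_const)
    · refine ContinuousAt.comp (f := fun z => mobiusDen M z / mobiusDen M Complex.I)
        (Complex.continuousAt_arg (mobiusDen_div_mem_slitPlane M hz)) ?_
      unfold mobiusDen
      fun_prop
  · intro z (hz : 0 < z.im)
    have h2 : ∀ a : ℝ, ((2 * a : ℝ) : Real.Angle) = (2 : ℕ) • (a : Real.Angle) := fun a => by
      rw [two_mul, two_nsmul, Real.Angle.coe_add]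
    rw [Real.Angle.coe_sub, Real.Angle.coe_sub, coe_sideAngle_mobius M hz hw, h2, h2, h2,
      Real.Angle.coe_sub, mobiusArg, mobiusArg,
      Complex.arg_div_coe_angle (mobiusDen_ne_zero M hz) hI,
      Complex.arg_div_coe_angle (mobiusDen_ne_zero M hw) hI]
    abel
  · simp [sideAngle_self hw, sideAngle_self (im_mobius_pos M hw)]

theorem integral_mobiusDen_eq (M : SL(2, ℝ)) {g g' : ℝ → ℂ} {c d : ℝ}
    (hg : ∀ t ∈ uIcc c d, HasDerivAt g (g' t) t) (hg' : ContinuousOn g' (uIcc c d))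
    (h0 : ∀ t ∈ uIcc c d, 0 < (g t).im) :
    (∫ t in c..d, 2 * ((M 1 0 : ℂ) * g' t / mobiusDen M (g t)).im) =
      2 * (mobiusArg M (g d) - mobiusArg M (g c)) := by
  have hgc : ContinuousOn g (uIcc c d) := fun t ht => (hg t ht).continuousAt.continuousWithinAt
  have hI : mobiusDen M Complex.I ≠ 0 := mobiusDen_ne_zero M (by simp)
  have h1 : ∀ t ∈ uIcc c d, HasDerivAt (fun t => 2 * mobiusArg M (g t))
      (2 * ((M 1 0 : ℂ) * g' t / mobiusDen M (g t)).im) t := fun t ht => by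
    have hd : HasDerivAt (fun t => mobiusDen M (g t) / mobiusDen M Complex.I)
        ((M 1 0 : ℂ) * g' t / mobiusDen M Complex.I) t :=
      (((hg t ht).const_mul _).add_const _).div_const _
    have hl := (HasDerivAt.clog_real hd (mobiusDen_div_mem_slitPlane M (h0 t ht)))
    have hi := Complex.imCLM.hasFDerivAt.comp_hasDerivAt t hl
    refine ((hi.const_mul 2).congr_deriv ?_).congr_of_eventuallyEq
      (.of_forall fun s => by simp [mobiusArg, Complex.log_im])
    rw [div_div_div_cancel_right₀ hI]
    rfl
  rw [intervalIntegral.integral_eq_sub_of_hasDerivAt h1, mul_sub]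
  refine ContinuousOn.intervalIntegrable (continuousOn_const.mul
    (Complex.continuous_im.comp_continuousOn ((continuousOn_const.mul hg').div ?_ fun t ht =>
      mobiusDen_ne_zero M (h0 t ht))))
  unfold mobiusDen
  fun_prop

/-- The integral of `dx / y` along a curve close to the geodesic `re (M z) = 0` differs from the
integral along the geodesic by at most the area in between. -/
theorem abs_integral_sub_sideAngle_le {C : ℝ} {H : ℝ → ℝ} (hH : ContDiff ℝ ∞ H)
    (hH0 : ∀ x, |x| < 1 → H x = 0) (hH2 : ∀ x, |x - H x| ≤ 2) (hHC : ∀ x, |deriv H x| ≤ C)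
    {G : ℝ × ℝ → ℂ} {U : Set (ℝ × ℝ)} (hU : IsOpen U)
    (hG : ContDiffOn ℝ 2 G U) (him : ∀ x ∈ U, 0 < (G x).im) (M : SL(2, ℝ))
    {R c d B : ℝ} (hcd : c ≤ d) (hR : R < 1) (hsub : Ico R 1 ×ˢ Icc c d ⊆ U)
    (hre : ∀ δ > 0, ∀ᶠ r in 𝓝[<] (1 : ℝ), ∀ t ∈ Icc c d, |(mobius M (G (r, t))).re| < δ)
    (hc : ∀ r ∈ Ico R 1, fderiv ℝ G (r, c) (1, 0) = 0)
    (hd : ∀ r ∈ Ico R 1, fderiv ℝ G (r, d) (1, 0) = 0)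
    (hc' : (mobius M (G (R, c))).re = 0) (hd' : (mobius M (G (R, d))).re = 0)
    (hB : ∀ R' ∈ Ico R 1, (∫ r in R..R', ∫ t in c..d, |hypJacobian G (r, t)|) ≤ B) :
    |(∫ t in c..d, (fderiv ℝ G (R, t) (0, 1)).re / (G (R, t)).im) -
      sideAngle (G (R, c)) (G (R, d))| ≤ C * B := by
  have hdiff : ∀ x ∈ U, DifferentiableAt ℝ G x := fun x hx =>
    (hG.contDiffAt (hU.mem_nhds hx)).differentiableAt (by norm_num)
  have hmem : ∀ t ∈ Icc c d, (R, t) ∈ U := fun t ht => hsub ⟨⟨le_rfl, hR⟩, ht⟩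
  have hc0 : c ∈ Icc c d := left_mem_Icc.2 hcd
  have hd0 : d ∈ Icc c d := right_mem_Icc.2 hcd
  have hcf : ContinuousOn (fun t => fderiv ℝ G (R, t) (0, 1)) (Icc c d) := by
    refine ContinuousOn.comp (g := fun x => fderiv ℝ G x (0, 1)) (t := U) ?_ (by fun_prop) hmem
    exact (hG.continuousOn_fderiv_of_isOpen hU (by norm_num)).clm_apply continuousOn_const
  have hcG : ContinuousOn (fun t => G (R, t)) (Icc c d) :=
    hG.continuousOn.comp (by fun_prop) hmem
  have hMG : ContDiffOn ℝ 2 (fun x => mobius M (G x)) U := fun x hx =>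
    ((contDiffAt_mobius M (him x hx)).comp x
      (hG.contDiffAt (hU.mem_nhds hx))).contDiffWithinAt
  have key := abs_integral_side_le hH hH0 hH2 hHC hU hMG
    (fun x hx => im_mobius_pos M (him x hx)) hcd hR hsub hre
    (fun r hr => by
      have hx := hsub (mk_mem_prod hr hc0)
      rw [fderiv_mobius_comp M (hdiff _ hx) (him _ hx), hc r hr, zero_div])
    (fun r hr => by
      have hx := hsub (mk_mem_prod hr hd0)
      rw [fderiv_mobius_comp M (hdiff _ hx) (him _ hx), hd r hr, zero_div])
    (B := B) (fun R' hR' => by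
      refine le_of_eq_of_le ?_ (hB R' hR')
      refine intervalIntegral.integral_congr fun r hr => ?_
      refine intervalIntegral.integral_congr fun t ht => ?_
      rw [uIcc_of_le hR'.1] at hr
      rw [uIcc_of_le hcd] at ht
      have hx : (r, t) ∈ U := hsub ⟨⟨hr.1, hr.2.trans_lt hR'.2⟩, ht⟩
      simp only [hypJacobian_mobius_comp M (hdiff _ hx) (him _ hx)])
  have hA := integral_mobiusDen_eq M (g := fun t => G (R, t))
    (g' := fun t => fderiv ℝ G (R, t) (0, 1)) (c := c) (d := d)
    (fun t ht => by
      rw [uIcc_of_le hcd] at ht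
      exact (hdiff _ (hmem t ht)).hasDerivAt_snd) (by rwa [uIcc_of_le hcd])
    (fun t ht => by
      rw [uIcc_of_le hcd] at ht
      exact him _ (hmem t ht))
  -- Both endpoints are mapped by `M` to the imaginary axis, where `sideAngle` is `0`, so the exact
  -- correction integrates to minus the `sideAngle` of the original endpoints.
  rw [two_mul_mobiusArg_sub M (him _ (hmem c hc0)) (him _ (hmem d hd0)),
    sideAngle_of_re_eq (im_mobius_pos M (him _ (hmem c hc0)))
      (im_mobius_pos M (him _ (hmem d hd0))) (hc'.trans hd'.symm), zero_sub] at hA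
  have hsplit : (∫ t in c..d, (fderiv ℝ (fun x => mobius M (G x)) (R, t) (0, 1)).re /
      (mobius M (G (R, t))).im) = (∫ t in c..d, (fderiv ℝ G (R, t) (0, 1)).re / (G (R, t)).im) +
        ∫ t in c..d, 2 * ((M 1 0 : ℂ) * fderiv ℝ G (R, t) (0, 1) / mobiusDen M (G (R, t))).im := by
    rw [← intervalIntegral.integral_add]
    · refine intervalIntegral.integral_congr fun t ht => ?_
      rw [uIcc_of_le hcd] at ht
      exact fderiv_mobius_comp_re_div_im M (hdiff _ (hmem t ht)) (him _ (hmem t ht)) _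
    · refine ContinuousOn.intervalIntegrable ?_
      rw [uIcc_of_le hcd]
      exact (Complex.continuous_re.comp_continuousOn hcf).div
        (Complex.continuous_im.comp_continuousOn hcG) fun t ht => (him _ (hmem t ht)).ne'
    · refine ContinuousOn.intervalIntegrable ?_
      rw [uIcc_of_le hcd]
      refine continuousOn_const.mul
        (Complex.continuous_im.comp_continuousOn ((continuousOn_const.mul hcf).div ?_
          fun t ht => mobiusDen_ne_zero M (him _ (hmem t ht))))
      exact (continuousOn_const.mul hcG).add continuousOn_const
  rw [hsplit, hA, ← sub_eq_add_neg] at key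
  exact key

/-! ### Discs in polar coordinates -/

/-- The density of the pullback of the hyperbolic area form under a map to `ℂ`. -/
noncomputable def hypDensity (g : ℂ → ℂ) (z : ℂ) : ℝ := (fderiv ℝ g z).det / (g z).im ^ 2

theorem Complex.det_eq_re_mul_im_sub (L : ℂ →L[ℝ] ℂ) :
    L.det = (L 1).re * (L Complex.I).im - (L Complex.I).re * (L 1).im := by
  rw [ContinuousLinearMap.det, ← LinearMap.det_toMatrix Complex.basisOneI, Matrix.det_fin_two]
  simp [LinearMap.toMatrix_apply]

theorem Complex.re_mul_im_sub_map (L : ℂ →L[ℝ] ℂ) (v w : ℂ) :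
    (L v).re * (L w).im - (L w).re * (L v).im = L.det * (v.re * w.im - w.re * v.im) := by
  have h : ∀ v : ℂ, L v = v.re • L 1 + v.im • L Complex.I := fun v => by
    rw [← map_smul, ← map_smul, ← map_add]
    congr 1
    apply Complex.ext <;> simp
  rw [h v, h w, Complex.det_eq_re_mul_im_sub]
  simp
  ring

/-- Polar coordinates on `ℂ`. -/
noncomputable def polarMap (x : ℝ × ℝ) : ℂ := x.1 * Complex.exp (x.2 * Complex.I)

theorem contDiff_polarMap {n : WithTop ℕ∞} : ContDiff ℝ n polarMap := by
  have h1 : ContDiff ℝ n (fun x : ℝ × ℝ => (x.1 : ℂ)) :=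
    Complex.ofRealCLM.contDiff.comp contDiff_fst
  have h2 : ContDiff ℝ n (fun x : ℝ × ℝ => (x.2 : ℂ)) :=
    Complex.ofRealCLM.contDiff.comp contDiff_snd
  exact h1.mul (h2.mul contDiff_const).cexp

theorem norm_polarMap (x : ℝ × ℝ) : ‖polarMap x‖ = |x.1| := by
  rw [polarMap, norm_mul, Complex.norm_exp_ofReal_mul_I, mul_one, Complex.norm_real,
    Real.norm_eq_abs]

theorem polarMap_add_two_pi (r t : ℝ) : polarMap (r, t + 2 * Real.pi) = polarMap (r, t) := by
  simp only [polarMap]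
  push_cast
  rw [add_mul, Complex.exp_periodic]

theorem fderiv_polarMap_fst (x : ℝ × ℝ) :
    fderiv ℝ polarMap x (1, 0) = Complex.exp (x.2 * Complex.I) := by
  have hd : DifferentiableAt ℝ polarMap x := contDiff_polarMap.differentiable (by norm_num : (1 : WithTop ℕ∞) ≠ 0) x
  have h1 := hd.hasFDerivAt.comp_hasDerivAt (f := fun r => (r, x.2)) x.1
    ((hasDerivAt_id x.1).prodMk (hasDerivAt_const x.1 x.2))
  have h2 : HasDerivAt (fun r : ℝ => (r : ℂ) * Complex.exp (x.2 * Complex.I))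
      (1 * Complex.exp (x.2 * Complex.I)) x.1 := (Complex.ofRealCLM.hasDerivAt).mul_const _
  rw [one_mul] at h2
  exact h1.unique h2

theorem fderiv_polarMap_snd (x : ℝ × ℝ) :
    fderiv ℝ polarMap x (0, 1) = x.1 * (Complex.exp (x.2 * Complex.I) * Complex.I) := by
  have hd : DifferentiableAt ℝ polarMap x := contDiff_polarMap.differentiable (by norm_num : (1 : WithTop ℕ∞) ≠ 0) x
  have h1 := hd.hasFDerivAt.comp_hasDerivAt (f := fun t => (x.1, t)) x.2
    ((hasDerivAt_const x.2 x.1).prodMk (hasDerivAt_id x.2))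
  have h3 : HasDerivAt (fun t : ℝ => (t : ℂ) * Complex.I) Complex.I x.2 := by
    simpa using (Complex.ofRealCLM.hasDerivAt (x := x.2)).mul_const Complex.I
  have h2 : HasDerivAt (fun t : ℝ => (x.1 : ℂ) * Complex.exp (t * Complex.I))
      (x.1 * (Complex.exp (x.2 * Complex.I) * Complex.I)) x.2 := h3.cexp.const_mul _
  exact h1.unique h2

theorem fderiv_comp_polarMap {g : ℂ → ℂ} {x : ℝ × ℝ} (hg : DifferentiableAt ℝ g (polarMap x))
    (v : ℝ × ℝ) : fderiv ℝ (fun y => g (polarMap y)) x v =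
      fderiv ℝ g (polarMap x) (fderiv ℝ polarMap x v) := by
  have hd : DifferentiableAt ℝ polarMap x := contDiff_polarMap.differentiable (by norm_num : (1 : WithTop ℕ∞) ≠ 0) x
  rw [show (fun y => g (polarMap y)) = g ∘ polarMap from rfl,
    (hg.hasFDerivAt.comp x hd.hasFDerivAt).fderiv]
  rfl

theorem hypJacobian_comp_polarMap {g : ℂ → ℂ} {x : ℝ × ℝ}
    (hg : DifferentiableAt ℝ g (polarMap x)) :
    hypJacobian (fun y => g (polarMap y)) x = x.1 * hypDensity g (polarMap x) := by
  rw [hypJacobian, fderiv_comp_polarMap hg, fderiv_comp_polarMap hg,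
    Complex.re_mul_im_sub_map, fderiv_polarMap_fst, fderiv_polarMap_snd, hypDensity]
  have : (Complex.exp (x.2 * Complex.I)).re *
      ((x.1 : ℂ) * (Complex.exp (x.2 * Complex.I) * Complex.I)).im -
      ((x.1 : ℂ) * (Complex.exp (x.2 * Complex.I) * Complex.I)).re *
        (Complex.exp (x.2 * Complex.I)).im = x.1 := by
    simp [Complex.exp_ofReal_mul_I_re, Complex.exp_ofReal_mul_I_im]
    linear_combination x.1 * Real.sin_sq_add_cos_sq x.2
  rw [this]
  ring

theorem continuousOn_hypDensity {g : ℂ → ℂ} {s : Set ℂ} (hs : IsOpen s) (hg : ContDiffOn ℝ 2 g s)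
    (him : ∀ z ∈ s, 0 < (g z).im) : ContinuousOn (hypDensity g) s := by
  have h1 : ContinuousOn (fun z => (fderiv ℝ g z).det) s :=
    ContinuousLinearMap.continuous_det.comp_continuousOn
      (hg.continuousOn_fderiv_of_isOpen hs (by norm_num))
  exact h1.div ((Complex.continuous_im.comp_continuousOn hg.continuousOn).pow 2)
    fun z hz => (pow_pos (him z hz) 2).ne'

/-- Integration over an annulus in polar coordinates. -/
theorem integral_annulus {F : ℂ → ℝ} {a b : ℝ} (ha : 0 ≤ a) (hab : a ≤ b)
    (hF : ContinuousOn F (Metric.closedBall 0 b)) (θ : ℝ) :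
    ∫ z in {z : ℂ | a < ‖z‖ ∧ ‖z‖ ≤ b}, F z =
      ∫ r in a..b, ∫ t in θ..θ + 2 * Real.pi, r * F (polarMap (r, t)) := by
  have hms : MeasurableSet {z : ℂ | a < ‖z‖ ∧ ‖z‖ ≤ b} :=
    (measurableSet_lt measurable_const measurable_norm).inter
      (measurableSet_le measurable_norm measurable_const)
  rw [← integral_indicator hms, ← Complex.integral_comp_polarCoord_symm]
  have hpm : ∀ p : ℝ × ℝ, Complex.polarCoord.symm p = polarMap p := fun p => by
    rw [Complex.polarCoord_symm_apply, polarMap, Complex.exp_mul_I, Complex.ofReal_cos,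
      Complex.ofReal_sin]
  have hsub : Ioc a b ×ˢ Ioo (-Real.pi) Real.pi ⊆ polarCoord.target := by
    rw [polarCoord_target]
    exact Set.prod_mono (fun x hx => ha.trans_lt hx.1) le_rfl
  have hms2 : MeasurableSet (Ioc a b ×ˢ Ioo (-Real.pi) Real.pi) :=
    measurableSet_Ioc.prod measurableSet_Ioo
  have h1 : ∫ p in polarCoord.target, p.1 •
      {z : ℂ | a < ‖z‖ ∧ ‖z‖ ≤ b}.indicator F (Complex.polarCoord.symm p) =
      ∫ p in Ioc a b ×ˢ Ioo (-Real.pi) Real.pi, p.1 * F (polarMap p) := by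
    rw [setIntegral_eq_of_subset_of_forall_sdiff_eq_zero polarCoord.open_target.measurableSet hsub]
    · refine setIntegral_congr_fun hms2 fun p hp => ?_
      have h0 : 0 ≤ p.1 := ha.trans hp.1.1.le
      have hmem : polarMap p ∈ {z : ℂ | a < ‖z‖ ∧ ‖z‖ ≤ b} := by
        refine ⟨?_, ?_⟩ <;> rw [norm_polarMap, abs_of_nonneg h0]
        exacts [hp.1.1, hp.1.2]
      simp only [hpm, indicator_of_mem hmem, smul_eq_mul]
    · intro p hp
      rw [hpm, indicator_of_notMem, smul_zero]
      intro hmem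
      have hp1 := hp.1
      rw [polarCoord_target] at hp1
      simp only [mem_ofPred_eq, norm_polarMap, abs_of_pos (show 0 < p.1 from hp1.1)] at hmem
      exact hp.2 ⟨hmem, hp1.2⟩
  have hcont : ContinuousOn (fun p : ℝ × ℝ => p.1 * F (polarMap p))
      (Icc a b ×ˢ (univ : Set ℝ)) := by
    refine continuousOn_fst.mul (hF.comp (contDiff_polarMap (n := 0)).continuous.continuousOn
      fun p hp => ?_)
    rw [mem_closedBall_zero_iff, norm_polarMap, abs_of_nonneg (ha.trans hp.1.1)]
    exact hp.1.2
  have hint : IntegrableOn (fun p : ℝ × ℝ => p.1 * F (polarMap p))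
      (Ioc a b ×ˢ Ioo (-Real.pi) Real.pi) (volume.prod volume) :=
    ((hcont.mono (Set.prod_mono le_rfl (subset_univ _))).integrableOn_compact
      (isCompact_Icc.prod (isCompact_Icc (a := -Real.pi) (b := Real.pi)))).mono_set
      (Set.prod_mono Ioc_subset_Icc_self Ioo_subset_Icc_self)
  rw [h1, Measure.volume_eq_prod, setIntegral_prod _ hint, intervalIntegral.integral_of_le hab]
  refine setIntegral_congr_fun measurableSet_Ioc fun r hr => ?_
  have hper : Function.Periodic (fun t => r * F (polarMap (r, t))) (2 * Real.pi) := fun t => by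
    simp only [polarMap_add_two_pi]
  have := hper.intervalIntegral_add_eq θ (-Real.pi)
  simp only at this ⊢
  rw [this, intervalIntegral.integral_of_le (by linarith [Real.pi_pos]),
    integral_Ioc_eq_integral_Ioo]
  congr 3
  ring

theorem contDiffOn_comp_polarMap {g : ℂ → ℂ} (hs : ContDiffOn ℝ ∞ g (Metric.ball 0 1)) :
    ContDiffOn ℝ 2 (fun x => g (polarMap x)) (Ioo (-1) 1 ×ˢ (univ : Set ℝ)) := by
  refine (hs.of_le (by norm_cast)).comp contDiff_polarMap.contDiffOn fun x hx => ?_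
  rw [mem_ball_zero_iff, norm_polarMap]
  exact abs_lt.2 hx.1

/-- Stokes' formula for the disc of radius `R < 1`. -/
theorem integral_annulus_hypDensity {g : ℂ → ℂ} (hs : ContDiffOn ℝ ∞ g (Metric.ball 0 1))
    (him : ∀ z ∈ Metric.ball (0 : ℂ) 1, 0 < (g z).im) {R : ℝ} (hR0 : 0 ≤ R) (hR : R < 1) (θ : ℝ) :
    ∫ z in {z : ℂ | 0 < ‖z‖ ∧ ‖z‖ ≤ R}, hypDensity g z =
      ∫ t in θ..θ + 2 * Real.pi, (fderiv ℝ (fun x => g (polarMap x)) (R, t) (0, 1)).re /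
        (g (polarMap (R, t))).im := by
  set G : ℝ × ℝ → ℂ := fun x => g (polarMap x) with hGdef
  have hU : IsOpen (Ioo (-1 : ℝ) 1 ×ˢ (univ : Set ℝ)) := isOpen_Ioo.prod isOpen_univ
  have hG : ContDiffOn ℝ 2 G _ := contDiffOn_comp_polarMap hs
  have hball : ∀ x ∈ Ioo (-1 : ℝ) 1 ×ˢ (univ : Set ℝ), polarMap x ∈ Metric.ball (0 : ℂ) 1 :=
    fun x hx => by
      rw [mem_ball_zero_iff, norm_polarMap]
      exact abs_lt.2 hx.1
  have hd : ∀ z ∈ Metric.ball (0 : ℂ) 1, DifferentiableAt ℝ g z := fun z hz =>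
    (hs.contDiffAt (Metric.isOpen_ball.mem_nhds hz)).differentiableAt (by norm_num)
  have hGi : ∀ x ∈ Ioo (-1 : ℝ) 1 ×ˢ (univ : Set ℝ), 0 < (G x).im := fun x hx =>
    him _ (hball x hx)
  rw [integral_annulus le_rfl hR0 ((continuousOn_hypDensity Metric.isOpen_ball
    (hs.of_le (by norm_cast)) him).mono (Metric.closedBall_subset_ball hR)) θ]
  -- With `H` the identity the form is `dx / y` itself. The edge `r = 0` contributes nothing because
  -- `polarMap` is constant there, and the two radial edges cancel by periodicity.
  have key := integral_rectangle_hypJacobian hU hG hGi contDiff_id (a := 0) (b := R) (c := θ)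
    (d := θ + 2 * Real.pi) (by
      rw [uIcc_of_le hR0]
      exact Set.prod_mono (fun x hx => ⟨by linarith [hx.1], hx.2.trans_lt hR⟩) (subset_univ _))
  simp only [deriv_id, one_mul] at key
  have hl : ∀ r ∈ uIcc 0 R, ∀ t, (r, t) ∈ Ioo (-1 : ℝ) 1 ×ˢ (univ : Set ℝ) := fun r hr t => by
    rw [uIcc_of_le hR0] at hr
    exact ⟨⟨by linarith [hr.1], hr.2.trans_lt hR⟩, mem_univ _⟩
  have e1 : (∫ r in (0 : ℝ)..R, ∫ t in θ..θ + 2 * Real.pi, hypJacobian G (r, t)) =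
      ∫ r in (0 : ℝ)..R, ∫ t in θ..θ + 2 * Real.pi, r * hypDensity g (polarMap (r, t)) := by
    refine intervalIntegral.integral_congr fun r hr => ?_
    refine intervalIntegral.integral_congr fun t _ => ?_
    exact hypJacobian_comp_polarMap (hd _ (hball _ (hl r hr t)))
  have e2 : (∫ t in θ..θ + 2 * Real.pi, (fderiv ℝ G (0, t) (0, 1)).re / (G (0, t)).im) = 0 := by
    rw [intervalIntegral.integral_congr (g := fun _ => (0 : ℝ)), intervalIntegral.integral_zero]
    intro t _
    simp only
    rw [fderiv_comp_polarMap (hd _ (hball _ (hl 0 left_mem_uIcc t))), fderiv_polarMap_snd]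
    simp
  have e3 : (∫ r in (0 : ℝ)..R, (fderiv ℝ G (r, θ + 2 * Real.pi) (1, 0)).re /
      (G (r, θ + 2 * Real.pi)).im) =
      ∫ r in (0 : ℝ)..R, (fderiv ℝ G (r, θ) (1, 0)).re / (G (r, θ)).im := by
    refine intervalIntegral.integral_congr fun r hr => ?_
    rw [fderiv_comp_polarMap (hd _ (hball _ (hl r hr _))),
      fderiv_comp_polarMap (hd _ (hball _ (hl r hr _))), fderiv_polarMap_fst, fderiv_polarMap_fst,
      hGdef]
    simp only [polarMap_add_two_pi]
    push_cast
    rw [add_mul, Complex.exp_periodic]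
  rw [← e1, key, e2, e3]
  simp only [sub_self, sub_zero]
  rfl

theorem tendsto_setIntegral_norm_gt {F : ℂ → ℝ} (hF : IntegrableOn F (Metric.ball 0 1)) :
    Tendsto (fun k : ℕ => ∫ z in {z : ℂ | 1 - 1 / ((k : ℝ) + 1) < ‖z‖ ∧ ‖z‖ < 1}, F z) atTop
      (𝓝 0) := by
  have hanti : Antitone fun k : ℕ => {z : ℂ | 1 - 1 / ((k : ℝ) + 1) < ‖z‖ ∧ ‖z‖ < 1} :=
    fun i j hij z hz => ⟨lt_of_le_of_lt (sub_le_sub_left (Nat.one_div_le_one_div hij) 1) hz.1, hz.2⟩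
  have := tendsto_setIntegral_of_antitone (f := F) (μ := volume) (fun k =>
    (measurableSet_lt measurable_const measurable_norm).inter
      (measurableSet_lt measurable_norm measurable_const)) hanti
    ⟨0, hF.mono_set fun z hz => mem_ball_zero_iff.2 hz.2⟩
  have he : (⋂ k : ℕ, {z : ℂ | 1 - 1 / ((k : ℝ) + 1) < ‖z‖} ∩ {z : ℂ | ‖z‖ < 1}) = ∅ := by
    refine eq_empty_of_forall_notMem fun z hz => ?_
    rw [mem_iInter] at hz
    have h1 : ‖z‖ < 1 := (hz 0).2
    obtain ⟨k, hk⟩ := exists_nat_one_div_lt (K := ℝ) (sub_pos.2 h1)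
    have h2 : 1 - 1 / ((k : ℝ) + 1) < ‖z‖ := (hz k).1
    linarith
  rw [he, setIntegral_empty] at this
  exact this

theorem eventually_forall_abs_sub_lt {k : ℝ × ℝ → ℝ} {c d : ℝ}
    (hk : ContinuousOn k (Icc 0 1 ×ˢ Icc c d)) {δ : ℝ} (hδ : 0 < δ) :
    ∀ᶠ r in 𝓝[<] (1 : ℝ), ∀ t ∈ Icc c d, |k (r, t) - k (1, t)| < δ := by
  have huc := (isCompact_Icc.prod isCompact_Icc).uniformContinuousOn_of_continuous hk
  obtain ⟨η, hη, h⟩ := Metric.uniformContinuousOn_iff.1 huc δ hδ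
  filter_upwards [Ioo_mem_nhdsLT (show max 0 (1 - η) < 1 by simp [hη])] with r hr t ht
  have hr0 : 0 < r := (le_max_left _ _).trans_lt hr.1
  have hr1 : 1 - η < r := (le_max_right _ _).trans_lt hr.1
  refine h (r, t) ⟨⟨hr0.le, hr.2.le⟩, ht⟩ (1, t) ⟨⟨zero_le_one, le_rfl⟩, ht⟩ ?_
  rw [Prod.dist_eq, dist_self, max_eq_left dist_nonneg, Real.dist_eq, abs_lt]
  constructor <;> linarith [hr.2]

/-- Stokes' formula for a disc whose boundary is a polygon and which is collapsed along the radii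
to the vertices. -/
theorem integral_hypDensity_eq_sum {g : ℂ → ℂ} (hcont : ContinuousOn g (Metric.closedBall 0 1))
    (him : ∀ z ∈ Metric.closedBall (0 : ℂ) 1, 0 < (g z).im)
    (hs : ContDiffOn ℝ ∞ g (Metric.ball 0 1))
    (hint : IntegrableOn (hypDensity g) (Metric.ball 0 1)) {n : ℕ} {θ : ℕ → ℝ} (hmono : Monotone θ)
    (hper : θ n = θ 0 + 2 * Real.pi) (v : ℕ → ℂ) (M : ℕ → SL(2, ℝ))
    (hM : ∀ j < n, ∀ t ∈ Icc (θ j) (θ (j + 1)), (mobius (M j) (g (polarMap (1, t)))).re = 0)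
    (hv : ∀ j ≤ n, ∀ᶠ r in 𝓝[<] (1 : ℝ), g (polarMap (r, θ j)) = v j) :
    ∫ z in Metric.ball (0 : ℂ) 1, hypDensity g z =
      ∑ j ∈ Finset.range n, sideAngle (v j) (v (j + 1)) := by
  obtain ⟨C, H, hH, hH0, hH2, hHC⟩ := exists_smooth_eq_zero_near_zero
  have him' : ∀ z ∈ Metric.ball (0 : ℂ) 1, 0 < (g z).im := fun z hz =>
    him z (Metric.ball_subset_closedBall hz)
  set G : ℝ × ℝ → ℂ := fun x => g (polarMap x) with hGdef
  have hU : IsOpen (Ioo (-1 : ℝ) 1 ×ˢ (univ : Set ℝ)) := isOpen_Ioo.prod isOpen_univ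
  have hG : ContDiffOn ℝ 2 G _ := contDiffOn_comp_polarMap hs
  have hball : ∀ x ∈ Ioo (-1 : ℝ) 1 ×ˢ (univ : Set ℝ), polarMap x ∈ Metric.ball (0 : ℂ) 1 :=
    fun x hx => by
      rw [mem_ball_zero_iff, norm_polarMap]
      exact abs_lt.2 hx.1
  have hd : ∀ z ∈ Metric.ball (0 : ℂ) 1, DifferentiableAt ℝ g z := fun z hz =>
    (hs.contDiffAt (Metric.isOpen_ball.mem_nhds hz)).differentiableAt (by norm_num)
  have hGi : ∀ x ∈ Ioo (-1 : ℝ) 1 ×ˢ (univ : Set ℝ), 0 < (G x).im := fun x hx =>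
    him' _ (hball x hx)
  have hdens : ContinuousOn (hypDensity g) (Metric.ball 0 1) :=
    continuousOn_hypDensity Metric.isOpen_ball (hs.of_le (by norm_cast)) him'
  have hGc : ContinuousOn G (Icc 0 1 ×ˢ (univ : Set ℝ)) :=
    hcont.comp (contDiff_polarMap (n := 0)).continuous.continuousOn fun x hx => by
      rw [mem_closedBall_zero_iff, norm_polarMap, abs_of_nonneg hx.1.1]
      exact hx.1.2
  have hGi1 : ∀ x ∈ Icc (0 : ℝ) 1 ×ˢ (univ : Set ℝ), 0 < (G x).im := fun x hx => by
    refine him _ ?_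
    rw [mem_closedBall_zero_iff, norm_polarMap, abs_of_nonneg hx.1.1]
    exact hx.1.2
  -- the vertices lie on the geodesics
  have hlim : ∀ j ≤ n, g (polarMap (1, θ j)) = v j := fun j hj => by
    have h1 : Tendsto (fun r : ℝ => G (r, θ j)) (𝓝[<] 1) (𝓝 (G (1, θ j))) := by
      have h2 : ContinuousWithinAt (fun r : ℝ => G (r, θ j)) (Icc 0 1) 1 :=
        (hGc.comp (f := fun r : ℝ => (r, θ j)) (by fun_prop) fun r hr => ⟨hr, mem_univ _⟩) 1
          ⟨zero_le_one, le_rfl⟩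
      refine h2.mono_left ?_
      refine nhdsWithin_le_of_mem ?_
      filter_upwards [Ioo_mem_nhdsLT zero_lt_one] with r hr using ⟨hr.1.le, hr.2.le⟩
    exact tendsto_nhds_unique h1
      ((tendsto_congr' (hv j hj)).2 tendsto_const_nhds)
  -- a common radius
  have hall : ∀ᶠ r in 𝓝[<] (1 : ℝ), ∀ j ∈ Finset.range (n + 1), G (r, θ j) = v j :=
    (Finset.eventually_all _).2 fun j hj => hv j (Nat.lt_succ_iff.1 (Finset.mem_range.1 hj))
  obtain ⟨R₀, hR₀, hR₀'⟩ := (mem_nhdsLT_iff_exists_Ioo_subset' zero_lt_one).1 hall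
  set B : ℝ → ℝ := fun R => ∫ z in {z : ℂ | R < ‖z‖ ∧ ‖z‖ < 1}, |hypDensity g z| with hB
  have hring : ∀ R : ℝ, MeasurableSet {z : ℂ | R < ‖z‖ ∧ ‖z‖ < 1} := fun R =>
    (measurableSet_lt measurable_const measurable_norm).inter
      (measurableSet_lt measurable_norm measurable_const)
  have hringI : ∀ R : ℝ, IntegrableOn (fun z => |hypDensity g z|) {z : ℂ | R < ‖z‖ ∧ ‖z‖ < 1} :=
    fun R => (hint.mono_set fun z hz => mem_ball_zero_iff.2 hz.2).abs
  -- `B R` is the absolute area outside radius `R`: it is lost once by stopping at `R`, and enters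
  -- `C` times for each of the `n` sides.
  have main : ∀ R, max 0 R₀ < R → R < 1 → |(∫ z in Metric.ball (0 : ℂ) 1, hypDensity g z) -
      ∑ j ∈ Finset.range n, sideAngle (v j) (v (j + 1))| ≤ B R + n * (C * B R) := by
    intro R hRR hR1
    have hR0 : 0 < R := (le_max_left _ _).trans_lt hRR
    have hRR0 : R₀ < R := (le_max_right _ _).trans_lt hRR
    have hsub : ∀ c d, Ico R 1 ×ˢ Icc c d ⊆ Ioo (-1 : ℝ) 1 ×ˢ (univ : Set ℝ) := fun c d =>
      Set.prod_mono (fun x hx => ⟨by linarith [hx.1], hx.2⟩) (subset_univ _)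
    have hcol : ∀ j ≤ n, ∀ r ∈ Ico R 1, G (r, θ j) = v j := fun j hj r hr =>
      hR₀' ⟨hRR0.trans_le hr.1, hr.2⟩ j (Finset.mem_range.2 (Nat.lt_succ_iff.2 hj))
    have hcold : ∀ j ≤ n, ∀ r ∈ Ico R 1, fderiv ℝ G (r, θ j) (1, 0) = 0 := fun j hj r hr => by
      have hx := hsub (θ j) (θ j) (mk_mem_prod hr (left_mem_Icc.2 le_rfl))
      have hdG : DifferentiableAt ℝ G (r, θ j) :=
        (hG.contDiffAt (hU.mem_nhds hx)).differentiableAt (by norm_num)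
      have h1 := hdG.hasFDerivAt.comp_hasDerivAt (f := fun r => (r, θ j)) r
        ((hasDerivAt_id r).prodMk (hasDerivAt_const r (θ j)))
      have h2 : (G ∘ fun r => (r, θ j)) =ᶠ[𝓝 r] fun _ => v j := by
        filter_upwards [Ioo_mem_nhds (hRR0.trans_le hr.1) hr.2] with s hs
        exact hR₀' hs j (Finset.mem_range.2 (Nat.lt_succ_iff.2 hj))
      exact h1.unique ((hasDerivAt_const r (v j)).congr_of_eventuallyEq h2)
    have hside : ∀ j < n, |(∫ t in θ j..θ (j + 1), (fderiv ℝ G (R, t) (0, 1)).re / (G (R, t)).im) -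
        sideAngle (v j) (v (j + 1))| ≤ C * B R := fun j hj => by
      have hle : θ j ≤ θ (j + 1) := hmono (Nat.le_succ j)
      have hRmem : R ∈ Ico R 1 := ⟨le_rfl, hR1⟩
      rw [← hcol j hj.le R hRmem, ← hcol (j + 1) hj R hRmem]
      refine abs_integral_sub_sideAngle_le hH hH0 hH2 hHC hU hG hGi (M j) hle hR1 (hsub _ _) ?_
        (hcold j hj.le) (hcold (j + 1) hj) ?_ ?_ ?_
      · intro δ hδ
        have hk : ContinuousOn (fun x => (mobius (M j) (G x)).re)
            (Icc 0 1 ×ˢ Icc (θ j) (θ (j + 1))) := by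
          refine Complex.continuous_re.comp_continuousOn fun x hx => ?_
          have hx' : x ∈ Icc (0 : ℝ) 1 ×ˢ (univ : Set ℝ) := ⟨hx.1, mem_univ _⟩
          exact (hasDerivAt_mobius (M j) (hGi1 x hx')).continuousAt.comp_continuousWithinAt
            ((hGc x hx').mono (Set.prod_mono le_rfl (subset_univ _)))
        filter_upwards [eventually_forall_abs_sub_lt hk hδ] with r hr t ht
        have := hr t ht
        simpa only [hGdef, hM j hj t ht, sub_zero] using this
      · rw [hcol j hj.le R hRmem, ← hlim j hj.le]
        exact hM j hj _ ⟨le_rfl, hle⟩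
      · rw [hcol (j + 1) hj R hRmem, ← hlim (j + 1) hj]
        exact hM j hj _ ⟨hle, le_rfl⟩
      · intro R' hR'
        have habs : ContinuousOn (fun z => |hypDensity g z|) (Metric.closedBall 0 R') :=
          (hdens.mono (Metric.closedBall_subset_ball hR'.2)).abs
        have h1 := integral_annulus hR0.le hR'.1 habs (θ j)
        have h2 : (∫ z in {z : ℂ | R < ‖z‖ ∧ ‖z‖ ≤ R'}, |hypDensity g z|) ≤ B R := by
          refine setIntegral_mono_set (hringI R) (ae_of_all _ fun _ => abs_nonneg _)
            (LE.le.eventuallyLE fun z hz => ⟨hz.1, hz.2.trans_lt hR'.2⟩)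
        refine le_trans ?_ (h1.symm.le.trans h2)
        -- A single sector is at most a full turn, so its area is bounded by that of the whole ring.
        have hθ2 : θ (j + 1) ≤ θ j + 2 * Real.pi := by
          linarith [hmono (Nat.zero_le j), hmono (Nat.succ_le_of_lt hj)]
        have hWc : ContinuousOn (fun x => |hypJacobian G x|) (Ioo (-1 : ℝ) 1 ×ˢ (univ : Set ℝ)) :=
          (continuousOn_hypJacobian hU hG hGi).abs
        have hsub2 : ∀ d, Icc R R' ×ˢ Icc (θ j) d ⊆ Ioo (-1 : ℝ) 1 ×ˢ (univ : Set ℝ) := fun d =>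
          (Set.prod_mono (Icc_subset_Ico_right hR'.2) le_rfl).trans (hsub _ _)
        have hI : ∀ r ∈ Icc R R', ∀ d, θ j ≤ d → IntervalIntegrable
            (fun t => |hypJacobian G (r, t)|) volume (θ j) d := fun r hr d hjd => by
          refine ContinuousOn.intervalIntegrable ?_
          rw [uIcc_of_le hjd]
          exact hWc.comp (by fun_prop) fun t ht => hsub2 d ⟨hr, ht⟩
        have e : (∫ r in R..R', ∫ t in θ j..θ j + 2 * Real.pi,
            r * |hypDensity g (polarMap (r, t))|) =
            ∫ r in R..R', ∫ t in θ j..θ j + 2 * Real.pi, |hypJacobian G (r, t)| := by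
          refine intervalIntegral.integral_congr fun r hr => ?_
          refine intervalIntegral.integral_congr fun t _ => ?_
          rw [uIcc_of_le hR'.1] at hr
          have hx : (r, t) ∈ Ioo (-1 : ℝ) 1 ×ˢ (univ : Set ℝ) :=
            ⟨⟨by linarith [hr.1], hr.2.trans_lt hR'.2⟩, mem_univ _⟩
          simp only [hGdef]
          rw [hypJacobian_comp_polarMap (hd _ (hball _ hx)), abs_mul,
            abs_of_nonneg (hR0.le.trans hr.1)]
        rw [e]
        refine intervalIntegral.integral_mono_on hR'.1
          (ContinuousOn.intervalIntegrable_integral (F := fun x => |hypJacobian G x|) hR'.1 hle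
            (hWc.mono (hsub2 _)))
          (ContinuousOn.intervalIntegrable_integral (F := fun x => |hypJacobian G x|) hR'.1
            (hle.trans hθ2) (hWc.mono (hsub2 _))) fun r hr => ?_
        refine intervalIntegral.integral_mono_interval le_rfl hle hθ2
          (ae_of_all _ fun _ => abs_nonneg _) (hI r hr _ (hle.trans hθ2))
    have hdisc := integral_annulus_hypDensity hs him' hR0.le hR1 (θ 0)
    have hline : ContinuousOn (fun t : ℝ => (fderiv ℝ G (R, t) (0, 1)).re / (G (R, t)).im) univ := by
      have hmem : ∀ t : ℝ, (R, t) ∈ Ioo (-1 : ℝ) 1 ×ˢ (univ : Set ℝ) := fun t =>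
        ⟨⟨by linarith, hR1⟩, mem_univ _⟩
      have h1 : ContinuousOn (fun x => (fderiv ℝ G x (0, 1)).re / (G x).im)
          (Ioo (-1 : ℝ) 1 ×ˢ (univ : Set ℝ)) :=
        (Complex.continuous_re.comp_continuousOn
          ((hG.continuousOn_fderiv_of_isOpen hU (by norm_num)).clm_apply continuousOn_const)).div
          (Complex.continuous_im.comp_continuousOn hG.continuousOn) fun x hx => (hGi x hx).ne'
      exact h1.comp (by fun_prop) fun t _ => hmem t
    have hsum := intervalIntegral.sum_integral_adjacent_intervals (a := θ) (n := n)
      (f := fun t : ℝ => (fderiv ℝ G (R, t) (0, 1)).re / (G (R, t)).im) (μ := volume)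
      fun k _ => (hline.mono (subset_univ _)).intervalIntegrable
    rw [hper] at hsum
    have hball_split : (∫ z in Metric.ball (0 : ℂ) 1, hypDensity g z) =
        (∫ z in {z : ℂ | 0 < ‖z‖ ∧ ‖z‖ ≤ R}, hypDensity g z) +
          ∫ z in {z : ℂ | R < ‖z‖ ∧ ‖z‖ < 1}, hypDensity g z := by
      rw [← setIntegral_union _ (hring R)
        (hint.mono_set fun z hz => mem_ball_zero_iff.2 (hz.2.trans_lt hR1))
        (hint.mono_set fun z hz => mem_ball_zero_iff.2 hz.2)]
      · have hz : (Metric.ball (0 : ℂ) 1 : Set ℂ) =ᵐ[volume] (Metric.ball (0 : ℂ) 1 \ {0} : Set ℂ) :=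
          (sdiff_null_ae_eq_self (by simp)).symm
        rw [setIntegral_congr_set hz]
        congr 2
        ext z
        simp only [Set.mem_sdiff, mem_ball_zero_iff, mem_singleton_iff, mem_union, mem_ofPred_eq,
          ← norm_pos_iff]
        constructor
        · rintro ⟨h1, h2⟩
          rcases le_or_gt ‖z‖ R with h | h
          · exact Or.inl ⟨h2, h⟩
          · exact Or.inr ⟨h, h1⟩
        · rintro (⟨h1, h2⟩ | ⟨h1, h2⟩)
          · exact ⟨h2.trans_lt hR1, h1⟩
          · exact ⟨h2, hR0.trans h1⟩
      · exact Set.disjoint_left.2 fun z h1 h2 => absurd h1.2 (not_le.2 h2.1)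
    have h3 : |∫ z in {z : ℂ | R < ‖z‖ ∧ ‖z‖ < 1}, hypDensity g z| ≤ B R :=
      abs_integral_le_integral_abs
    have h4 : |∑ j ∈ Finset.range n, ((∫ t in θ j..θ (j + 1),
        (fderiv ℝ G (R, t) (0, 1)).re / (G (R, t)).im) - sideAngle (v j) (v (j + 1)))| ≤
        n * (C * B R) := by
      refine (Finset.abs_sum_le_sum_abs _ _).trans ?_
      refine (Finset.sum_le_card_nsmul _ _ _ fun j hj => hside j (Finset.mem_range.1 hj)).trans ?_
      simp
    rw [Finset.sum_sub_distrib, hsum] at h4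
    rw [hball_split, hdisc]
    rw [abs_le] at h3 h4 ⊢
    constructor <;> linarith [h3.1, h3.2, h4.1, h4.2]
  have hBlim := tendsto_setIntegral_norm_gt hint.abs
  have hlim2 : Tendsto (fun k : ℕ => B (1 - 1 / ((k : ℝ) + 1)) +
      n * (C * B (1 - 1 / ((k : ℝ) + 1)))) atTop (𝓝 (0 + n * (C * 0))) :=
    hBlim.add ((hBlim.const_mul C).const_mul _)
  rw [mul_zero, mul_zero, add_zero] at hlim2
  have hev : ∀ᶠ k : ℕ in atTop, max 0 R₀ < 1 - 1 / ((k : ℝ) + 1) := by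
    have : Tendsto (fun k : ℕ => 1 - 1 / ((k : ℝ) + 1)) atTop (𝓝 (1 - 0)) :=
      tendsto_const_nhds.sub tendsto_one_div_add_atTop_nhds_zero_nat
    rw [sub_zero] at this
    exact this.eventually (lt_mem_nhds (max_lt zero_lt_one hR₀))
  have hle := ge_of_tendsto hlim2 (hev.mono fun k hk => main _ hk (by
    have : (0 : ℝ) < 1 / ((k : ℝ) + 1) := by positivity
    linarith))
  exact sub_eq_zero.1 (abs_nonpos_iff.1 hle)

/-! ### Integrability of the area density -/

/-- Where `f` is injective, the change of variables turns the integral of the absolute density into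
the area of the image, which lies in a compact subset of the half-plane. Compactness of the closed
disc reduces to finitely many such pieces, including those at the boundary. -/
theorem integrableOn_hypDensity {f : ℂ → ℂ} (hc : ContinuousOn f (Metric.closedBall 0 1))
    (him : ∀ z ∈ Metric.closedBall (0 : ℂ) 1, 0 < (f z).im)
    (hinj : ∀ z ∈ Metric.closedBall (0 : ℂ) 1, ∃ U ∈ 𝓝 z, InjOn f (U ∩ Metric.closedBall 0 1))
    (hs : ContDiffOn ℝ ∞ f (Metric.ball 0 1)) :
    IntegrableOn (hypDensity f) (Metric.ball 0 1) := by
  have hcomp : IsCompact (Metric.closedBall (0 : ℂ) 1) := isCompact_closedBall 0 1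
  have hdens : ContinuousOn (hypDensity f) (Metric.ball 0 1) :=
    continuousOn_hypDensity Metric.isOpen_ball (hs.of_le (by norm_cast))
      fun z hz => him z (Metric.ball_subset_closedBall hz)
  have hd : ∀ z ∈ Metric.ball (0 : ℂ) 1, DifferentiableAt ℝ f z := fun z hz =>
    (hs.contDiffAt (Metric.isOpen_ball.mem_nhds hz)).differentiableAt (by norm_num)
  have key : IntegrableOn (hypDensity f) (Metric.closedBall 0 1 ∩ Metric.ball 0 1) := by
    refine hcomp.induction_on (p := fun s => IntegrableOn (hypDensity f) (s ∩ Metric.ball 0 1) volume)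
      (by simp) (fun s t hst ht => ht.mono_set (inter_subset_inter_left _ hst))
      (fun s t h1 h2 => by rw [union_inter_distrib_right]; exact h1.union h2) fun z hz => ?_
    obtain ⟨U, hU, hUinj⟩ := hinj z hz
    obtain ⟨V, hVU, hVo, hzV⟩ := mem_nhds_iff.1 hU
    refine ⟨V, mem_nhdsWithin_of_mem_nhds (hVo.mem_nhds hzV), ?_⟩
    have hms : MeasurableSet (V ∩ Metric.ball (0 : ℂ) 1) :=
      (hVo.inter Metric.isOpen_ball).measurableSet
    have hVinj : InjOn f (V ∩ Metric.ball 0 1) :=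
      hUinj.mono (inter_subset_inter hVU Metric.ball_subset_closedBall)
    have hK : IsCompact (f '' Metric.closedBall (0 : ℂ) 1) := hcomp.image_of_continuousOn hc
    have h1 : IntegrableOn (fun w : ℂ => (w.im ^ 2)⁻¹) (f '' (V ∩ Metric.ball 0 1)) := by
      refine IntegrableOn.mono_set (t := f '' Metric.closedBall (0 : ℂ) 1)
        (ContinuousOn.integrableOn_compact hK ?_)
        (image_mono (inter_subset_right.trans Metric.ball_subset_closedBall))
      refine ContinuousOn.inv₀ (by fun_prop) ?_
      rintro _ ⟨z, hz, rfl⟩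
      exact (pow_pos (him z hz) 2).ne'
    rw [integrableOn_image_iff_integrableOn_abs_det_fderiv_smul volume hms
      (fun x hx => (hd x hx.2).hasFDerivAt.hasFDerivWithinAt) hVinj] at h1
    have hae : AEStronglyMeasurable (hypDensity f) (volume.restrict (V ∩ Metric.ball 0 1)) :=
      (hdens.mono inter_subset_right).aestronglyMeasurable hms
    refine (integrable_norm_iff hae).1 (h1.congr (ae_of_all _ fun x => ?_))
    simp only [hypDensity, norm_div, Real.norm_eq_abs, norm_pow, sq_abs, smul_eq_mul]
    rfl
  rwa [inter_eq_right.2 Metric.ball_subset_closedBall] at key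

/-- Makes the preimage of the vertices a null set, so that the collapsing maps converge to the
identity at almost every point of the disc. -/
theorem finite_fiber_of_locally_injective {X Y : Type*} [TopologicalSpace X] {f : X → Y} {s : Set X}
    (hs : IsCompact s) (hinj : ∀ z ∈ s, ∃ U ∈ 𝓝 z, InjOn f (U ∩ s)) (y : Y) :
    (s ∩ f ⁻¹' {y}).Finite := by
  have key : (s ∩ (s ∩ f ⁻¹' {y})).Finite := by
    refine hs.induction_on (p := fun t => (t ∩ (s ∩ f ⁻¹' {y})).Finite)
      (by simp) (fun t t' h ht => ht.subset (inter_subset_inter_left _ h))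
      (fun t t' h1 h2 => by rw [union_inter_distrib_right]; exact h1.union h2) fun z hz => ?_
    obtain ⟨U, hU, hUinj⟩ := hinj z hz
    refine ⟨U, mem_nhdsWithin_of_mem_nhds hU, Set.Subsingleton.finite fun a ha b hb => ?_⟩
    exact hUinj ⟨ha.1, ha.2.1⟩ ⟨hb.1, hb.2.1⟩ (Eq.trans ha.2.2 (Eq.symm hb.2.2))
  rwa [← inter_assoc, inter_self] at key

/-! ### Maps collapsing neighbourhoods of points -/

/-- A smooth compactly supported map equal to `-id` near the origin. -/
noncomputable def collapseBump (u : ℂ) : ℂ :=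
  (Real.smoothTransition (Complex.normSq u - 1) - 1) • u

theorem collapseBump_of_le {u : ℂ} (h : Complex.normSq u ≤ 1) : collapseBump u = -u := by
  rw [collapseBump, Real.smoothTransition.zero_of_nonpos (by linarith)]
  simp

theorem collapseBump_of_ge {u : ℂ} (h : 2 ≤ Complex.normSq u) : collapseBump u = 0 := by
  rw [collapseBump, Real.smoothTransition.one_of_one_le (by linarith)]
  simp

theorem contDiff_normSq {n : WithTop ℕ∞} : ContDiff ℝ n Complex.normSq := by
  have : (Complex.normSq : ℂ → ℝ) = fun z => Complex.reCLM z * Complex.reCLM z +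
      Complex.imCLM z * Complex.imCLM z := by
    funext z
    rw [Complex.normSq_apply]
    rfl
  rw [this]
  fun_prop

theorem contDiff_collapseBump : ContDiff ℝ ∞ collapseBump :=
  ((Real.smoothTransition.contDiff.comp (contDiff_normSq.sub contDiff_const)).sub
    contDiff_const).smul contDiff_id

theorem hasCompactSupport_collapseBump : HasCompactSupport collapseBump := by
  refine HasCompactSupport.intro (isCompact_closedBall (0 : ℂ) 2) fun u hu => ?_
  refine collapseBump_of_ge ?_
  rw [mem_closedBall_zero_iff, not_le] at hu
  rw [Complex.normSq_eq_norm_sq]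
  nlinarith

theorem norm_lt_two_of_collapseBump_ne_zero {u : ℂ} (h : collapseBump u ≠ 0) : ‖u‖ < 2 := by
  by_contra! h2
  refine h (collapseBump_of_ge ?_)
  rw [Complex.normSq_eq_norm_sq]
  nlinarith

/-! ### Collapsing the vertices in coordinates with straight geodesics -/

/-- The coordinates `(x, x² + y²)` of the upper half-plane, in which geodesics are straight. -/
noncomputable def klein (z : ℂ) : ℂ := ⟨z.re, Complex.normSq z⟩

/-- The inverse of `klein`. -/
noncomputable def kleinInv (w : ℂ) : ℂ := ⟨w.re, Real.sqrt (w.im - w.re ^ 2)⟩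

theorem contDiff_complex_mk {E : Type*} [NormedAddCommGroup E] [NormedSpace ℝ E] {a b : E → ℝ}
    {x : E} {n : WithTop ℕ∞} (ha : ContDiffAt ℝ n a x) (hb : ContDiffAt ℝ n b x) :
    ContDiffAt ℝ n (fun y => (⟨a y, b y⟩ : ℂ)) x := by
  have h := (Complex.ofRealCLM.contDiff.contDiffAt.comp x ha).add
    ((Complex.ofRealCLM.contDiff.contDiffAt.comp x hb).mul (contDiffAt_const (c := Complex.I)))
  refine h.congr_of_eventuallyEq (.of_forall fun y => ?_)
  apply Complex.ext <;> simp

theorem contDiff_klein {n : WithTop ℕ∞} : ContDiff ℝ n klein :=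
  contDiff_iff_contDiffAt.2 fun _ => contDiff_complex_mk Complex.reCLM.contDiff.contDiffAt
    contDiff_normSq.contDiffAt

theorem contDiffAt_kleinInv {w : ℂ} (hw : w.re ^ 2 < w.im) {n : WithTop ℕ∞} :
    ContDiffAt ℝ n kleinInv w := by
  refine contDiff_complex_mk Complex.reCLM.contDiff.contDiffAt (ContDiffAt.sqrt ?_ (by linarith))
  exact Complex.imCLM.contDiff.contDiffAt.sub (Complex.reCLM.contDiff.contDiffAt.pow 2)

theorem isOpen_kleinDomain : IsOpen {w : ℂ | w.re ^ 2 < w.im} :=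
  isOpen_lt (by fun_prop) (by fun_prop)

theorem klein_mem {z : ℂ} (hz : 0 < z.im) : (klein z).re ^ 2 < (klein z).im := by
  simp only [klein, Complex.normSq_apply]
  nlinarith

theorem kleinInv_klein {z : ℂ} (hz : 0 < z.im) : kleinInv (klein z) = z := by
  apply Complex.ext
  · rfl
  · simp only [kleinInv, klein, Complex.normSq_apply]
    rw [show z.re * z.re + z.im * z.im - z.re ^ 2 = z.im ^ 2 by ring, Real.sqrt_sq hz.le]

theorem klein_kleinInv {w : ℂ} (hw : w.re ^ 2 < w.im) : klein (kleinInv w) = w := by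
  apply Complex.ext
  · rfl
  · simp only [kleinInv, klein, Complex.normSq_apply]
    rw [Real.mul_self_sqrt (by linarith)]
    ring

theorem kleinInv_im_pos {w : ℂ} (hw : w.re ^ 2 < w.im) : 0 < (kleinInv w).im :=
  Real.sqrt_pos.2 (by linarith)

/-- A geodesic is the preimage of the imaginary axis under an isometry; in the coordinates `klein`
its equation is affine. The collapse moves points towards a vertex along straight lines, hence
respects these equations. -/
theorem mobius_re_eq_zero_iff (M : SL(2, ℝ)) {z : ℂ} (hz : 0 < z.im) :
    (mobius M z).re = 0 ↔ M 0 0 * M 1 0 * (klein z).im +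
      (M 0 0 * M 1 1 + M 0 1 * M 1 0) * (klein z).re + M 0 1 * M 1 1 = 0 := by
  have hn : Complex.normSq (mobiusDen M z) ≠ 0 := by simpa using mobiusDen_ne_zero M hz
  rw [mobius, Complex.div_re, ← add_div, div_eq_zero_iff, or_iff_left hn]
  simp only [klein, Complex.normSq_apply, mobiusDen]
  simp
  constructor <;> intro h <;> linear_combination h

/-- The map collapsing, in the coordinates `klein`, a small neighbourhood of each point of `S`. -/
noncomputable def kleinCollapse (S : Finset ℂ) (ε : ℝ) (w : ℂ) : ℂ :=
  w + ∑ v ∈ S, ε • collapseBump (ε⁻¹ • (w - klein v))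

/-- The map of the upper half-plane collapsing a small neighbourhood of each point of `S`. -/
noncomputable def collapse (S : Finset ℂ) (ε : ℝ) (z : ℂ) : ℂ :=
  kleinInv (kleinCollapse S ε (klein z))

theorem contDiff_kleinCollapse (S : Finset ℂ) (ε : ℝ) : ContDiff ℝ ∞ (kleinCollapse S ε) := by
  refine contDiff_id.add (ContDiff.sum fun v _ => ?_)
  exact (contDiff_collapseBump.comp
    ((contDiff_id.sub contDiff_const).const_smul ε⁻¹)).const_smul ε

theorem exists_norm_kleinCollapse_sub_le (S : Finset ℂ) :
    ∃ C, ∀ ε > 0, ∀ w, ‖kleinCollapse S ε w - w‖ ≤ C * ε := by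
  obtain ⟨C, hC⟩ := hasCompactSupport_collapseBump.exists_bound_of_continuous
    contDiff_collapseBump.continuous
  refine ⟨S.card * C, fun ε hε w => ?_⟩
  rw [kleinCollapse, add_sub_cancel_left]
  refine (norm_sum_le _ _).trans ((Finset.sum_le_card_nsmul _ _ (ε * C) fun v _ => ?_).trans ?_)
  · rw [norm_smul, Real.norm_of_nonneg hε.le]
    exact mul_le_mul_of_nonneg_left (hC _) hε.le
  · rw [nsmul_eq_mul]
    exact le_of_eq (by ring)

/-- The outer factor `ε` and the inner `ε⁻¹` cancel in the derivative. A bound independent of `ε` is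
what gives a dominating function. -/
theorem exists_norm_fderiv_kleinCollapse_le (S : Finset ℂ) :
    ∃ C, ∀ ε > 0, ∀ w, ‖fderiv ℝ (kleinCollapse S ε) w‖ ≤ C := by
  obtain ⟨C, hC⟩ := (hasCompactSupport_collapseBump.fderiv ℝ).exists_bound_of_continuous
    (contDiff_collapseBump.continuous_fderiv (by norm_num))
  refine ⟨1 + S.card * C, fun ε hε w => ?_⟩
  have h1 : ∀ v, HasFDerivAt (fun w => ε • collapseBump (ε⁻¹ • (w - klein v)))
      (fderiv ℝ collapseBump (ε⁻¹ • (w - klein v))) w := fun v => by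
    have h2 : HasFDerivAt (fun w : ℂ => ε⁻¹ • (w - klein v))
        (ε⁻¹ • ContinuousLinearMap.id ℝ ℂ) w := ((hasFDerivAt_id w).sub_const _).const_smul ε⁻¹
    have h3 := ((contDiff_collapseBump.differentiable (by norm_num)
      (ε⁻¹ • (w - klein v))).hasFDerivAt.comp w h2).const_smul ε
    refine h3.congr_fderiv ?_
    ext; simp [hε.ne']
  have h4 : HasFDerivAt (kleinCollapse S ε) (ContinuousLinearMap.id ℝ ℂ +
      ∑ v ∈ S, fderiv ℝ collapseBump (ε⁻¹ • (w - klein v))) w :=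
    (hasFDerivAt_id w).add (HasFDerivAt.fun_sum fun v _ => h1 v)
  rw [h4.fderiv]
  refine (norm_add_le _ _).trans (add_le_add ContinuousLinearMap.norm_id_le ?_)
  refine (norm_sum_le _ _).trans ((Finset.sum_le_card_nsmul _ _ C fun v _ => hC _).trans ?_)
  rw [nsmul_eq_mul]

theorem kleinCollapse_eq_self {S : Finset ℂ} {ε : ℝ} (hε : 0 < ε) {w : ℂ}
    (h : ∀ v ∈ S, 2 * ε ≤ ‖w - klein v‖) : kleinCollapse S ε w = w := by
  rw [kleinCollapse, Finset.sum_eq_zero, add_zero]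
  intro v hv
  by_contra hne
  have h1 := norm_lt_two_of_collapseBump_ne_zero (fun h0 => hne (by rw [h0, smul_zero]))
  rw [norm_smul, norm_inv, Real.norm_of_nonneg hε.le, inv_mul_lt_iff₀ hε] at h1
  linarith [h v hv]

theorem kleinCollapse_eq_klein {S : Finset ℂ} {ε : ℝ} (hε : 0 < ε) {w v : ℂ} (hv : v ∈ S)
    (hw : ‖w - klein v‖ ≤ ε) (h : ∀ v' ∈ S, v' ≠ v → 2 * ε ≤ ‖w - klein v'‖) :
    kleinCollapse S ε w = klein v := by
  rw [kleinCollapse, Finset.sum_eq_single_of_mem v hv]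
  · rw [collapseBump_of_le, smul_neg, smul_inv_smul₀ hε.ne']
    · ring
    · rw [Complex.normSq_eq_norm_sq, norm_smul, norm_inv, Real.norm_of_nonneg hε.le]
      refine pow_le_one₀ (by positivity) ?_
      rwa [inv_mul_le_iff₀ hε, mul_one]
  · intro v' hv' hne
    by_contra hne'
    have h1 := norm_lt_two_of_collapseBump_ne_zero (fun h0 => hne' (by rw [h0, smul_zero]))
    rw [norm_smul, norm_inv, Real.norm_of_nonneg hε.le, inv_mul_lt_iff₀ hε] at h1
    linarith [h v' hv' hne]

theorem klein_injOn : InjOn klein {z | 0 < z.im} := fun z hz w hw h => by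
  rw [← kleinInv_klein hz, ← kleinInv_klein hw, h]

theorem eventually_collapse_eq_self {S : Finset ℂ} (hS : ∀ v ∈ S, 0 < v.im) {z : ℂ}
    (hz : 0 < z.im) (hzS : z ∉ S) : ∀ᶠ ε in 𝓝[>] (0 : ℝ), collapse S ε =ᶠ[𝓝 z] id := by
  have h1 : ∀ᶠ ε in 𝓝[>] (0 : ℝ), ∀ v ∈ S, 2 * ε < ‖klein z - klein v‖ := by
    refine (Finset.eventually_all _).2 fun v hv => ?_
    have hpos : 0 < ‖klein z - klein v‖ / 2 := half_pos (norm_pos_iff.2 (sub_ne_zero.2 fun h =>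
      hzS (klein_injOn hz (hS v hv) h ▸ hv)))
    filter_upwards [Ioo_mem_nhdsGT hpos] with ε hε
    linarith [hε.2]
  filter_upwards [h1, self_mem_nhdsWithin] with ε hε (hε0 : 0 < ε)
  have hkc : Continuous klein := (contDiff_klein (n := 0)).continuous
  have h2 : ∀ᶠ y in 𝓝 z, ∀ v ∈ S, 2 * ε < ‖klein y - klein v‖ :=
    (Finset.eventually_all _).2 fun v hv =>
      (Continuous.tendsto (f := fun y => ‖klein y - klein v‖) (by fun_prop) z).eventually
        (lt_mem_nhds (hε v hv))
  have h3 : ∀ᶠ y in 𝓝 z, 0 < y.im :=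
    (Complex.continuous_im.tendsto z).eventually (lt_mem_nhds hz)
  filter_upwards [h2, h3] with y hy hy0
  rw [collapse, kleinCollapse_eq_self hε0 fun v hv => (hy v hv).le, kleinInv_klein hy0]
  rfl

theorem eventually_collapse_eq_vertex {S : Finset ℂ} (hS : ∀ v ∈ S, 0 < v.im) {v : ℂ}
    (hv : v ∈ S) : ∀ᶠ ε in 𝓝[>] (0 : ℝ), ∀ᶠ z in 𝓝 v, collapse S ε z = v := by
  have h1 : ∀ᶠ ε in 𝓝[>] (0 : ℝ), ∀ v' ∈ S, v' ≠ v → 2 * ε < ‖klein v - klein v'‖ := by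
    refine (Finset.eventually_all _).2 fun v' hv' => ?_
    by_cases hne : v' = v
    · exact .of_forall fun _ h => absurd hne h
    have hpos : 0 < ‖klein v - klein v'‖ / 2 := half_pos (norm_pos_iff.2 (sub_ne_zero.2 fun h =>
      hne (klein_injOn (hS v hv) (hS v' hv') h).symm))
    filter_upwards [Ioo_mem_nhdsGT hpos] with ε hε _
    linarith [hε.2]
  filter_upwards [h1, self_mem_nhdsWithin] with ε hε (hε0 : 0 < ε)
  have hkc : Continuous klein := (contDiff_klein (n := 0)).continuous
  have h2 : ∀ᶠ y in 𝓝 v, ∀ v' ∈ S, v' ≠ v → 2 * ε < ‖klein y - klein v'‖ :=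
    (Finset.eventually_all _).2 fun v' hv' => by
      by_cases hne : v' = v
      · exact .of_forall fun _ h => absurd hne h
      · filter_upwards [(Continuous.tendsto (f := fun y => ‖klein y - klein v'‖)
          (by fun_prop) v).eventually (lt_mem_nhds (hε v' hv' hne))] with y hy _ using hy
  have h3 : ∀ᶠ y in 𝓝 v, ‖klein y - klein v‖ < ε :=
    (Continuous.tendsto (f := fun y => ‖klein y - klein v‖) (by fun_prop) v).eventually
      (gt_mem_nhds (by simpa using hε0))
  filter_upwards [h2, h3] with y hy hy0
  rw [collapse, kleinCollapse_eq_klein hε0 hv hy0.le fun v' hv' hne => (hy v' hv' hne).le,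
    kleinInv_klein (hS v hv)]

/-- Near a vertex on the geodesic, points of the geodesic move along it. Vertices off the geodesic
are at positive distance from it in the coordinates `klein`, so for small `ε` their bumps do not
reach it. The bound on `ε` depends only on `M` and `S`, not on the point. -/
theorem eventually_collapse_mem_geodesic {S : Finset ℂ} (M : SL(2, ℝ)) :
    ∀ᶠ ε in 𝓝[>] (0 : ℝ), ∀ z : ℂ, 0 < z.im → (mobius M z).re = 0 →
      (kleinCollapse S ε (klein z)).re ^ 2 < (kleinCollapse S ε (klein z)).im →
      (mobius M (collapse S ε z)).re = 0 := by
  set A := M 0 0 * M 1 0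
  set B := M 0 0 * M 1 1 + M 0 1 * M 1 0
  set D := M 0 1 * M 1 1
  have hsmall : ∀ᶠ ε in 𝓝[>] (0 : ℝ), ∀ v ∈ S, A * (klein v).im + B * (klein v).re + D ≠ 0 →
      (|A| + |B|) * (2 * ε) < |A * (klein v).im + B * (klein v).re + D| := by
    refine (Finset.eventually_all _).2 fun v hv => ?_
    by_cases hne : A * (klein v).im + B * (klein v).re + D = 0
    · exact .of_forall fun _ h => absurd hne h
    have ht : Tendsto (fun ε : ℝ => (|A| + |B|) * (2 * ε)) (𝓝[>] 0) (𝓝 ((|A| + |B|) * (2 * 0))) :=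
      Tendsto.mono_left (Continuous.tendsto (by fun_prop) 0) nhdsWithin_le_nhds
    have hpos : (|A| + |B|) * (2 * 0) < |A * (klein v).im + B * (klein v).re + D| := by
      rw [mul_zero, mul_zero]
      exact abs_pos.2 hne
    filter_upwards [ht.eventually (gt_mem_nhds hpos)] with ε hε _ using hε
  filter_upwards [hsmall, self_mem_nhdsWithin] with ε hε (hε0 : 0 < ε) z hz hzM hdom
  rw [collapse, mobius_re_eq_zero_iff M (kleinInv_im_pos hdom), klein_kleinInv hdom]
  rw [mobius_re_eq_zero_iff M hz] at hzM
  have hterm : ∀ v ∈ S, A * (ε • collapseBump (ε⁻¹ • (klein z - klein v))).im +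
      B * (ε • collapseBump (ε⁻¹ • (klein z - klein v))).re = 0 := fun v hv => by
    by_cases h0 : collapseBump (ε⁻¹ • (klein z - klein v)) = 0
    · rw [h0]
      simp
    have h1 := norm_lt_two_of_collapseBump_ne_zero h0
    rw [norm_smul, norm_inv, Real.norm_of_nonneg hε0.le, inv_mul_lt_iff₀ hε0] at h1
    -- An active bump is within `2 * ε` of its centre, so the affine equation at `v` fails by at
    -- most `(|A| + |B|) * (2 * ε)`; for small `ε` it must then hold exactly.
    have hvl : A * (klein v).im + B * (klein v).re + D = 0 := by
      by_contra hne
      have h2 := hε v hv hne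
      have h3 : A * (klein v).im + B * (klein v).re + D =
          -(A * (klein z - klein v).im + B * (klein z - klein v).re) := by
        simp only [Complex.sub_im, Complex.sub_re]
        linear_combination hzM
      rw [h3, abs_neg] at h2
      have h4 : |A * (klein z - klein v).im + B * (klein z - klein v).re| ≤
          |A| * ‖klein z - klein v‖ + |B| * ‖klein z - klein v‖ := by
        refine (abs_add_le _ _).trans (add_le_add ?_ ?_) <;> rw [abs_mul]
        · exact mul_le_mul_of_nonneg_left (Complex.abs_im_le_norm _) (abs_nonneg _)
        · exact mul_le_mul_of_nonneg_left (Complex.abs_re_le_norm _) (abs_nonneg _)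
      nlinarith [abs_nonneg A, abs_nonneg B]
    rw [collapseBump]
    simp only [Complex.smul_re, Complex.smul_im, smul_eq_mul, Complex.sub_im, Complex.sub_re]
    linear_combination (ε * ((Real.smoothTransition (Complex.normSq
      (ε⁻¹ • (klein z - klein v)) - 1) - 1) * ε⁻¹)) * (hzM - hvl)
  have hsum := Finset.sum_eq_zero hterm
  rw [Finset.sum_add_distrib, ← Finset.mul_sum, ← Finset.mul_sum, ← Complex.im_sum,
    ← Complex.re_sum] at hsum
  rw [kleinCollapse, Complex.add_im, Complex.add_re]
  linear_combination hzM + hsum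

theorem Complex.abs_det_le (L : ℂ →L[ℝ] ℂ) : |L.det| ≤ 2 * ‖L‖ ^ 2 := by
  have h1 : ‖L 1‖ ≤ ‖L‖ := by simpa using L.le_opNorm 1
  have hI : ‖L Complex.I‖ ≤ ‖L‖ := by simpa using L.le_opNorm Complex.I
  have hprod : ∀ a b : ℝ, |a| ≤ ‖L‖ → |b| ≤ ‖L‖ → |a * b| ≤ ‖L‖ ^ 2 := fun a b ha hb => by
    rw [abs_mul, pow_two]
    exact mul_le_mul ha hb (abs_nonneg _) (norm_nonneg _)
  rw [Complex.det_eq_re_mul_im_sub]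
  refine (abs_sub _ _).trans ?_
  have e1 := hprod _ _ ((Complex.abs_re_le_norm (L 1)).trans h1)
    ((Complex.abs_im_le_norm (L Complex.I)).trans hI)
  have e2 := hprod _ _ ((Complex.abs_re_le_norm (L Complex.I)).trans hI)
    ((Complex.abs_im_le_norm (L 1)).trans h1)
  linarith

/-- Uniform control of the collapsing maps on a compact set. -/
theorem exists_collapse_bound (S : Finset ℂ) {K : Set ℂ} (hK : IsCompact K)
    (hKim : ∀ z ∈ K, 0 < z.im) : ∃ C, ∀ᶠ ε in 𝓝[>] (0 : ℝ), ∀ z ∈ K,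
      (kleinCollapse S ε (klein z)).re ^ 2 < (kleinCollapse S ε (klein z)).im ∧
      |(fderiv ℝ (collapse S ε) z).det| / (collapse S ε z).im ^ 2 ≤ C := by
  have hkK : IsCompact (klein '' K) := hK.image (contDiff_klein (n := 0)).continuous
  obtain ⟨δ, hδ, hsub⟩ := hkK.exists_cthickening_subset_open isOpen_kleinDomain
    (by rintro _ ⟨z, hz, rfl⟩; exact klein_mem (hKim z hz))
  have hK' : IsCompact (Metric.cthickening δ (klein '' K)) := hkK.cthickening
  obtain ⟨C₀, hC₀⟩ := exists_norm_kleinCollapse_sub_le S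
  obtain ⟨C₁, hC₁⟩ := exists_norm_fderiv_kleinCollapse_le S
  have hinvc : ContDiffOn ℝ 1 kleinInv {w : ℂ | w.re ^ 2 < w.im} := fun w hw =>
    (contDiffAt_kleinInv hw).contDiffWithinAt
  obtain ⟨C₂, hC₂⟩ := hK'.exists_bound_of_continuousOn
    ((hinvc.continuousOn_fderiv_of_isOpen isOpen_kleinDomain le_rfl).mono hsub)
  obtain ⟨C₃, hC₃⟩ := hK.exists_bound_of_continuousOn
    ((contDiff_klein (n := 1)).continuous_fderiv (by norm_num)).continuousOn
  obtain ⟨C₄, hC₄⟩ := hK'.exists_bound_of_continuousOn (f := fun w => ((kleinInv w).im ^ 2)⁻¹)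
    (ContinuousOn.inv₀ ((Complex.continuous_im.comp_continuousOn
      (hinvc.continuousOn.mono hsub)).pow 2) fun w hw => (pow_pos (kleinInv_im_pos (hsub hw)) 2).ne')
  -- The chain rule bounds the derivative by `C₂ * C₁ * C₃`, a determinant is at most twice the
  -- square of the norm, and `C₄` bounds the inverse square of the height.
  refine ⟨2 * (C₂ * C₁ * C₃) ^ 2 * C₄, ?_⟩
  have ht : Tendsto (fun ε : ℝ => C₀ * ε) (𝓝[>] 0) (𝓝 (C₀ * 0)) :=
    Tendsto.mono_left (Continuous.tendsto (by fun_prop) 0) nhdsWithin_le_nhds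
  filter_upwards [ht.eventually (gt_mem_nhds (by simpa using hδ)), self_mem_nhdsWithin]
    with ε hε (hε0 : 0 < ε) z hz
  have hmem : kleinCollapse S ε (klein z) ∈ Metric.cthickening δ (klein '' K) := by
    refine Metric.mem_cthickening_of_dist_le _ (klein z) _ _ (mem_image_of_mem _ hz) ?_
    rw [dist_eq_norm]
    exact (hC₀ ε hε0 _).trans hε.le
  have hdom := hsub hmem
  refine ⟨hdom, ?_⟩
  have hfd : fderiv ℝ (collapse S ε) z = (fderiv ℝ kleinInv (kleinCollapse S ε (klein z))).comp
      ((fderiv ℝ (kleinCollapse S ε) (klein z)).comp (fderiv ℝ klein z)) := by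
    have h1 := ((contDiffAt_kleinInv (n := 1) hdom).differentiableAt (by norm_num)).hasFDerivAt
    have h2 := ((contDiff_kleinCollapse S ε).differentiable (by norm_num) (klein z)).hasFDerivAt
    have h3 := ((contDiff_klein (n := 1)).differentiable (by norm_num) z).hasFDerivAt
    exact (h1.comp z (h2.comp z h3)).fderiv
  have hn : ‖fderiv ℝ (collapse S ε) z‖ ≤ C₂ * C₁ * C₃ := by
    rw [hfd, mul_assoc]
    refine (ContinuousLinearMap.opNorm_comp_le _ _).trans ?_
    refine mul_le_mul (hC₂ _ hmem) ((ContinuousLinearMap.opNorm_comp_le _ _).trans ?_)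
      (norm_nonneg _) ((norm_nonneg _).trans (hC₂ _ hmem))
    exact mul_le_mul (hC₁ ε hε0 _) (hC₃ z hz) (norm_nonneg _)
      ((norm_nonneg _).trans (hC₁ ε hε0 (klein z)))
  rw [div_eq_mul_inv]
  refine mul_le_mul ((Complex.abs_det_le _).trans ?_) ((le_abs_self _).trans (hC₄ _ hmem))
    (by positivity) (by positivity)
  gcongr

theorem contDiffAt_collapse {S : Finset ℂ} {ε : ℝ} {z : ℂ}
    (h : (kleinCollapse S ε (klein z)).re ^ 2 < (kleinCollapse S ε (klein z)).im) :
    ContDiffAt ℝ ∞ (collapse S ε) z :=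
  (contDiffAt_kleinInv h).comp z
    ((contDiff_kleinCollapse S ε).contDiffAt.comp z contDiff_klein.contDiffAt)

/-! ### The area of an immersed polygon -/

theorem hypDensity_comp {E g : ℂ → ℂ} {z : ℂ} (hE : DifferentiableAt ℝ E (g z))
    (hg : DifferentiableAt ℝ g z) :
    hypDensity (fun z => E (g z)) z =
      (fderiv ℝ E (g z)).det / (E (g z)).im ^ 2 * (fderiv ℝ g z).det := by
  have h : fderiv ℝ (fun z => E (g z)) z = (fderiv ℝ E (g z)).comp (fderiv ℝ g z) :=
    (hE.hasFDerivAt.comp z hg.hasFDerivAt).fderiv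
  have hdet : ((fderiv ℝ E (g z)).comp (fderiv ℝ g z)).det =
      (fderiv ℝ E (g z)).det * (fderiv ℝ g z).det := by
    simp only [ContinuousLinearMap.det, ContinuousLinearMap.toLinearMap_comp]
    exact LinearMap.det_comp _ _
  rw [hypDensity, h, hdet]
  ring

/-- The area of a disc bounded by a closed polygon, provided that the density is integrable. -/
theorem integral_hypDensity_eq_sum_sideAngle {f : ℂ → ℂ}
    (hc : ContinuousOn f (Metric.closedBall 0 1))
    (him : ∀ z ∈ Metric.closedBall (0 : ℂ) 1, 0 < (f z).im)
    (hinj : ∀ z ∈ Metric.closedBall (0 : ℂ) 1, ∃ U ∈ 𝓝 z, InjOn f (U ∩ Metric.closedBall 0 1))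
    (hs : ContDiffOn ℝ ∞ f (Metric.ball 0 1)) {n : ℕ} {θ : ℕ → ℝ} (hmono : Monotone θ)
    (hper : θ n = θ 0 + 2 * Real.pi) (v : ℕ → ℂ) (M : ℕ → SL(2, ℝ))
    (hM : ∀ j < n, ∀ t ∈ Icc (θ j) (θ (j + 1)), (mobius (M j) (f (polarMap (1, t)))).re = 0)
    (hv : ∀ j ≤ n, f (polarMap (1, θ j)) = v j) :
    ∫ z in Metric.ball (0 : ℂ) 1, hypDensity f z =
      ∑ j ∈ Finset.range n, sideAngle (v j) (v (j + 1)) := by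
  classical
  have hint := integrableOn_hypDensity hc him hinj hs
  have hpolar : ∀ t : ℝ, polarMap (1, t) ∈ Metric.closedBall (0 : ℂ) 1 := fun t => by
    rw [mem_closedBall_zero_iff, norm_polarMap, abs_one]
  set S : Finset ℂ := (Finset.range (n + 1)).image v with hSdef
  have hvS : ∀ j ≤ n, v j ∈ S := fun j hj =>
    Finset.mem_image_of_mem v (Finset.mem_range.2 (Nat.lt_succ_iff.2 hj))
  have hS : ∀ w ∈ S, 0 < w.im := fun w hw => by
    obtain ⟨j, hj, rfl⟩ := Finset.mem_image.1 hw
    rw [← hv j (Nat.lt_succ_iff.1 (Finset.mem_range.1 hj))]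
    exact him _ (hpolar _)
  have hK : IsCompact (f '' Metric.closedBall (0 : ℂ) 1) :=
    (isCompact_closedBall 0 1).image_of_continuousOn hc
  have hKim : ∀ w ∈ f '' Metric.closedBall (0 : ℂ) 1, 0 < w.im := by
    rintro _ ⟨z, hz, rfl⟩
    exact him z hz
  obtain ⟨C, hC⟩ := exists_collapse_bound S hK hKim
  obtain ⟨m, hm⟩ := hK.exists_bound_of_continuousOn (f := fun w : ℂ => w.im)
    Complex.continuous_im.continuousOn
  have hd : ∀ z ∈ Metric.ball (0 : ℂ) 1, DifferentiableAt ℝ f z := fun z hz =>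
    (hs.contDiffAt (Metric.isOpen_ball.mem_nhds hz)).differentiableAt (by norm_num)
  have hball := Metric.ball_subset_closedBall (x := (0 : ℂ)) (ε := 1)
  have hgeo : ∀ᶠ ε in 𝓝[>] (0 : ℝ), ∀ j ∈ Finset.range n, ∀ z : ℂ, 0 < z.im →
      (mobius (M j) z).re = 0 →
      (kleinCollapse S ε (klein z)).re ^ 2 < (kleinCollapse S ε (klein z)).im →
      (mobius (M j) (collapse S ε z)).re = 0 :=
    (Finset.eventually_all _).2 fun j _ => eventually_collapse_mem_geodesic (M j)
  have hvert : ∀ᶠ ε in 𝓝[>] (0 : ℝ), ∀ w ∈ S, ∀ᶠ z in 𝓝 w, collapse S ε z = w :=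
    (Finset.eventually_all _).2 fun w hw => eventually_collapse_eq_vertex hS hw
  have hcont : ∀ ε, (∀ w ∈ f '' Metric.closedBall (0 : ℂ) 1,
      (kleinCollapse S ε (klein w)).re ^ 2 < (kleinCollapse S ε (klein w)).im) →
      ContDiffOn ℝ ∞ (fun z => collapse S ε (f z)) (Metric.ball 0 1) := fun ε hε z hz =>
    ((contDiffAt_collapse (hε _ (mem_image_of_mem f (hball hz)))).comp z
      (hs.contDiffAt (Metric.isOpen_ball.mem_nhds hz))).contDiffWithinAt
  have hmeas : ∀ᶠ ε in 𝓝[>] (0 : ℝ), AEStronglyMeasurable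
      (hypDensity fun z => collapse S ε (f z)) (volume.restrict (Metric.ball 0 1)) := by
    filter_upwards [hC] with ε hε
    refine ContinuousOn.aestronglyMeasurable (continuousOn_hypDensity Metric.isOpen_ball
      ((hcont ε fun w hw => (hε w hw).1).of_le (by norm_cast)) fun z hz => ?_)
      Metric.isOpen_ball.measurableSet
    exact kleinInv_im_pos (hε _ (mem_image_of_mem f (hball hz))).1
  have hbound : ∀ᶠ ε in 𝓝[>] (0 : ℝ), ∀ z ∈ Metric.ball (0 : ℂ) 1,
      ‖hypDensity (fun z => collapse S ε (f z)) z‖ ≤ C * m ^ 2 * |hypDensity f z| := by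
    filter_upwards [hC] with ε hε z hz
    have hfz := mem_image_of_mem f (hball hz)
    have hz0 := him z (hball hz)
    rw [hypDensity_comp ((contDiffAt_collapse (hε _ hfz).1).differentiableAt (by norm_num))
      (hd z hz), norm_mul, norm_div, Real.norm_eq_abs, Real.norm_eq_abs, Real.norm_eq_abs,
      abs_of_nonneg (sq_nonneg (collapse S ε (f z)).im)]
    have h1 : |(fderiv ℝ f z).det| = (f z).im ^ 2 * |hypDensity f z| := by
      rw [hypDensity, abs_div, abs_of_nonneg (sq_nonneg (f z).im)]
      field_simp
    have h2 : (f z).im ^ 2 ≤ m ^ 2 := by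
      refine pow_le_pow_left₀ hz0.le ((le_abs_self _).trans (hm _ hfz)) 2
    have hC0 : 0 ≤ C := le_trans (by positivity) (hε _ hfz).2
    rw [mul_assoc, h1]
    exact mul_le_mul (hε _ hfz).2 (mul_le_mul_of_nonneg_right h2 (abs_nonneg _)) (by positivity) hC0
  have heq : ∀ᶠ ε in 𝓝[>] (0 : ℝ), ∫ z in Metric.ball (0 : ℂ) 1,
      hypDensity (fun z => collapse S ε (f z)) z =
        ∑ j ∈ Finset.range n, sideAngle (v j) (v (j + 1)) := by
    -- The collapsed disc is in general neither immersed nor locally injective, so its integrability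
    -- comes from the domination by the density of `f`.
    filter_upwards [hC, hgeo, hvert, hmeas, hbound] with ε hε hg hve hme hbo
    have hdom := fun w hw => (hε w hw).1
    refine integral_hypDensity_eq_sum (fun z hz => ?_) (fun z hz => ?_) (hcont ε hdom) ?_
      hmono hper v M (fun j hj t ht => ?_) fun j hj => ?_
    · exact (contDiffAt_collapse (hdom _ (mem_image_of_mem f hz))).continuousAt.comp_continuousWithinAt
        (hc z hz)
    · exact kleinInv_im_pos (hdom _ (mem_image_of_mem f hz))
    · refine Integrable.mono' (hint.abs.const_mul (C * m ^ 2)) hme ?_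
      exact (ae_restrict_mem Metric.isOpen_ball.measurableSet).mono fun z hz => hbo z hz
    · exact hg j (Finset.mem_range.2 hj) _ (him _ (hpolar t)) (hM j hj t ht)
        (hdom _ (mem_image_of_mem f (hpolar t)))
    · have h1 : ContinuousWithinAt (fun r : ℝ => f (polarMap (r, θ j))) (Icc 0 1) 1 := by
        refine ContinuousWithinAt.comp (t := Metric.closedBall 0 1)
          (f := fun r : ℝ => polarMap (r, θ j)) (hc _ (hpolar _)) ?_ fun r hr => ?_
        · exact ((contDiff_polarMap (n := 0)).continuous.comp
            (continuous_id.prodMk continuous_const)).continuousWithinAt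
        · rw [mem_closedBall_zero_iff, norm_polarMap, abs_of_nonneg hr.1]
          exact hr.2
      have h2 : Tendsto (fun r : ℝ => f (polarMap (r, θ j))) (𝓝[<] 1) (𝓝 (v j)) := by
        rw [← hv j hj]
        refine h1.mono_left (nhdsWithin_le_of_mem ?_)
        filter_upwards [Ioo_mem_nhdsLT zero_lt_one] with r hr using ⟨hr.1.le, hr.2.le⟩
      exact h2.eventually (hve _ (hvS j hj))
  have hlim : Tendsto (fun ε : ℝ => ∫ z in Metric.ball (0 : ℂ) 1,
      hypDensity (fun z => collapse S ε (f z)) z) (𝓝[>] 0)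
      (𝓝 (∫ z in Metric.ball (0 : ℂ) 1, hypDensity f z)) := by
    refine tendsto_integral_filter_of_dominated_convergence
      (fun z => C * m ^ 2 * |hypDensity f z|) hmeas (hbound.mono fun ε hε =>
        (ae_restrict_mem Metric.isOpen_ball.measurableSet).mono fun z hz => hε z hz)
      (hint.abs.const_mul _) ?_
    -- Off the finitely many preimages of vertices, the collapse is the identity near `f z` once `ε`
    -- is small, so the densities are eventually equal and not just convergent.
    have hfin : (Metric.closedBall (0 : ℂ) 1 ∩ f ⁻¹' S).Finite := by
      have : Metric.closedBall (0 : ℂ) 1 ∩ f ⁻¹' S =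
          ⋃ w ∈ S, Metric.closedBall (0 : ℂ) 1 ∩ f ⁻¹' {w} := by
        ext z
        simp
      rw [this]
      exact S.finite_toSet.biUnion fun w _ =>
        finite_fiber_of_locally_injective (isCompact_closedBall 0 1) hinj w
    have hnull : ∀ᵐ z ∂(volume.restrict (Metric.ball (0 : ℂ) 1)),
        z ∉ Metric.closedBall (0 : ℂ) 1 ∩ f ⁻¹' S :=
      measure_eq_zero_iff_ae_notMem.1 (hfin.measure_zero _)
    filter_upwards [hnull, ae_restrict_mem Metric.isOpen_ball.measurableSet] with z hz hzb
    have hfz : f z ∉ S := fun h => hz ⟨hball hzb, h⟩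
    refine (tendsto_congr' ?_).2 tendsto_const_nhds
    filter_upwards [eventually_collapse_eq_self hS (him z (hball hzb)) hfz] with ε hε
    have h1 : (fun z => collapse S ε (f z)) =ᶠ[𝓝 z] f :=
      (hd z hzb).continuousAt.eventually hε
    rw [hypDensity, hypDensity, h1.fderiv_eq, h1.eq_of_nhds]
  exact tendsto_nhds_unique hlim ((tendsto_congr' heq).2 tendsto_const_nhds)

/-! ### The area of an immersed polygon from its boundary parametrization -/

theorem geodesicVec_base (h : SL(2, ℝ)) (s : ℝ) :
    (geodesicVec h s).base = h • (verticalVec s).base := rfl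

theorem mobius_inv_geodesicVec (h : SL(2, ℝ)) (s : ℝ) :
    mobius h⁻¹ ((geodesicVec h s).base : ℂ) = Real.exp s * Complex.I := by
  rw [geodesicVec_base, ← coe_smul_eq_mobius, inv_smul_smul]
  rfl

theorem mobius_inv_geodesicVec_re (h : SL(2, ℝ)) (s : ℝ) :
    (mobius h⁻¹ ((geodesicVec h s).base : ℂ)).re = 0 := by
  rw [mobius_inv_geodesicVec]
  simp

theorem exists_eq_of_continuous_of_map_add_one {φ : ℝ → ℝ} {n : ℕ} [NeZero n] (hφ : Continuous φ)
    (hadd : ∀ t, φ (t + 1) = φ t + n) (y : ℝ) : ∃ t, φ t = y := by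
  have hn : (1 : ℝ) ≤ n := by exact_mod_cast NeZero.one_le
  have h1 : ∀ m : ℕ, φ m = φ 0 + m * n := fun m => by
    induction m with
    | zero => simp
    | succ k ih => push_cast; rw [hadd, ih]; ring
  have h2 : ∀ m : ℕ, φ (-m) = φ 0 - m * n := fun m => by
    induction m with
    | zero => simp
    | succ k ih =>
      have := hadd (-(k + 1 : ℕ))
      push_cast at this ⊢
      rw [show (-((k : ℝ) + 1) + 1) = -k by ring, ih] at this
      linarith
  obtain ⟨m, hm⟩ := exists_nat_ge |y - φ 0|
  have hm0 : (0 : ℝ) ≤ m := Nat.cast_nonneg m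
  rw [abs_le] at hm
  exact mem_range_of_exists_le_of_exists_ge hφ ⟨-m, by rw [h2]; nlinarith⟩
    ⟨m, by rw [h1]; nlinarith⟩

/-- The area of an immersed disc bounded by a geodesic polygon. -/
theorem IsImmersedDisc.signedArea_eq_sum {n : ℕ} [NeZero n] {v : Fin n → UpperHalfPlane}
    {f : ℂ → UpperHalfPlane} (hf : IsImmersedDisc v f) :
    signedArea f = ∑ k : Fin n, sideAngle (v k) (v (k + 1)) := by
  obtain ⟨P, φ, ⟨hPper, hP⟩, hφ, hφm, hadd, hfP⟩ := hf.boundary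
  choose h ℓ hgeo hseg using hP
  beta_reduce at hseg
  -- `t j` is the time at which the reparametrized boundary reaches the vertex of index `j`; the
  -- angles on the circle are `2π * t j`.
  choose t ht using fun j : ℕ => exists_eq_of_continuous_of_map_add_one hφ hadd (j : ℝ)
  have htm : Monotone t := fun i j hij => by
    rw [← hφm.le_iff_le, ht, ht]
    exact_mod_cast hij
  have htn : t n = t 0 + 1 := hφm.injective (by rw [ht, hadd, ht]; simp)
  have hpol : ∀ s : ℝ, f (polarMap (1, 2 * Real.pi * s)) = P (φ s) := fun s => by
    rw [← hfP]
    simp [polarMap]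
  have hvert : ∀ k : Fin n, P ((k : ℕ) : ℝ) = v k := fun k => by
    have := hseg k 0 ⟨le_rfl, zero_le_one⟩
    rw [add_zero, zero_mul] at this
    rw [this, (hgeo k).2.1]
  have hvert1 : ∀ k : Fin n, P (((k : ℕ) : ℝ) + 1) = v (k + 1) := fun k => by
    have := hseg k 1 ⟨zero_le_one, le_rfl⟩
    rw [one_mul] at this
    rw [this, (hgeo k).2.2]
  have key := integral_hypDensity_eq_sum_sideAngle (f := fun z => (f z : ℂ)) (n := n)
    (θ := fun j => 2 * Real.pi * t j)
    (UpperHalfPlane.continuous_coe.comp_continuousOn hf.continuousOn) (fun z _ => (f z).im_pos)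
    (fun z hz => by
      obtain ⟨U, hU, hinj⟩ := hf.locally_injective z hz
      exact ⟨U, hU, UpperHalfPlane.coe_injective.comp_injOn hinj⟩)
    hf.smooth (fun i j hij => mul_le_mul_of_nonneg_left (htm hij) (by positivity))
    (by simp only [htn]; ring) (fun j => (P j : ℂ))
    -- The inverse of the isometry that parametrizes a side takes this side back to the imaginary
    -- axis; the value for `j ≥ n` plays no role.
    (fun j => if hj : j < n then (h ⟨j, hj⟩)⁻¹ else 1)
    (fun j hj s hs => by
      have hpos : (0 : ℝ) < 2 * Real.pi := by positivity
      have hs1 : t j ≤ s / (2 * Real.pi) := by rw [le_div_iff₀ hpos]; linarith [hs.1]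
      have hs2 : s / (2 * Real.pi) ≤ t (j + 1) := by rw [div_le_iff₀ hpos]; linarith [hs.2]
      have e : s = 2 * Real.pi * (s / (2 * Real.pi)) := by field_simp
      have u1 := hφm.monotone hs1
      have u2 := hφm.monotone hs2
      rw [ht] at u1 u2
      push_cast at u2
      have hp := hseg ⟨j, hj⟩ (φ (s / (2 * Real.pi)) - j) ⟨by linarith, by linarith⟩
      simp only [add_sub_cancel] at hp
      simp only [dif_pos hj]
      rw [e, hpol, hp]
      exact mobius_inv_geodesicVec_re _ _)
    (fun j _ => by simp only [hpol, ht])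
  have hfin : ∑ j ∈ Finset.range n, sideAngle (P (j : ℕ)) (P ((j + 1 : ℕ) : ℝ)) =
      ∑ k : Fin n, sideAngle (v k) (v (k + 1)) := by
    rw [Finset.sum_range]
    refine Finset.sum_congr rfl fun k _ => ?_
    push_cast
    rw [hvert, hvert1]
  rw [← hfin, ← key]
  rfl

theorem IsImmersedDisc.integrableOn_areaDensity {n : ℕ} [NeZero n] {v : Fin n → UpperHalfPlane}
    {f : ℂ → UpperHalfPlane} (hf : IsImmersedDisc v f) :
    IntegrableOn (areaDensity f) (Metric.ball 0 1) :=
  integrableOn_hypDensity (f := fun z => (f z : ℂ))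
    (UpperHalfPlane.continuous_coe.comp_continuousOn hf.continuousOn) (fun z _ => (f z).im_pos)
    (fun z hz => by
      obtain ⟨U, hU, hinj⟩ := hf.locally_injective z hz
      exact ⟨U, hU, UpperHalfPlane.coe_injective.comp_injOn hinj⟩)
    hf.smooth

/-! ### Directions of unit tangent vectors -/

namespace UnitTangent

theorem vec_ne_zero (v : UnitTangent) : v.vec ≠ 0 := by
  rw [← norm_pos_iff, v.norm_vec]
  exact v.base.im_pos

/-- The angle from the horizontal direction to `v`. -/
noncomputable def dir (v : UnitTangent) : Real.Angle := (Complex.arg v.vec : ℝ)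

theorem ext_dir {v w : UnitTangent} (hb : v.base = w.base) (hd : v.dir = w.dir) : v = w := by
  refine UnitTangent.ext hb (Complex.ext_norm_arg ?_ (Complex.arg_coe_angle_eq_iff.1 hd))
  rw [v.norm_vec, w.norm_vec, hb]

theorem dir_rotate (θ : ℝ) (v : UnitTangent) : (v.rotate θ).dir = θ + v.dir := by
  rw [dir, dir, rotate, Complex.arg_mul_coe_angle (Complex.exp_ne_zero _) v.vec_ne_zero,
    Complex.exp_mul_I]
  have := Complex.arg_cos_add_sin_mul_I_coe_angle θ
  rw [Real.Angle.cos_coe, Real.Angle.sin_coe, Complex.ofReal_cos, Complex.ofReal_sin] at this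
  rw [this]

theorem base_smul (g : PSL(2, ℝ)) (v : UnitTangent) : (g • v).base = g • v.base := by
  induction g using QuotientGroup.induction_on with
  | H M => rfl

/-- The unit tangent vector at `p` in the horizontal direction. -/
noncomputable def horizontal (p : UpperHalfPlane) : UnitTangent :=
  ⟨p, p.im, by simp [abs_of_pos p.im_pos]⟩

theorem dir_horizontal (p : UpperHalfPlane) : (horizontal p).dir = 0 := by
  rw [dir, horizontal, Complex.arg_ofReal_of_nonneg p.im_pos.le, Real.Angle.coe_zero]

end UnitTangent

theorem Real.Angle.coe_two_mul (a : ℝ) : ((2 * a : ℝ) : Real.Angle) = (2 : ℕ) • (a : Real.Angle) := by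
  rw [two_mul, two_nsmul, Real.Angle.coe_add]

/-- The angle by which the derivative of `g` at `p` turns tangent vectors. -/
noncomputable def turn (g : PSL(2, ℝ)) (p : UpperHalfPlane) : Real.Angle :=
  (g • UnitTangent.horizontal p).dir

theorem UnitTangent.dir_smul_mk (M : SL(2, ℝ)) (v : UnitTangent) :
    ((QuotientGroup.mk M : PSL(2, ℝ)) • v).dir =
      v.dir - ((2 * Complex.arg (mobiusDen M v.base) : ℝ) : Real.Angle) := by
  have h0 := mobiusDen_ne_zero M v.base.im_pos
  have h : ((QuotientGroup.mk M : PSL(2, ℝ)) • v).vec = v.vec / mobiusDen M v.base ^ 2 := rfl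
  rw [dir, h, Complex.arg_div_coe_angle v.vec_ne_zero (pow_ne_zero 2 h0), pow_two,
    Complex.arg_mul_coe_angle h0 h0, two_mul, Real.Angle.coe_add]
  rfl

theorem turn_mk (M : SL(2, ℝ)) (p : UpperHalfPlane) :
    turn (QuotientGroup.mk M : PSL(2, ℝ)) p =
      -((2 * Complex.arg (mobiusDen M p) : ℝ) : Real.Angle) := by
  rw [turn, UnitTangent.dir_smul_mk, UnitTangent.dir_horizontal, zero_sub]
  rfl

theorem UnitTangent.dir_smul (g : PSL(2, ℝ)) (v : UnitTangent) :
    (g • v).dir = v.dir + turn g v.base := by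
  induction g using QuotientGroup.induction_on with
  | H M => rw [dir_smul_mk, turn_mk, sub_eq_add_neg]

theorem turn_mul (g h : PSL(2, ℝ)) (p : UpperHalfPlane) :
    turn (g * h) p = turn g (h • p) + turn h p := by
  rw [turn, mul_smul, UnitTangent.dir_smul, UnitTangent.base_smul, add_comm]
  rfl

theorem turn_one (p : UpperHalfPlane) : turn 1 p = 0 := by
  rw [turn, one_smul, UnitTangent.dir_horizontal]

/-- The form modulo `2π` for a single isometry, where only `turn` is available; along a path from
the identity it lifts to the real equality `sideAngle_proj_smul`. -/
theorem coe_sideAngle_smul (g : PSL(2, ℝ)) (z w : UpperHalfPlane) :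
    (sideAngle (g • z : UpperHalfPlane) (g • w : UpperHalfPlane) : Real.Angle) =
      sideAngle z w + turn g z - turn g w := by
  induction g using QuotientGroup.induction_on with
  | H M =>
    have h : ∀ z : UpperHalfPlane, (((QuotientGroup.mk M : PSL(2, ℝ)) • z : UpperHalfPlane) : ℂ) =
        mobius M z := fun z => coe_smul_eq_mobius M z
    rw [h, h, coe_sideAngle_mobius M z.im_pos w.im_pos, turn_mk, turn_mk]
    abel

theorem continuous_mobiusDen (p : ℂ) : Continuous fun M : SL(2, ℝ) => mobiusDen M p := by
  have h : ∀ i j, Continuous fun M : SL(2, ℝ) => (M i j : ℝ) := fun i j =>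
    (continuous_subtype_val (p := fun A : Matrix (Fin 2) (Fin 2) ℝ => A.det = 1)).matrix_elem i j
  exact ((Complex.continuous_ofReal.comp (h _ _)).mul continuous_const).add
    (Complex.continuous_ofReal.comp (h _ _))

theorem continuous_smul_upperHalfPlane (p : UpperHalfPlane) :
    Continuous fun g : PSL(2, ℝ) => g • p := by
  have h : ∀ i j, Continuous fun M : SL(2, ℝ) => (M i j : ℝ) := fun i j =>
    (continuous_subtype_val (p := fun A : Matrix (Fin 2) (Fin 2) ℝ => A.det = 1)).matrix_elem i j
  have h1 : Continuous fun M : SL(2, ℝ) => (QuotientGroup.mk M : PSL(2, ℝ)) • p := by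
    rw [UpperHalfPlane.isOpenEmbedding_coe.isInducing.continuous_iff]
    have : (UpperHalfPlane.coe ∘ fun M : SL(2, ℝ) => (QuotientGroup.mk M : PSL(2, ℝ)) • p) =
        fun M => mobius M p := funext fun M => coe_smul_eq_mobius M p
    rw [this]
    exact (((Complex.continuous_ofReal.comp (h _ _)).mul continuous_const).add
      (Complex.continuous_ofReal.comp (h _ _))).div (continuous_mobiusDen _)
      fun M => mobiusDen_ne_zero M p.im_pos
  exact (QuotientGroup.isQuotientMap_mk _).continuous_iff.2 h1

theorem continuous_turn (p : UpperHalfPlane) : Continuous fun g : PSL(2, ℝ) => turn g p := by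
  have h1 : Continuous fun M : SL(2, ℝ) => turn (QuotientGroup.mk M : PSL(2, ℝ)) p := by
    have h2 : Continuous fun M : SL(2, ℝ) => (Complex.arg (mobiusDen M p) : Real.Angle) :=
      continuous_iff_continuousAt.2 fun M =>
        (Complex.continuousAt_arg_coe_angle (mobiusDen_ne_zero M p.im_pos)).comp
          (f := fun M : SL(2, ℝ) => mobiusDen M p) (continuous_mobiusDen _).continuousAt
    simp only [turn_mk, Real.Angle.coe_two_mul, two_nsmul]
    exact (h2.add h2).neg
  exact (QuotientGroup.isQuotientMap_mk _).continuous_iff.2 h1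

/-! ### The turning number of an element of the universal covering group -/

theorem Real.Angle.isCoveringMap_coe : IsCoveringMap ((↑) : ℝ → Real.Angle) :=
  AddCircle.isCoveringMap_coe (2 * Real.pi)

/-- The rotation of the derivative at `p` along a path in `PSL(2, ℝ)`. -/
noncomputable def turnPath (p : UpperHalfPlane) (γ : C(I, PSL(2, ℝ))) : C(I, Real.Angle) :=
  (⟨fun g => turn g p, continuous_turn p⟩ : C(PSL(2, ℝ), Real.Angle)).comp γ

theorem turnPath_zero (p : UpperHalfPlane) (γ : BasedPath PSL(2, ℝ)) :
    turnPath p γ 0 = ((0 : ℝ) : Real.Angle) := by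
  have h : (γ : C(I, PSL(2, ℝ))) 0 = 1 := γ.2
  show turn ((γ : C(I, PSL(2, ℝ))) 0) p = _
  rw [h, turn_one, Real.Angle.coe_zero]

/-- The total angle by which a path of isometries in the class `x` turns tangent vectors at `p`. -/
noncomputable def turning (x : UnivCover PSL(2, ℝ)) (p : UpperHalfPlane) : ℝ :=
  Con.liftOn x (fun γ => Real.Angle.isCoveringMap_coe.liftPath (turnPath p γ) 0
    (turnPath_zero p γ) 1) fun γ δ h => by
      have h' : ContinuousMap.HomotopicRel (γ : C(I, PSL(2, ℝ))) (δ : C(I, PSL(2, ℝ))) {0, 1} := h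
      exact Real.Angle.isCoveringMap_coe.liftPath_apply_one_eq_of_homotopicRel
        (h'.comp_continuousMap _) 0 (turnPath_zero p γ) (turnPath_zero p δ)

/-- Uniqueness of lifts through the covering of the circle of angles: any explicit continuous real
function with the right start and the right classes computes `turning`. -/
theorem turning_mk_eq {γ : BasedPath PSL(2, ℝ)} {p : UpperHalfPlane} {θ : I → ℝ}
    (hθ : Continuous θ) (h0 : θ 0 = 0)
    (h : ∀ t, (θ t : Real.Angle) = turn ((γ : C(I, PSL(2, ℝ))) t) p) :
    turning (γ : UnivCover PSL(2, ℝ)) p = θ 1 := by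
  have := (Real.Angle.isCoveringMap_coe.eq_liftPath_iff (γ := turnPath p γ) (e := 0)
    (γ_0 := turnPath_zero p γ) (Γ := θ)).2 ⟨hθ, funext h, h0⟩
  rw [this]
  rfl

theorem exists_turning_lift (γ : BasedPath PSL(2, ℝ)) (p : UpperHalfPlane) : ∃ θ : I → ℝ,
    Continuous θ ∧ θ 0 = 0 ∧ (∀ t, (θ t : Real.Angle) = turn ((γ : C(I, PSL(2, ℝ))) t) p) ∧
      turning (γ : UnivCover PSL(2, ℝ)) p = θ 1 := by
  set θ := Real.Angle.isCoveringMap_coe.liftPath (turnPath p γ) 0 (turnPath_zero p γ) with hθ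
  exact ⟨θ, θ.continuous, Real.Angle.isCoveringMap_coe.liftPath_zero _ _ _,
    fun t => congrFun (Real.Angle.isCoveringMap_coe.liftPath_lifts _ _ _) t, rfl⟩

theorem continuous_sideAngle_comp {X : Type*} [TopologicalSpace X] {z w : X → UpperHalfPlane}
    (hz : Continuous z) (hw : Continuous w) : Continuous fun t => sideAngle (z t) (w t) :=
  continuous_iff_continuousAt.2 fun t =>
    ContinuousAt.comp (f := fun t => ((z t : ℂ), (w t : ℂ)))
      (continuousAt_sideAngle (z t).im_pos (w t).im_pos)
      ((UpperHalfPlane.continuous_coe.comp hz).prodMk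
        (UpperHalfPlane.continuous_coe.comp hw)).continuousAt

theorem continuous_path_smul (γ : BasedPath PSL(2, ℝ)) (p : UpperHalfPlane) :
    Continuous fun t => (γ : C(I, PSL(2, ℝ))) t • p :=
  (continuous_smul_upperHalfPlane p).comp (γ : C(I, PSL(2, ℝ))).continuous

theorem BasedPath.apply_zero (γ : BasedPath PSL(2, ℝ)) : (γ : C(I, PSL(2, ℝ))) 0 = 1 := γ.2

/-- The chain rule for `turn`, lifted to real numbers. Along the product path the first factor acts
at the moving point `δ t • p`, whereas its own lift is taken at the fixed endpoint `q`; a difference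
of `sideAngle`s compensates. -/
theorem turning_mul (x y : UnivCover PSL(2, ℝ)) (p : UpperHalfPlane) :
    turning (x * y) p = turning x (UnivCover.proj y • p) + turning y p := by
  induction x using Con.induction_on with | _ γ
  induction y using Con.induction_on with | _ δ
  set q : UpperHalfPlane := (δ : C(I, PSL(2, ℝ))) 1 • p with hq
  have hproj : UnivCover.proj (δ : UnivCover PSL(2, ℝ)) • p = q := rfl
  obtain ⟨θ₁, h1c, h10, h1, h1'⟩ := exists_turning_lift γ q
  obtain ⟨θ₂, h2c, h20, h2, h2'⟩ := exists_turning_lift δ p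
  have hmul : ∀ t, ((γ * δ : BasedPath PSL(2, ℝ)) : C(I, PSL(2, ℝ))) t =
      (γ : C(I, PSL(2, ℝ))) t * (δ : C(I, PSL(2, ℝ))) t := fun t => rfl
  have key := turning_mk_eq (γ := γ * δ) (p := p)
    -- The correction is the change of `sideAngle` under `γ t`. At `t = 0` its two terms cancel
    -- since `γ 0 = 1`; at `t = 1` both vanish since `δ 1 • p = q`.
    (θ := fun t => θ₂ t + θ₁ t +
      sideAngle (((γ * δ : BasedPath PSL(2, ℝ)) : C(I, PSL(2, ℝ))) t • p : UpperHalfPlane)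
        ((γ : C(I, PSL(2, ℝ))) t • q : UpperHalfPlane) -
      sideAngle ((δ : C(I, PSL(2, ℝ))) t • p : UpperHalfPlane) q)
    (((h2c.add h1c).add (continuous_sideAngle_comp (continuous_path_smul _ p)
      (continuous_path_smul γ q))).sub
      (continuous_sideAngle_comp (continuous_path_smul δ p) continuous_const))
    (by simp only [BasedPath.apply_zero, one_smul, h10, h20]; ring)
    (fun t => by
      rw [Real.Angle.coe_sub, Real.Angle.coe_add, Real.Angle.coe_add, h1, h2, hmul, mul_smul,
        coe_sideAngle_smul, turn_mul]
      abel)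
  rw [hproj, h1', h2', ← Con.coe_mul, key, hmul, mul_smul, ← hq,
    sideAngle_self (UpperHalfPlane.im_pos _), sideAngle_self (UpperHalfPlane.im_pos _)]
  ring

theorem turning_one (p : UpperHalfPlane) : turning 1 p = 0 := by
  have := turning_mul 1 1 p
  rw [mul_one, map_one, one_smul] at this
  linarith

theorem turning_inv (x : UnivCover PSL(2, ℝ)) (p : UpperHalfPlane) :
    turning x⁻¹ p = -turning x ((UnivCover.proj x)⁻¹ • p) := by
  have := turning_mul x x⁻¹ p
  rw [mul_inv_cancel, turning_one, map_inv] at this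
  linarith

/-- Both sides vary continuously along a path from the identity, agree at its start, and agree
modulo `2π` throughout. -/
theorem sideAngle_proj_smul (x : UnivCover PSL(2, ℝ)) (p q : UpperHalfPlane) :
    sideAngle (UnivCover.proj x • p : UpperHalfPlane) (UnivCover.proj x • q : UpperHalfPlane) =
      sideAngle p q + turning x p - turning x q := by
  induction x using Con.induction_on with | _ γ
  obtain ⟨θ₁, h1c, h10, h1, h1'⟩ := exists_turning_lift γ p
  obtain ⟨θ₂, h2c, h20, h2, h2'⟩ := exists_turning_lift γ q
  have key := (isPreconnected_univ (α := I)).eq_zero_of_coe_angle_eq_zero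
    (f := fun t => sideAngle ((γ : C(I, PSL(2, ℝ))) t • p : UpperHalfPlane)
      ((γ : C(I, PSL(2, ℝ))) t • q : UpperHalfPlane) - (sideAngle p q + θ₁ t - θ₂ t))
    ((continuous_sideAngle_comp (continuous_path_smul γ p) (continuous_path_smul γ q)).sub
      ((continuous_const.add h1c).sub h2c)).continuousOn
    (fun t _ => by
      rw [Real.Angle.coe_sub, Real.Angle.coe_sub, Real.Angle.coe_add, h1, h2,
        coe_sideAngle_smul, sub_self])
    (mem_univ 0) (by simp only [BasedPath.apply_zero, one_smul, h10, h20]; ring) (mem_univ 1)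
  rw [h1', h2']
  exact sub_eq_zero.1 key

/-- The combinatorial heart: two pairs of sides of the pentagon are identified by `β` and `α` with
reversed direction, so in each pair the `sideAngle`s cancel up to two values of `turning`. -/
theorem turning_commutator (a b : UnivCover PSL(2, ℝ)) (α β : PSL(2, ℝ)) (p : UpperHalfPlane)
    (ha : UnivCover.proj a = α) (hb : UnivCover.proj b = β) :
    turning ⁅a⁻¹, b⁻¹⁆ p + sideAngle p ((α⁻¹ * β⁻¹ * α * β) • p : UpperHalfPlane) =
      ∑ k : Fin 5, sideAngle (pent α β p k) (pent α β p (k + 1)) := by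
  -- `β` takes `p → β⁻¹αβp`, the fifth side reversed, to the third side; `α` takes `βp → α⁻¹β⁻¹αβp`,
  -- the second side reversed, to the fourth.
  have e1 := sideAngle_proj_smul b p ((β⁻¹ * α * β) • p)
  have e2 := sideAngle_proj_smul a (β • p) ((α⁻¹ * β⁻¹ * α * β) • p)
  rw [hb, smul_smul, show β * (β⁻¹ * α * β) = α * β by group] at e1
  rw [ha, smul_smul, smul_smul, show α * (α⁻¹ * β⁻¹ * α * β) = β⁻¹ * α * β by group] at e2
  have e3 : turning ⁅a⁻¹, b⁻¹⁆ p = turning b p + turning a (β • p) -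
      turning b ((β⁻¹ * α * β) • p) - turning a ((α⁻¹ * β⁻¹ * α * β) • p) := by
    rw [commutatorElement_def, inv_inv, inv_inv, turning_mul, turning_mul, turning_mul, turning_inv,
      turning_inv, ha, hb]
    simp only [map_inv, hb, smul_smul, mul_assoc]
    ring
  have s1 := sideAngle_swap (z := p) (w := ((β⁻¹ * α * β) • p : UpperHalfPlane))
    (UpperHalfPlane.im_pos _) (UpperHalfPlane.im_pos _)
  have s2 := sideAngle_swap (z := (β • p : UpperHalfPlane))
    (w := ((α⁻¹ * β⁻¹ * α * β) • p : UpperHalfPlane)) (UpperHalfPlane.im_pos _)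
    (UpperHalfPlane.im_pos _)
  have hsum : ∑ k : Fin 5, sideAngle (pent α β p k) (pent α β p (k + 1)) =
      sideAngle p ((α⁻¹ * β⁻¹ * α * β) • p : UpperHalfPlane) +
      sideAngle ((α⁻¹ * β⁻¹ * α * β) • p : UpperHalfPlane) (β • p : UpperHalfPlane) +
      sideAngle (β • p : UpperHalfPlane) ((α * β) • p : UpperHalfPlane) +
      sideAngle ((α * β) • p : UpperHalfPlane) ((β⁻¹ * α * β) • p : UpperHalfPlane) +
      sideAngle ((β⁻¹ * α * β) • p : UpperHalfPlane) p := by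
    rw [Fin.sum_univ_five]
    rfl
  rw [hsum, e3]
  linarith

/-! ### The direction along a geodesic -/

theorem dir_verticalVec (s : ℝ) : (verticalVec s).dir = ((Real.pi / 2 : ℝ) : Real.Angle) := by
  rw [UnitTangent.dir, verticalVec, Complex.arg_real_mul _ (Real.exp_pos s), Complex.arg_I]

theorem geodesicVec_eq_mk_smul (h : SL(2, ℝ)) (s : ℝ) :
    geodesicVec h s = (QuotientGroup.mk h : PSL(2, ℝ)) • verticalVec s := rfl

/-- On the vertical geodesic the direction is constant and `sideAngle` is zero. Under an isometry
the direction changes by `turn`, and so does `sideAngle` with the opposite sign, which gives the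
general case. -/
theorem dir_geodesicVec (h : SL(2, ℝ)) (s : ℝ) :
    (geodesicVec h s).dir = (geodesicVec h 0).dir -
      sideAngle (geodesicVec h 0).base (geodesicVec h s).base := by
  have h0 : sideAngle (verticalVec 0).base (verticalVec s).base = 0 :=
    sideAngle_of_re_eq (UpperHalfPlane.im_pos _) (UpperHalfPlane.im_pos _) (by simp [verticalVec])
  rw [geodesicVec_eq_mk_smul, geodesicVec_eq_mk_smul, UnitTangent.base_smul, UnitTangent.base_smul,
    coe_sideAngle_smul, h0, UnitTangent.dir_smul, UnitTangent.dir_smul, dir_verticalVec,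
    dir_verticalVec, Real.Angle.coe_zero]
  abel

theorem continuous_geodesicVec_base (h : SL(2, ℝ)) :
    Continuous fun s => (geodesicVec h s).base := by
  have h1 : Continuous fun s => (verticalVec s).base := by
    rw [UpperHalfPlane.isOpenEmbedding_coe.isInducing.continuous_iff]
    exact (Complex.continuous_ofReal.comp Real.continuous_exp).mul continuous_const
  exact (continuous_const_smul h).comp h1

/-! ### Isometries with prescribed value and turning angle at a point -/

/-- The upper triangular matrix with positive diagonal that maps `i` to `z`. -/
noncomputable def upperTo (z : UpperHalfPlane) : SL(2, ℝ) :=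
  ⟨!![√z.im, z.re / √z.im; 0, (√z.im)⁻¹], by
    have := (Real.sqrt_pos.2 z.im_pos).ne'
    simp [this]⟩

/-- The rotation about `i` by the angle `θ`. -/
noncomputable def rotationI (θ : ℝ) : SL(2, ℝ) :=
  ⟨!![Real.cos (θ / 2), Real.sin (θ / 2); -Real.sin (θ / 2), Real.cos (θ / 2)], by
    rw [Matrix.det_fin_two_of]
    linarith [Real.sin_sq_add_cos_sq (θ / 2)]⟩

theorem upperTo_smul_I (z : UpperHalfPlane) :
    (QuotientGroup.mk (upperTo z) : PSL(2, ℝ)) • UpperHalfPlane.I = z := by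
  apply UpperHalfPlane.ext
  refine (coe_smul_eq_mobius _ _).trans ?_
  have h : (√z.im : ℂ) ≠ 0 := by exact_mod_cast (Real.sqrt_pos.2 z.im_pos).ne'
  have h2 : (√z.im : ℂ) ^ 2 = z.im := by exact_mod_cast Real.sq_sqrt z.im_pos.le
  simp only [mobius, mobiusDen, upperTo, UpperHalfPlane.coe_I]
  simp
  field_simp
  rw [h2]
  apply Complex.ext <;> simp

theorem turn_upperTo (z : UpperHalfPlane) :
    turn (QuotientGroup.mk (upperTo z)) UpperHalfPlane.I = 0 := by
  have h : mobiusDen (upperTo z) UpperHalfPlane.I = ((√z.im)⁻¹ : ℝ) := by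
    simp [mobiusDen, upperTo]
  rw [turn_mk, h, Complex.arg_ofReal_of_nonneg (by positivity)]
  simp

theorem rotationI_smul_I (θ : ℝ) :
    (QuotientGroup.mk (rotationI θ) : PSL(2, ℝ)) • UpperHalfPlane.I = UpperHalfPlane.I := by
  apply UpperHalfPlane.ext
  refine (coe_smul_eq_mobius _ _).trans ?_
  rw [mobius, div_eq_iff (mobiusDen_ne_zero _ (UpperHalfPlane.im_pos _))]
  simp only [mobiusDen, rotationI, UpperHalfPlane.coe_I]
  apply Complex.ext <;> simp [add_comm]

/-- The denominator at `i` is `exp (-iθ/2)` and the derivative is its inverse square, which explains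
the half angles in `rotationI`. -/
theorem turn_rotationI (θ : ℝ) :
    turn (QuotientGroup.mk (rotationI θ)) UpperHalfPlane.I = θ := by
  have h : mobiusDen (rotationI θ) UpperHalfPlane.I =
      Complex.cos ((-(θ / 2) : ℝ) : ℂ) + Complex.sin ((-(θ / 2) : ℝ) : ℂ) * Complex.I := by
    simp [mobiusDen, rotationI]
    ring
  have h2 := Complex.arg_cos_add_sin_mul_I_coe_angle ((-(θ / 2) : ℝ) : Real.Angle)
  rw [Real.Angle.cos_coe, Real.Angle.sin_coe, Complex.ofReal_cos, Complex.ofReal_sin] at h2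
  rw [turn_mk, h, Real.Angle.coe_two_mul, h2, ← Real.Angle.coe_two_mul, ← Real.Angle.coe_neg]
  congr 1
  ring

/-- The isometry that maps `p` to `z` and turns tangent vectors at `p` by the angle `θ`. -/
noncomputable def isometryTo (p z : UpperHalfPlane) (θ : ℝ) : PSL(2, ℝ) :=
  QuotientGroup.mk (upperTo z) * QuotientGroup.mk (rotationI θ) *
    (QuotientGroup.mk (upperTo p) : PSL(2, ℝ))⁻¹

theorem upperTo_inv_smul (p : UpperHalfPlane) :
    (QuotientGroup.mk (upperTo p) : PSL(2, ℝ))⁻¹ • p = UpperHalfPlane.I := by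
  rw [inv_smul_eq_iff, upperTo_smul_I]

theorem isometryTo_smul (p z : UpperHalfPlane) (θ : ℝ) : isometryTo p z θ • p = z := by
  rw [isometryTo, mul_smul, upperTo_inv_smul, mul_smul, rotationI_smul_I, upperTo_smul_I]

theorem turn_isometryTo (p z : UpperHalfPlane) (θ : ℝ) : turn (isometryTo p z θ) p = θ := by
  have h := turn_mul (QuotientGroup.mk (upperTo p)) (QuotientGroup.mk (upperTo p))⁻¹ p
  rw [mul_inv_cancel, turn_one, upperTo_inv_smul, turn_upperTo, zero_add] at h
  rw [isometryTo, turn_mul, ← h, upperTo_inv_smul, turn_mul, rotationI_smul_I, turn_upperTo,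
    turn_rotationI, zero_add, add_zero]

/-- Together with `isometryTo_eq` this gives coordinates on `PSL(2, ℝ)` by the image of `p` and the
angle of rotation there. Paths and homotopies of isometries can then be built in the contractible
space of pairs of a point and a real angle. -/
theorem continuous_isometryTo (p : UpperHalfPlane) :
    Continuous fun q : UpperHalfPlane × ℝ => isometryTo p q.1 q.2 := by
  have h1 : Continuous upperTo := by
    refine Continuous.subtype_mk (continuous_matrix fun i j => ?_) _
    have him := UpperHalfPlane.continuous_im
    have hre := UpperHalfPlane.continuous_re
    have h0 : ∀ z : UpperHalfPlane, √z.im ≠ 0 := fun z => (Real.sqrt_pos.2 z.im_pos).ne'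
    fin_cases i <;> fin_cases j <;> simp
    · fun_prop
    · exact hre.div (by fun_prop) h0
    · exact continuous_const
    · exact Continuous.inv₀ (by fun_prop) h0
  have h2 : Continuous rotationI := by
    refine Continuous.subtype_mk (continuous_matrix fun i j => ?_) _
    fin_cases i <;> fin_cases j <;> simp <;> fun_prop
  have hmk : Continuous fun M : SL(2, ℝ) => (QuotientGroup.mk M : PSL(2, ℝ)) :=
    QuotientGroup.continuous_mk
  exact ((hmk.comp (h1.comp continuous_fst)).mul
    (hmk.comp (h2.comp continuous_snd))).mul continuous_const

theorem Continuous.isometryTo {X : Type*} [TopologicalSpace X] {z : X → UpperHalfPlane}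
    {θ : X → ℝ} (hz : Continuous z) (hθ : Continuous θ) (p : UpperHalfPlane) :
    Continuous fun t => isometryTo p (z t) (θ t) :=
  Continuous.comp (f := fun t => (z t, θ t)) (continuous_isometryTo p) (hz.prodMk hθ)

/-- The action on unit tangent vectors is free: zero turning makes `c p + d` real, so `c = 0`, and a
real affine map with unit determinant fixing `p` is given by a central matrix. -/
theorem eq_one_of_smul_eq_of_turn_eq_zero {g : PSL(2, ℝ)} {p : UpperHalfPlane} (h : g • p = p)
    (ht : turn g p = 0) : g = 1 := by
  induction g using QuotientGroup.induction_on with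
  | H M =>
    have hden := mobiusDen_ne_zero M p.im_pos
    have hm : mobius M p = p := (coe_smul_eq_mobius M p).symm.trans (congrArg UpperHalfPlane.coe h)
    rw [turn_mk, neg_eq_zero, Real.Angle.coe_two_mul, Real.Angle.two_nsmul_eq_zero_iff] at ht
    have hsin : Real.sin (Complex.arg (mobiusDen M p)) = 0 := by
      rw [← Real.Angle.sin_coe]
      rcases ht with ht | ht <;> simp [ht]
    have hc : M 1 0 = 0 := by
      rw [Complex.sin_arg, div_eq_zero_iff, norm_eq_zero, or_iff_left hden] at hsin
      simpa [mobiusDen, p.im_ne_zero] using hsin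
    have hdet := M.det_fin_two_eq_one
    rw [mobius, div_eq_iff hden] at hm
    rw [hc, mul_zero, sub_zero] at hdet
    have him := congrArg Complex.im hm
    have hre := congrArg Complex.re hm
    simp [mobiusDen, hc] at him hre
    have had : M 0 0 = M 1 1 := by
      apply mul_right_cancel₀ p.im_ne_zero
      linarith
    have hb : M 0 1 = 0 := by
      rw [had] at hre
      linarith
    rw [QuotientGroup.eq_one_iff, Matrix.SpecialLinearGroup.mem_center_iff]
    refine ⟨M 0 0, ?_, ?_⟩
    · rw [Fintype.card_fin, pow_two]
      rwa [← had] at hdet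
    · ext i j
      fin_cases i <;> fin_cases j <;> simp [hc, hb, had]

theorem eq_of_smul_eq_of_turn_eq {g g' : PSL(2, ℝ)} {p : UpperHalfPlane} (h : g • p = g' • p)
    (ht : turn g p = turn g' p) : g = g' := by
  refine (inv_mul_eq_one.1 (eq_one_of_smul_eq_of_turn_eq_zero (p := p) ?_ ?_)).symm
  · rw [mul_smul, h, inv_smul_smul]
  · have h1 := turn_mul g'⁻¹ g' p
    rw [inv_mul_cancel, turn_one] at h1
    rw [turn_mul, ht, h, ← h1]

theorem isometryTo_eq {g : PSL(2, ℝ)} {p z : UpperHalfPlane} {θ : ℝ} (h : g • p = z)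
    (ht : turn g p = θ) : isometryTo p z θ = g :=
  eq_of_smul_eq_of_turn_eq ((isometryTo_smul p z θ).trans h.symm)
    ((turn_isometryTo p z θ).trans ht.symm)

/-- The point at the parameter `s` of the Euclidean segment from `z` to `w`. -/
noncomputable def segmentPoint (s : I) (z w : UpperHalfPlane) : UpperHalfPlane :=
  ⟨(1 - (s : ℝ) : ℝ) * z + (s : ℝ) * w, by
    rw [Complex.add_im, Complex.im_ofReal_mul, Complex.im_ofReal_mul]
    have h0 := s.2.1
    have h1 := s.2.2
    have hz := z.im_pos
    have hw := w.im_pos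
    rcases h0.eq_or_lt with h | h
    · simp [← h, hz]
    · exact add_pos_of_nonneg_of_pos (mul_nonneg (sub_nonneg.2 h1) hz.le) (mul_pos h hw)⟩

theorem segmentPoint_zero (z w : UpperHalfPlane) : segmentPoint 0 z w = z :=
  UpperHalfPlane.ext (by simp [segmentPoint])

theorem segmentPoint_one (z w : UpperHalfPlane) : segmentPoint 1 z w = w :=
  UpperHalfPlane.ext (by simp [segmentPoint])

theorem segmentPoint_self (s : I) (z : UpperHalfPlane) : segmentPoint s z z = z :=
  UpperHalfPlane.ext (by simp [segmentPoint]; ring)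

/-- Every path of isometries is homotopic, relative to its endpoints, to one along which `p`
follows a prescribed path and the turning angle grows linearly. -/
theorem exists_basedPath_isometryTo (x : UnivCover PSL(2, ℝ)) (p : UpperHalfPlane)
    {c : I → UpperHalfPlane} (hc : Continuous c) (h0 : c 0 = p)
    (h1 : c 1 = UnivCover.proj x • p) : ∃ γ : BasedPath PSL(2, ℝ),
      (γ : UnivCover PSL(2, ℝ)) = x ∧
        ∀ t, (γ : C(I, PSL(2, ℝ))) t = isometryTo p (c t) (t * turning x p) := by
  induction x using Con.induction_on with | _ δ
  obtain ⟨θ, hθ, hθ0, hθt, hθ1⟩ := exists_turning_lift δ p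
  rw [hθ1]
  have hproj : UnivCover.proj (δ : UnivCover PSL(2, ℝ)) • p = (δ : C(I, PSL(2, ℝ))) 1 • p := rfl
  rw [hproj] at h1
  have hlin : Continuous fun t : I => (t : ℝ) * θ 1 := by fun_prop
  have hcont : Continuous fun t : I => isometryTo p (c t) (t * θ 1) :=
    hc.isometryTo hlin p
  have hδt : ∀ t, isometryTo p ((δ : C(I, PSL(2, ℝ))) t • p) (θ t) = (δ : C(I, PSL(2, ℝ))) t :=
    fun t => isometryTo_eq rfl (hθt t).symm
  refine ⟨⟨⟨_, hcont⟩, ?_⟩, ?_, fun t => rfl⟩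
  · show isometryTo p (c 0) ((0 : I) * θ 1) = 1
    exact isometryTo_eq (by rw [one_smul, h0]) (by rw [turn_one]; simp)
  · refine ((Con.eq _).2 ?_).symm
    have hseg : Continuous fun q : I × I =>
        segmentPoint q.1 ((δ : C(I, PSL(2, ℝ))) q.2 • p) (c q.2) := by
      rw [UpperHalfPlane.isOpenEmbedding_coe.isInducing.continuous_iff]
      have e1 := UpperHalfPlane.continuous_coe.comp
        ((continuous_path_smul δ p).comp (continuous_snd (X := I)))
      have e2 := UpperHalfPlane.continuous_coe.comp (hc.comp (continuous_snd (X := I)))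
      exact ((Complex.continuous_ofReal.comp (by fun_prop : Continuous fun q : I × I =>
        (1 - (q.1 : ℝ) : ℝ))).mul e1).add ((Complex.continuous_ofReal.comp
          (by fun_prop : Continuous fun q : I × I => (q.1 : ℝ))).mul e2)
    -- The straight-line homotopy in the coordinates of `isometryTo`, using the Euclidean segment
    -- for the point and the real lift `θ` for the angle.
    refine ⟨⟨⟨⟨fun q => isometryTo p
      (segmentPoint q.1 ((δ : C(I, PSL(2, ℝ))) q.2 • p) (c q.2))
      ((1 - (q.1 : ℝ)) * θ q.2 + q.1 * (q.2 * θ 1)), ?_⟩, ?_, ?_⟩, ?_⟩⟩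
    · exact hseg.isometryTo (by fun_prop) p
    · intro t
      simp [segmentPoint_zero, hδt]
    · intro t
      simp [segmentPoint_one]
    -- At both endpoints the two paths of points agree, and so do the two angles, so the homotopy is
    -- stationary there.
    · rintro s t (rfl | rfl)
      · have := hδt 0
        have hδ := BasedPath.apply_zero δ
        simp_all [segmentPoint_self]
      · have := hδt 1
        rw [← h1] at this
        simp [segmentPoint_self, ← h1]
        rw [← this]
        congr 1
        ring

/-! ### The twist -/

/-- The direction of `V` is `θ` plus the direction of the geodesic, and the latter changes by minus
`sideAngle`. Removing it from `θ t - θ 0` leaves a lift of the turning of `γ` at `y`. This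
determines the twist regardless of the choice of the geodesic, of `γ`, of `V` and of the angle. -/
theorem IsTwist.eq_turning_add_sideAngle {x : UnivCover PSL(2, ℝ)} {y : UpperHalfPlane} {τ : ℝ}
    (hτ : IsTwist x y τ) :
    τ = turning x y + sideAngle y (UnivCover.proj x • y : UpperHalfPlane) := by
  obtain ⟨h, ℓ, ⟨-, h0, h1⟩, γ, rfl, V, hV, θ, hθ, rfl⟩ := hτ
  have hbase : ∀ t, (V t).base = (geodesicVec h (t * ℓ)).base := fun t => by rw [hθ]; rfl
  have hV0 : (V 0).base = y := by simp [hbase, h0]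
  have hdir : ∀ t, (V t).dir =
      θ t + ((geodesicVec h 0).dir - sideAngle y (geodesicVec h (t * ℓ)).base) := fun t => by
    rw [hθ, UnitTangent.dir_rotate, dir_geodesicVec h (t * ℓ), h0]
  have hcont : Continuous fun t : I => (geodesicVec h (t * ℓ)).base :=
    (continuous_geodesicVec_base h).comp (continuous_subtype_val.mul continuous_const)
  have key := turning_mk_eq (γ := γ) (p := y)
    (θ := fun t => θ t - θ 0 - sideAngle y (geodesicVec h (t * ℓ)).base)
    ((θ.continuous.sub continuous_const).sub (continuous_sideAngle_comp continuous_const hcont))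
    (by simp [h0, sideAngle_self y.im_pos])
    (fun t => by
      have e := hdir t
      rw [hV t, UnitTangent.dir_smul, hV0, hdir 0] at e
      simp only [Set.Icc.coe_zero, zero_mul, h0, sideAngle_self y.im_pos, Real.Angle.coe_zero,
        sub_zero] at e
      rw [Real.Angle.coe_sub, Real.Angle.coe_sub]
      rw [← add_right_inj (θ 0 + (geodesicVec h 0).dir : Real.Angle), e]
      abel)
  rw [key]
  simp [h1]

/-- Existence requires a representative of the class that moves `y` exactly along the geodesic,
which is what `exists_basedPath_isometryTo` provides; `V` is the initial velocity vector transported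
by it. -/
theorem isTwist_turning_add_sideAngle {x : UnivCover PSL(2, ℝ)} {y : UpperHalfPlane}
    {h : SL(2, ℝ)} {ℓ : ℝ} (hg : IsGeodesicFromTo h ℓ y (UnivCover.proj x • y)) :
    IsTwist x y (turning x y + sideAngle y (UnivCover.proj x • y : UpperHalfPlane)) := by
  have hcont : Continuous fun t : I => (geodesicVec h (t * ℓ)).base :=
    (continuous_geodesicVec_base h).comp (continuous_subtype_val.mul continuous_const)
  obtain ⟨γ, hγ, hγt⟩ := exists_basedPath_isometryTo x y hcont (by simp [hg.2.1])
    (by simp [hg.2.2])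
  refine ⟨h, ℓ, hg, γ, hγ, fun t => (γ : C(I, PSL(2, ℝ))) t • geodesicVec h 0, fun t => ?_,
    ⟨fun t => t * turning x y + sideAngle y (geodesicVec h (t * ℓ)).base,
      (continuous_subtype_val.mul continuous_const).add
        (continuous_sideAngle_comp continuous_const hcont)⟩, fun t => ?_, ?_⟩
  · simp only [BasedPath.apply_zero, one_smul]
  · refine UnitTangent.ext_dir ?_ ?_
    · rw [UnitTangent.base_smul, hg.2.1, hγt, isometryTo_smul]
      rfl
    · rw [UnitTangent.dir_smul, hg.2.1, hγt, turn_isometryTo, UnitTangent.dir_rotate,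
        dir_geodesicVec h (t * ℓ), hg.2.1]
      simp only [ContinuousMap.coe_mk, Real.Angle.coe_add]
      abel
  · simp [hg.2.1, hg.2.2, sideAngle_self y.im_pos]

theorem mainTheorem3 (α β : PSL(2, ℝ)) (p : UpperHalfPlane)
    (a b : UnivCover PSL(2, ℝ)) (ha : UnivCover.proj a = α) (hb : UnivCover.proj b = β)
    (hnd : Nondegenerate (pent α β p))
    (f : ℂ → UpperHalfPlane) (hf : IsImmersedDisc (pent α β p) f) :
    MeasureTheory.IntegrableOn (areaDensity f) (Metric.ball 0 1) ∧
      ∀ τ : ℝ, IsTwist ⁅a⁻¹, b⁻¹⁆ p τ ↔ τ = signedArea f := by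
  have hproj : UnivCover.proj ⁅a⁻¹, b⁻¹⁆ = α⁻¹ * β⁻¹ * α * β := by
    rw [map_commutatorElement, map_inv, map_inv, ha, hb, commutatorElement_def, inv_inv, inv_inv]
  have harea : signedArea f =
      turning ⁅a⁻¹, b⁻¹⁆ p + sideAngle p (UnivCover.proj ⁅a⁻¹, b⁻¹⁆ • p : UpperHalfPlane) := by
    rw [hf.signedArea_eq_sum, hproj, turning_commutator a b α β p ha hb]
  -- The first side of the pentagon is the geodesic from `p` to its image under the commutator, so
  -- the boundary data supply the geodesic along which the twist is measured.
  obtain ⟨P, φ, hP, -⟩ := hf.boundary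
  obtain ⟨h, ℓ, hg, -⟩ := hP.2 0
  have hg' : IsGeodesicFromTo h ℓ p (UnivCover.proj ⁅a⁻¹, b⁻¹⁆ • p) := by
    rw [hproj]
    exact hg
  refine ⟨hf.integrableOn_areaDensity, fun τ => ⟨fun hτ => ?_, ?_⟩⟩
  · rw [harea]
    exact hτ.eq_turning_add_sideAngle
  · rintro rfl
    rw [harea]
    exact isTwist_turning_add_sideAngle hg'
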